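/- Let $Q$ be a smooth (finite-dimensional, Hausdorff, second countable) manifold and $\tau_E:E\to Q$ a smooth real vector bundle of finite rank with an algebroid structure $(B_E,\rho^l_E,\rho^r_E)$: vector bundle morphisms $\rho^l_E,\rho^r_E:E\to TQ$ over the identity and an $\mathbb R$-bilinear bracket $B_E$ on $\Gamma(E)$ with $$B_E(f\sigma,f'\sigma')=f\,\rho^l_E(\sigma)(f')\,\sigma'-f'\rho^r_E(\sigma')(f)\,\sigma+ff'B_E(\sigma,\sigma').$$ Let $\tau:E^*\to Q$ be the dual bundle and $\widehat\gamma(\kappa)=\kappa(\gamma(\tau(\kappa)))$ for $\gamma\in\Gamma(E)$. (a) There is a unique $(2,0)$-tensor $\Pi_{E^*}$ on $E^*$ such that $\{\varphi,\psi\}=\Pi_{E^*}(d\varphi,d\psi)$ satisfies $\{\widehat\sigma,\widehat{\sigma'}\}=-\widehat{B_E(\sigma,\sigma')}$, $\{\widehat\sigma,f'\circ\tau\}=-\rho^l_E(\sigma)(f')\circ\tau$, $\{f\circ\tau,\widehat{\sigma'}\}=\rho^r_E(\sigma')(f)\circ\tau$, $\{f\circ\tau,f'\circ\tau\}=0$.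 For $H\in C^\infty(E^*)$ let $\mathcal H^{\Pi_{E^*}}_H$ be the vector field on $E^*$ with $\mathcal H^{\Pi_{E^*}}_H(F)=-\{H,F\}$ for all $F\in C^\infty(E^*)$. (b) There are a $\rho^l_E$-connection $D^l$ and a $\rho^r_E$-connection $D^r$ on $E$ with $B_E(\sigma,\sigma')=D^l_\sigma\sigma'-D^r_{\sigma'}\sigma$. (A $\rho$-connection is an $\mathbb R$-bilinear $D:\Gamma(E)\times\Gamma(E)\to\Gamma(E)$ with $D_{f\sigma}\gamma=fD_\sigma\gamma$ and $D_\sigma(g\gamma)=\rho(\sigma)(g)\gamma+gD_\sigma\gamma$.) Fix any such $D^l,D^r$ and any $(1,3)$-tensor $R$ on $E$. For a $\rho$-connection $D$, $\kappa\in E^*_q$ and $e\in E_q$, the horizontal lift $e^{D\mathbf h}_\kappa\in T_\kappa E^*$ is characterized by $e^{D\mathbf h}_\kappa(f\circ\tau)=\rho(e)(f)$, $e^{D\mathbf h}_\kappa(\widehat\gamma)=\kappa(D_e\gamma)$; the vertical lift of $\nu\in\Gamma(E^*)$ by $\nu^{\mathbf v}(f\circ\tau)=0$, $\nu^{\mathbf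 v}(\widehat\gamma)=\nu(\gamma)\circ\tau$; that of a $(1,1)$-tensor $P$ by $P^{\mathbf v}(f\circ\tau)=0$, $P^{\mathbf v}(\widehat\gamma)=\widehat{P\gamma}$. Put $(D_\sigma\nu)(\gamma)=\rho(\sigma)(\nu(\gamma))-\nu(D_\sigma\gamma)$. Let $\mathcal T=\mathcal T^E_lE^*\to E^*$ be the vector bundle with fibre $$\mathcal T_\kappa=\{(e,X)\in E_q\times T_\kappa E^*:\rho^l_E(e)=T_\kappa\tau(X)\},$$ and set $\sigma_l^{\mathbf h}=(\sigma\circ\tau,\sigma^{D^l\mathbf h})$, $\nu_l^{\mathbf v}=(0,\nu^{\mathbf v})$, $P_l^{\mathbf v}=(0,P^{\mathbf v})$. (c) $\mathcal T$ has a unique algebroid structure $(B_{\mathcal T},\rho^l_{\mathcal T},\rho^r_{\mathcal T})$ with $\rho^l_{\mathcal T}(e,X)=X$, $\rho^r_{\mathcal T}(e,X)=X-e^{D^l\mathbf h}_\kappa+e^{D^r\mathbf h}_\kappa$ for $(e,X)\in\mathcal T_\kappa$, and $B_{\mathcal T}(\sigma^{\mathbf h}_l,\sigma'^{\mathbf h}_l)=B_E(\sigma,\sigma')^{\mathbf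 h}_l+R(\sigma,\sigma',\cdot)^{\mathbf v}_l$, $B_{\mathcal T}(\sigma^{\mathbf h}_l,\nu^{\mathbf v}_l)=(D^l_\sigma\nu)^{\mathbf v}_l$, $B_{\mathcal T}(\mu^{\mathbf v}_l,\sigma'^{\mathbf h}_l)=-(D^r_{\sigma'}\mu)^{\mathbf v}_l$, $B_{\mathcal T}(\mu^{\mathbf v}_l,\nu^{\mathbf v}_l)=0$ for $\sigma,\sigma'\in\Gamma(E)$, $\mu,\nu\in\Gamma(E^*)$. (d) Let $\lambda(\kappa)(e,X)=\kappa(e)$ be the Liouville section of $\mathcal T^*$ and $\Omega=-d^{lr}\lambda$, where $(d^{lr}\lambda)(Z,Z')=\rho^l_{\mathcal T}(Z)(\lambda(Z'))-\rho^r_{\mathcal T}(Z')(\lambda(Z))-\lambda(B_{\mathcal T}(Z,Z'))$. Then $\Omega$ is skew-symmetric and nondegenerate, so that $\flat_\Omega:\Gamma(\mathcal T)\to\Gamma(\mathcal T^*)$, $Z\mapsto\Omega(Z,\cdot)$, is bijective. (e) For every smooth $H:E^*\to\mathbb R$, with $(d^rH)(Z)=\rho^r_{\mathcal T}(Z)(H)$,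 the left–right Hamiltonian vector field of $H$ with respect to $\Omega$ is the Hamiltonian vector field of $H$ with respect to $\Pi_{E^*}$: $$\rho^l_{\mathcal T}\bigl(\flat_\Omega^{-1}(d^rH)\bigr)=\mathcal H^{\Pi_{E^*}}_H .$$ -/

import Mathlib

open Bundle Manifold
open scoped ContDiff

noncomputable section

namespace LeibnizAlgebroid

section Generic

variable {EM : Type*} [NormedAddCommGroup EM] [NormedSpace ℝ EM]
  {HM : Type*} [TopologicalSpace HM] (I : ModelWithCorners ℝ EM HM)
  {M : Type*} [TopologicalSpace M] [ChartedSpace HM M]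

/-- The specification of the `C^∞(M)`-module of smooth sections of a family of real vector spaces
`W x`, `x : M`.  It is only used below for smooth vector bundles (`bundleSections`), and for a
subbundle of a smooth vector bundle, whose smooth sections are the smooth sections of the ambient
bundle with values in the subbundle (`leftTangentSections`). -/
structure SectionModule (W : M → Type*) [∀ x, AddCommGroup (W x)] [∀ x, Module ℝ (W x)] where
  carrier : Submodule ℝ (∀ x, W x)
  smul_mem : ∀ (f : C^∞⟮I, M; 𝓘(ℝ, ℝ), ℝ⟯) {s : ∀ x, W x}, s ∈ carrier →
    (fun x => f x • s x) ∈ carrier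

variable {I}

/-- `Γ(W)`, the space of smooth sections. -/
def SectionModule.Sec {W : M → Type*} [∀ x, AddCommGroup (W x)] [∀ x, Module ℝ (W x)]
    (S : SectionModule I W) : Type _ := ↥S.carrier

section module

variable {W : M → Type*} [∀ x, AddCommGroup (W x)] [∀ x, Module ℝ (W x)] (S : SectionModule I W)

instance SectionModule.instAddCommGroupSec : AddCommGroup S.Sec :=
  inferInstanceAs (AddCommGroup ↥S.carrier)

instance SectionModule.instRealModuleSec : Module ℝ S.Sec :=
  inferInstanceAs (Module ℝ ↥S.carrier)

/-- Sections are multiplied by functions pointwise. -/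
instance SectionModule.instSMulSec : SMul C^∞⟮I, M; 𝓘(ℝ, ℝ), ℝ⟯ S.Sec where
  smul f s := ⟨fun x => f x • s.1 x, S.smul_mem f s.2⟩

theorem SectionModule.smul_apply (f : C^∞⟮I, M; 𝓘(ℝ, ℝ), ℝ⟯) (s : S.Sec) (x : M) :
    (f • s).1 x = f x • s.1 x := rfl

instance SectionModule.instModuleSec : Module C^∞⟮I, M; 𝓘(ℝ, ℝ), ℝ⟯ S.Sec where
  one_smul s := Subtype.ext (funext fun x => one_smul ℝ (s.1 x))
  mul_smul f g s := Subtype.ext (funext fun x => mul_smul (f x) (g x) (s.1 x))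
  smul_zero f := Subtype.ext (funext fun x => smul_zero (f x))
  smul_add f s t := Subtype.ext (funext fun x => smul_add (f x) (s.1 x) (t.1 x))
  add_smul f g s := Subtype.ext (funext fun x => add_smul (f x) (g x) (s.1 x))
  zero_smul s := Subtype.ext (funext fun x => zero_smul ℝ (s.1 x))

end module

/-- The smooth sections of a smooth real vector bundle. -/
def bundleSections (I : ModelWithCorners ℝ EM HM)
    (F : Type*) [NormedAddCommGroup F] [NormedSpace ℝ F]
    (V : M → Type*) [∀ x, AddCommGroup (V x)] [∀ x, Module ℝ (V x)]
    [∀ x, TopologicalSpace (V x)] [TopologicalSpace (TotalSpace F V)]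
    [FiberBundle F V] [VectorBundle ℝ F V] : SectionModule I V where
  carrier :=
    { carrier := {s | ContMDiff I (I.prod 𝓘(ℝ, F)) ∞ (fun x => TotalSpace.mk' F x (s x))}
      add_mem' := fun hs ht => ContMDiff.add_section hs ht
      zero_mem' := contMDiff_zeroSection ℝ V
      smul_mem' := fun c _ hs => ContMDiff.const_smul_section (a := c) hs }
  smul_mem := fun f _ hs => ContMDiff.smul_section f.contMDiff hs

/-- The smooth vector fields on `M`. -/
abbrev vectorFields (I : ModelWithCorners ℝ EM HM) (M : Type*) [TopologicalSpace M]
    [ChartedSpace HM M] [IsManifold I ∞ M] : SectionModule I (fun x : M => TangentSpace I x) :=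
  bundleSections I EM (fun x : M => TangentSpace I x)

/-- The differential of a function, as a covector. -/
def covec (f : M → ℝ) (x : M) : Module.Dual ℝ (TangentSpace I x) :=
  (show TangentSpace I x →L[ℝ] ℝ from mfderiv I 𝓘(ℝ, ℝ) f x).toLinearMap

/-- The derivative `X(f)` of a smooth function along a smooth vector field. -/
def derivAlong [IsManifold I ∞ M] (X : (vectorFields I M).Sec) (f : C^∞⟮I, M; 𝓘(ℝ, ℝ), ℝ⟯) :
    C^∞⟮I, M; 𝓘(ℝ, ℝ), ℝ⟯ :=
  ⟨fun x => covec (I := I) f x (X.1 x), by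
    have h1 : ContMDiff I.tangent 𝓘(ℝ, ℝ).tangent ∞ (tangentMap I 𝓘(ℝ, ℝ) f) :=
      f.contMDiff.contMDiff_tangentMap (by simp)
    have h2 : ContMDiff I I.tangent ∞ (fun x => (⟨x, X.1 x⟩ : TangentBundle I M)) := X.2
    exact (contMDiff_snd_tangentBundle_modelSpace ℝ 𝓘(ℝ, ℝ)).comp (h1.comp h2)⟩


section derivAlong

variable [IsManifold I ∞ M]

theorem derivAlong_apply (X : (vectorFields I M).Sec) (f : C^∞⟮I, M; 𝓘(ℝ, ℝ), ℝ⟯) (x : M) :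
    derivAlong X f x = covec (I := I) f x (X.1 x) := rfl

theorem derivAlong_add_left (X Y : (vectorFields I M).Sec) (f : C^∞⟮I, M; 𝓘(ℝ, ℝ), ℝ⟯) :
    derivAlong (X + Y) f = derivAlong X f + derivAlong Y f :=
  ContMDiffMap.ext fun x => map_add (covec (I := I) f x) (X.1 x) (Y.1 x)

theorem derivAlong_smul_left (g : C^∞⟮I, M; 𝓘(ℝ, ℝ), ℝ⟯) (X : (vectorFields I M).Sec)
    (f : C^∞⟮I, M; 𝓘(ℝ, ℝ), ℝ⟯) : derivAlong (g • X) f = g * derivAlong X f :=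
  ContMDiffMap.ext fun x => map_smul (covec (I := I) f x) (g x) (X.1 x)

theorem derivAlong_add_right (X : (vectorFields I M).Sec) (f g : C^∞⟮I, M; 𝓘(ℝ, ℝ), ℝ⟯) :
    derivAlong X (f + g) = derivAlong X f + derivAlong X g := by
  refine ContMDiffMap.ext fun x => ?_
  have hf : MDifferentiableAt I 𝓘(ℝ, ℝ) f x := f.contMDiff.mdifferentiable (by simp) x
  have hg : MDifferentiableAt I 𝓘(ℝ, ℝ) g x := g.contMDiff.mdifferentiable (by simp) x
  have h := (hf.hasMFDerivAt.add hg.hasMFDerivAt).mfderiv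
  exact congrArg (fun L : TangentSpace I x →L[ℝ] ℝ => L (X.1 x)) h

theorem derivAlong_mul_right (X : (vectorFields I M).Sec) (f g : C^∞⟮I, M; 𝓘(ℝ, ℝ), ℝ⟯) :
    derivAlong X (f * g) = f * derivAlong X g + derivAlong X f * g := by
  refine ContMDiffMap.ext fun x => ?_
  have hf : MDifferentiableAt I 𝓘(ℝ, ℝ) f x := f.contMDiff.mdifferentiable (by simp) x
  have hg : MDifferentiableAt I 𝓘(ℝ, ℝ) g x := g.contMDiff.mdifferentiable (by simp) x
  have h := (hf.hasMFDerivAt.mul hg.hasMFDerivAt).mfderiv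
  have h2 := congrArg (fun L : TangentSpace I x →L[ℝ] ℝ => L (X.1 x)) h
  refine h2.trans ?_
  change f x * _ + g x * _ = f x * _ + _ * g x
  rw [mul_comm (g x)]
  rfl

end derivAlong

variable {W : M → Type*} [∀ x, AddCommGroup (W x)] [∀ x, Module ℝ (W x)]

/-- An anchor: a smooth vector bundle morphism `W → TM` over the identity of `M`. -/
@[ext]
structure Anchor [IsManifold I ∞ M] (S : SectionModule I W) where
  toFun : ∀ x, W x →ₗ[ℝ] TangentSpace I x
  smooth : ∀ s : S.Sec, (fun x => toFun x (s.1 x)) ∈ (vectorFields I M).carrier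

variable [IsManifold I ∞ M] {S : SectionModule I W}

/-- The vector field `ρ(σ)`. -/
def Anchor.field (ρ : Anchor S) (σ : S.Sec) : (vectorFields I M).Sec :=
  ⟨fun x => ρ.toFun x (σ.1 x), ρ.smooth σ⟩

/-- The function `ρ(σ)(f)`. -/
def Anchor.deriv (ρ : Anchor S) (σ : S.Sec) (f : C^∞⟮I, M; 𝓘(ℝ, ℝ), ℝ⟯) :
    C^∞⟮I, M; 𝓘(ℝ, ℝ), ℝ⟯ :=
  derivAlong (ρ.field σ) f

theorem Anchor.deriv_add_left (ρ : Anchor S) (σ τ : S.Sec) (f : C^∞⟮I, M; 𝓘(ℝ, ℝ), ℝ⟯) :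
    ρ.deriv (σ + τ) f = ρ.deriv σ f + ρ.deriv τ f := by
  have h : ρ.field (σ + τ) = ρ.field σ + ρ.field τ :=
    Subtype.ext (funext fun x => map_add (ρ.toFun x) (σ.1 x) (τ.1 x))
  rw [Anchor.deriv, h, derivAlong_add_left]; rfl

theorem Anchor.deriv_smul_left (ρ : Anchor S) (g : C^∞⟮I, M; 𝓘(ℝ, ℝ), ℝ⟯) (σ : S.Sec)
    (f : C^∞⟮I, M; 𝓘(ℝ, ℝ), ℝ⟯) : ρ.deriv (g • σ) f = g * ρ.deriv σ f := by
  have h : ρ.field (g • σ) = g • ρ.field σ :=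
    Subtype.ext (funext fun x => map_smul (ρ.toFun x) (g x) (σ.1 x))
  rw [Anchor.deriv, h, derivAlong_smul_left]; rfl

/-- An algebroid structure: a left anchor `l`, a right anchor `r` and an `ℝ`-bilinear bracket `B`
of sections, with a Leibniz rule. -/
@[ext]
structure Algebroid (S : SectionModule I W) where
  l : Anchor S
  r : Anchor S
  B : S.Sec →ₗ[ℝ] S.Sec →ₗ[ℝ] S.Sec
  leibniz : ∀ (f f' : C^∞⟮I, M; 𝓘(ℝ, ℝ), ℝ⟯) (σ σ' : S.Sec),
    B (f • σ) (f' • σ') =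
      (f * l.deriv σ f') • σ' - (f' * r.deriv σ' f) • σ + (f * f') • B σ σ'

/-- A `ρ`-connection `D`: `D_{fσ} γ = f D_σ γ` and `D_σ (g γ) = ρ(σ)(g) γ + g D_σ γ`. -/
structure Connection (ρ : Anchor S) where
  D : S.Sec →ₗ[ℝ] S.Sec →ₗ[ℝ] S.Sec
  smul_left : ∀ (f : C^∞⟮I, M; 𝓘(ℝ, ℝ), ℝ⟯) (σ γ : S.Sec), D (f • σ) γ = f • D σ γ
  leibniz : ∀ (g : C^∞⟮I, M; 𝓘(ℝ, ℝ), ℝ⟯) (σ γ : S.Sec),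
    D σ (g • γ) = ρ.deriv σ g • γ + g • D σ γ

/-- Sections of the dual bundle: a smooth section `κ` is the same thing as the `C^∞(M)`-linear map
`σ ↦ κ(σ)` from smooth sections to smooth functions. -/
abbrev SectionModule.DualSec (S : SectionModule I W) : Type _ :=
  Module.Dual C^∞⟮I, M; 𝓘(ℝ, ℝ), ℝ⟯ S.Sec

/-- Tensors of type `(0, 2)`, as `C^∞(M)`-bilinear maps on sections. -/
abbrev SectionModule.Tensor02 (S : SectionModule I W) : Type _ :=
  S.Sec →ₗ[C^∞⟮I, M; 𝓘(ℝ, ℝ), ℝ⟯] S.Sec →ₗ[C^∞⟮I, M; 𝓘(ℝ, ℝ), ℝ⟯] C^∞⟮I, M; 𝓘(ℝ, ℝ), ℝ⟯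

/-- Tensors of type `(1, 3)`, as `C^∞(M)`-trilinear maps on sections. -/
abbrev SectionModule.Tensor13 (S : SectionModule I W) : Type _ :=
  S.Sec →ₗ[C^∞⟮I, M; 𝓘(ℝ, ℝ), ℝ⟯] S.Sec →ₗ[C^∞⟮I, M; 𝓘(ℝ, ℝ), ℝ⟯]
    S.Sec →ₗ[C^∞⟮I, M; 𝓘(ℝ, ℝ), ℝ⟯] S.Sec

/-- The connection on the dual bundle: `(D_σ ν)(γ) = ρ(σ)(ν(γ)) - ν(D_σ γ)`. -/
def Connection.dual {ρ : Anchor S} (D : Connection ρ) (σ : S.Sec) (ν : S.DualSec) : S.DualSec where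
  toFun γ := ρ.deriv σ (ν γ) - ν (D.D σ γ)
  map_add' γ γ' := by
    rw [map_add, map_add, map_add, Anchor.deriv, derivAlong_add_right]
    simp only [Anchor.deriv]; abel
  map_smul' g γ := by
    rw [D.leibniz, map_smul, map_add, map_smul, map_smul, Anchor.deriv, smul_eq_mul,
      derivAlong_mul_right]
    simp only [Anchor.deriv, smul_eq_mul, RingHom.id_apply]; ring

namespace Algebroid

variable (A : Algebroid S)

/-- The right differential `(d^r F)(σ) = ρ^r(σ)(F)` of a function. -/
def dr (F : C^∞⟮I, M; 𝓘(ℝ, ℝ), ℝ⟯) : S.DualSec where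
  toFun σ := A.r.deriv σ F
  map_add' σ τ := A.r.deriv_add_left σ τ F
  map_smul' g σ := A.r.deriv_smul_left g σ F

theorem B_smul_left (f : C^∞⟮I, M; 𝓘(ℝ, ℝ), ℝ⟯) (σ σ' : S.Sec) :
    A.B (f • σ) σ' = f • A.B σ σ' - A.r.deriv σ' f • σ := by
  have h := A.leibniz f 1 σ σ'
  have h1 : A.l.deriv σ 1 = 0 := by
    have := derivAlong_mul_right (A.l.field σ) 1 1
    rw [mul_one, mul_one, one_mul] at this
    exact left_eq_add.mp this
  rw [one_smul, h1, mul_zero, zero_smul, zero_sub, one_mul, mul_one] at h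
  rw [h]; abel

theorem B_smul_right (f : C^∞⟮I, M; 𝓘(ℝ, ℝ), ℝ⟯) (σ σ' : S.Sec) :
    A.B σ (f • σ') = f • A.B σ σ' + A.l.deriv σ f • σ' := by
  have h := A.leibniz 1 f σ σ'
  have h1 : A.r.deriv σ' 1 = 0 := by
    have := derivAlong_mul_right (A.r.field σ') 1 1
    rw [mul_one, mul_one, one_mul] at this
    exact left_eq_add.mp this
  rw [one_smul, h1, mul_zero, zero_smul, sub_zero, one_mul, one_mul] at h
  rw [h]; abel

/-- The differential `(d^{lr} κ)(σ, σ') = ρ^l(σ)(κ(σ')) - ρ^r(σ')(κ(σ)) - κ(B(σ, σ'))` of a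
section `κ` of the dual bundle. -/
def dlr (κ : S.DualSec) : S.Tensor02 :=
  LinearMap.mk₂ _ (fun σ σ' => A.l.deriv σ (κ σ') - A.r.deriv σ' (κ σ) - κ (A.B σ σ'))
    (fun σ₁ σ₂ σ' => by
      rw [A.l.deriv_add_left, map_add, map_add, LinearMap.add_apply, map_add]
      simp only [Anchor.deriv, derivAlong_add_right]; abel)
    (fun f σ σ' => by
      rw [A.l.deriv_smul_left, A.B_smul_left, map_sub, map_smul, map_smul, map_smul]
      simp only [Anchor.deriv, smul_eq_mul, derivAlong_mul_right]; ring)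
    (fun σ σ₁ σ₂ => by
      rw [A.r.deriv_add_left, map_add, map_add, map_add]
      simp only [Anchor.deriv, derivAlong_add_right]; abel)
    (fun f σ σ' => by
      rw [A.r.deriv_smul_left, A.B_smul_right, map_add, map_smul, map_smul, map_smul]
      simp only [Anchor.deriv, smul_eq_mul, derivAlong_mul_right]; ring)

/-- `Ω = -d^{lr} λ`. -/
def omega (lam : S.DualSec) : S.Tensor02 := -A.dlr lam

/-- The section `lam` of the dual bundle makes the algebroid exact symplectic: the tensor
`Ω = -d^{lr} λ` is skew-symmetric and nondegenerate at every point. -/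
def IsExactSymplectic (lam : S.DualSec) : Prop :=
  (∀ X Y : S.Sec, A.omega lam X Y = -A.omega lam Y X) ∧
  ∀ (x : M) (X : S.Sec), (∀ Y : S.Sec, A.omega lam X Y x = 0) → X.1 x = 0

/-- The map `♭_Ω : Γ(W) → Γ(W^*)`, `X ↦ i_X Ω = Ω(X, ·)`. -/
def flat (lam : S.DualSec) : S.Sec →ₗ[C^∞⟮I, M; 𝓘(ℝ, ℝ), ℝ⟯] S.DualSec := A.omega lam

/-- The right Hamiltonian section `♭_Ω⁻¹(d^r H)`; this is meaningful when `♭_Ω` is bijective. -/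
def rightHamiltonianSection (lam : S.DualSec) (H : C^∞⟮I, M; 𝓘(ℝ, ℝ), ℝ⟯) : S.Sec :=
  Function.invFun (A.flat lam) (A.dr H)

/-- The left-right Hamiltonian vector field `ρ^l(♭_Ω⁻¹(d^r H))`. -/
def leftRightHamiltonianField (lam : S.DualSec) (H : C^∞⟮I, M; 𝓘(ℝ, ℝ), ℝ⟯) :
    (vectorFields I M).Sec :=
  A.l.field (A.rightHamiltonianSection lam H)

end Algebroid

end Generic

section Along

variable {EB : Type*} [NormedAddCommGroup EB] [NormedSpace ℝ EB]
  {Q : Type*} [TopologicalSpace Q] [ChartedSpace EB Q]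
  {F : Type*} [NormedAddCommGroup F] [NormedSpace ℝ F]
  {V : Q → Type*} [∀ x, AddCommGroup (V x)] [∀ x, Module ℝ (V x)]
  [∀ x, TopologicalSpace (V x)] [TopologicalSpace (TotalSpace F V)]
  [FiberBundle F V] [VectorBundle ℝ F V]

theorem contMDiff_add_along {N : Type*} [TopologicalSpace N]
    {EN : Type*} [NormedAddCommGroup EN] [NormedSpace ℝ EN]
    {HN : Type*} [TopologicalSpace HN] {J : ModelWithCorners ℝ EN HN} [ChartedSpace HN N]
    {g : N → Q} {a b : ∀ n, V (g n)}
    (ha : ContMDiff J (𝓘(ℝ, EB).prod 𝓘(ℝ, F)) ∞ fun n => TotalSpace.mk' F (g n) (a n))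
    (hb : ContMDiff J (𝓘(ℝ, EB).prod 𝓘(ℝ, F)) ∞ fun n => TotalSpace.mk' F (g n) (b n)) :
    ContMDiff J (𝓘(ℝ, EB).prod 𝓘(ℝ, F)) ∞ fun n => TotalSpace.mk' F (g n) (a n + b n) := by
  intro n
  have ha' := contMDiffAt_totalSpace.1 (ha n)
  have hb' := contMDiffAt_totalSpace.1 (hb n)
  refine contMDiffAt_totalSpace.2 ⟨ha'.1, (ha'.2.add hb'.2).congr_of_eventuallyEq ?_⟩
  set e := trivializationAt F V (g n)
  filter_upwards [ha'.1.continuousAt.preimage_mem_nhds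
    (e.open_baseSet.mem_nhds (FiberBundle.mem_baseSet_trivializationAt' (g n)))] with m hm
  exact (e.linear ℝ hm).1 _ _

theorem contMDiff_smul_along {N : Type*} [TopologicalSpace N]
    {EN : Type*} [NormedAddCommGroup EN] [NormedSpace ℝ EN]
    {HN : Type*} [TopologicalSpace HN] {J : ModelWithCorners ℝ EN HN} [ChartedSpace HN N]
    {g : N → Q} {f : N → ℝ} {a : ∀ n, V (g n)} (hf : ContMDiff J 𝓘(ℝ, ℝ) ∞ f)
    (ha : ContMDiff J (𝓘(ℝ, EB).prod 𝓘(ℝ, F)) ∞ fun n => TotalSpace.mk' F (g n) (a n)) :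
    ContMDiff J (𝓘(ℝ, EB).prod 𝓘(ℝ, F)) ∞ fun n => TotalSpace.mk' F (g n) (f n • a n) := by
  intro n
  have ha' := contMDiffAt_totalSpace.1 (ha n)
  refine contMDiffAt_totalSpace.2 ⟨ha'.1, ((hf n).smul ha'.2).congr_of_eventuallyEq ?_⟩
  set e := trivializationAt F V (g n)
  filter_upwards [ha'.1.continuousAt.preimage_mem_nhds
    (e.open_baseSet.mem_nhds (FiberBundle.mem_baseSet_trivializationAt' (g n)))] with m hm
  exact (e.linear ℝ hm).2 _ _

end Along

section DualBundle

variable {EB : Type*} [NormedAddCommGroup EB] [NormedSpace ℝ EB] [FiniteDimensional ℝ EB]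
  {Q : Type*} [TopologicalSpace Q] [ChartedSpace EB Q] [IsManifold 𝓘(ℝ, EB) ∞ Q]
  (F : Type*) [NormedAddCommGroup F] [NormedSpace ℝ F] [FiniteDimensional ℝ F]
  (V : Q → Type*) [∀ x, AddCommGroup (V x)] [∀ x, Module ℝ (V x)]
  [∀ x, TopologicalSpace (V x)] [TopologicalSpace (TotalSpace F V)]
  [FiberBundle F V] [VectorBundle ℝ F V] [ContMDiffVectorBundle ∞ F V 𝓘(ℝ, EB)]

/-- The total space of the dual bundle `E^*` of the vector bundle `E` with fibres `V x`. -/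
abbrev DualTotal : Type _ :=
  TotalSpace (F →L[ℝ] ℝ) (fun x : Q => V x →L[ℝ] Bundle.Trivial Q ℝ x)

/-- The model of `E^*`. -/
abbrev dualModel (EB F : Type*) [NormedAddCommGroup EB] [NormedSpace ℝ EB]
    [NormedAddCommGroup F] [NormedSpace ℝ F] :
    ModelWithCorners ℝ (EB × (F →L[ℝ] ℝ)) (ModelProd EB (F →L[ℝ] ℝ)) :=
  𝓘(ℝ, EB).prod 𝓘(ℝ, F →L[ℝ] ℝ)

variable {F V}

/-- The tangent space of `E^*` at `κ`. -/
abbrev DualTangent (κ : DualTotal F V) : Type _ := TangentSpace (dualModel EB F) κ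

instance (κ : DualTotal F V) : FiniteDimensional ℝ (DualTangent (EB := EB) κ) :=
  inferInstanceAs (FiniteDimensional ℝ (EB × (F →L[ℝ] ℝ)))

/-- The tangent map at `κ` of the projection `τ : E^* → Q`. -/
def projTangent (κ : DualTotal F V) :
    DualTangent (EB := EB) κ →ₗ[ℝ] TangentSpace 𝓘(ℝ, EB) κ.proj :=
  (mfderiv (dualModel EB F) 𝓘(ℝ, EB) (fun p : DualTotal F V => p.proj) κ).toLinearMap

/-- The linear function `γ̂ : E^* → ℝ`, `κ ↦ κ(γ(τ(κ)))`, of a section `γ` of `E`. -/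
def hat (γ : (bundleSections 𝓘(ℝ, EB) F V).Sec) (κ : DualTotal F V) : ℝ := κ.2 (γ.1 κ.proj)

/-- The tangent vector `v` to `E^*` at `κ` characterized by `v(f ∘ τ) = ξ(f)` for all
`f ∈ C^∞(Q)` and `v(γ̂) = c(γ)` for all sections `γ` of `E`. -/
def liftVector (κ : DualTotal F V) (ξ : TangentSpace 𝓘(ℝ, EB) κ.proj)
    (c : (bundleSections 𝓘(ℝ, EB) F V).Sec → ℝ) : DualTangent (EB := EB) κ :=
  Classical.epsilon fun v =>
    (∀ f : C^∞⟮𝓘(ℝ, EB), Q; 𝓘(ℝ, ℝ), ℝ⟯,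
      covec (I := dualModel EB F) (fun p : DualTotal F V => f p.proj) κ v =
        covec (I := 𝓘(ℝ, EB)) f κ.proj ξ) ∧
    ∀ γ, covec (I := dualModel EB F) (hat γ) κ v = c γ

/-- `(D_{σ_q} γ)(q)` for `σ_q ∈ E_q`: the value at `q` of `D_σ γ`, for any section `σ` with
`σ(q) = σ_q`. -/
def Connection.at {ρ : Anchor (bundleSections 𝓘(ℝ, EB) F V)} (D : Connection ρ) {q : Q}
    (e : V q) (γ : (bundleSections 𝓘(ℝ, EB) F V).Sec) : V q :=
  (D.D (Classical.epsilon fun σ => σ.1 q = e) γ).1 q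

/-- The horizontal lift of `e ∈ E_q` at `κ ∈ E^*_q`: the tangent vector `v` with
`v(f ∘ τ) = ρ(e)(f)` and `v(γ̂) = κ(D_e γ)`. -/
def Connection.hlift {ρ : Anchor (bundleSections 𝓘(ℝ, EB) F V)} (D : Connection ρ)
    (κ : DualTotal F V) (e : V κ.proj) : DualTangent (EB := EB) κ :=
  liftVector κ (ρ.toFun κ.proj e) fun γ => κ.2 (D.at e γ)

/-- The vertical lift at `κ` of a section `ν` of `E^*`: the tangent vector `v` with
`v(f ∘ τ) = 0` and `v(γ̂) = ν(γ)(τ(κ))`. -/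
def vlift (ν : (bundleSections 𝓘(ℝ, EB) F V).DualSec) (κ : DualTotal F V) :
    DualTangent (EB := EB) κ :=
  liftVector κ 0 fun γ => ν γ κ.proj

/-- The vertical lift at `κ` of a `(1, 1)`-tensor `P` on `E`: the tangent vector `v` with
`v(f ∘ τ) = 0` and `v(γ̂) = κ(P γ)`. -/
def tensorVlift (P : (bundleSections 𝓘(ℝ, EB) F V).Sec
      →ₗ[C^∞⟮𝓘(ℝ, EB), Q; 𝓘(ℝ, ℝ), ℝ⟯] (bundleSections 𝓘(ℝ, EB) F V).Sec)
    (κ : DualTotal F V) : DualTangent (EB := EB) κ :=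
  liftVector κ 0 fun γ => hat (P γ) κ

/-- The fibre at `κ` of the left `E`-tangent bundle to `E^*`: the pairs `(σ, X)` in
`E_q × T_κ E^*`, `q = τ(κ)`, with `ρ(σ) = Tτ(X)`. -/
def leftTangent (ρ : Anchor (bundleSections 𝓘(ℝ, EB) F V)) (κ : DualTotal F V) :
    Submodule ℝ (V κ.proj × DualTangent (EB := EB) κ) :=
  LinearMap.eqLocus ((ρ.toFun κ.proj).comp (LinearMap.fst ℝ _ _))
    ((projTangent κ).comp (LinearMap.snd ℝ _ _))

/-- The smooth sections `κ ↦ (a(κ), X(κ))` of the left `E`-tangent bundle to `E^*`, a subbundle of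
the sum of `τ^*E` and `TE^*`: the map `a : E^* → E` and the vector field `X` on `E^*` are smooth. -/
def leftTangentSections (ρ : Anchor (bundleSections 𝓘(ℝ, EB) F V)) :
    SectionModule (dualModel EB F) (fun κ : DualTotal F V => leftTangent ρ κ) where
  carrier :=
    { carrier := {Z |
        ContMDiff (dualModel EB F) (𝓘(ℝ, EB).prod 𝓘(ℝ, F)) ∞
          (fun κ : DualTotal F V => TotalSpace.mk' F κ.proj (Z κ).1.1) ∧
        (fun κ : DualTotal F V => (Z κ).1.2) ∈
          (vectorFields (dualModel EB F) (DualTotal F V)).carrier}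
      add_mem' := fun ha hb => ⟨contMDiff_add_along ha.1 hb.1,
        ((vectorFields (dualModel EB F) (DualTotal F V)).carrier).add_mem ha.2 hb.2⟩
      zero_mem' := ⟨(contMDiff_zeroSection ℝ V).comp (contMDiff_proj _),
        ((vectorFields (dualModel EB F) (DualTotal F V)).carrier).zero_mem⟩
      smul_mem' := fun c _ ha => ⟨contMDiff_smul_along contMDiff_const ha.1,
        ((vectorFields (dualModel EB F) (DualTotal F V)).carrier).smul_mem c ha.2⟩ }
  smul_mem := fun f _ ha => ⟨contMDiff_smul_along f.contMDiff ha.1,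
    (vectorFields (dualModel EB F) (DualTotal F V)).smul_mem f ha.2⟩

/-- The Liouville section: `λ(κ)(σ, X) = κ(σ)`. -/
def liouville (ρ : Anchor (bundleSections 𝓘(ℝ, EB) F V)) : (leftTangentSections ρ).DualSec where
  toFun Z := ⟨fun κ => κ.2 (Z.1 κ).1.1, by
    have h : ContMDiff (dualModel EB F) (𝓘(ℝ, EB).prod 𝓘(ℝ, ℝ)) ∞
        (fun κ : DualTotal F V =>
          TotalSpace.mk' ℝ (E := Bundle.Trivial Q ℝ) κ.proj (κ.2 (Z.1 κ).1.1)) :=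
      ContMDiff.clm_bundle_apply (b := fun κ : DualTotal F V => κ.proj) (ϕ := fun κ => κ.2)
        contMDiff_id Z.2.1
    exact fun κ => (contMDiffAt_totalSpace.1 (h κ)).2⟩
  map_add' Z Z' := ContMDiffMap.ext fun κ => map_add κ.2 (Z.1 κ).1.1 (Z'.1 κ).1.1
  map_smul' f Z := ContMDiffMap.ext fun κ => map_smul κ.2 (f κ) (Z.1 κ).1.1

/-- The section `Z` of the left `E`-tangent bundle is the `D`-horizontal lift of the section `σ`:
`Z(κ) = (σ(q), σ^{Dh}(κ))`. -/
def IsHorizontalLift {ρ : Anchor (bundleSections 𝓘(ℝ, EB) F V)} (D : Connection ρ)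
    (σ : (bundleSections 𝓘(ℝ, EB) F V).Sec) (Z : (leftTangentSections ρ).Sec) : Prop :=
  ∀ κ, (Z.1 κ).1 = (σ.1 κ.proj, D.hlift κ (σ.1 κ.proj))

/-- The section `Z` of the left `E`-tangent bundle is the vertical lift of the section `ν` of
`E^*`: `Z(κ) = (0, ν^v(κ))`. -/
def IsVerticalLift {ρ : Anchor (bundleSections 𝓘(ℝ, EB) F V)}
    (ν : (bundleSections 𝓘(ℝ, EB) F V).DualSec) (Z : (leftTangentSections ρ).Sec) : Prop :=
  ∀ κ, (Z.1 κ).1 = (0, vlift ν κ)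

/-- The algebroid structure `T` on the left `E`-tangent bundle to `E^*` is the one determined by
the algebroid structure `A` of `E`, the connections `Dl` and `Dr` and the `(1, 3)`-tensor `R`. -/
structure IsLifted (A : Algebroid (bundleSections 𝓘(ℝ, EB) F V))
    (Dl : Connection A.l) (Dr : Connection A.r)
    (R : (bundleSections 𝓘(ℝ, EB) F V).Tensor13)
    (T : Algebroid (leftTangentSections A.l)) : Prop where
  left_anchor : ∀ (κ : DualTotal F V) (z : leftTangent A.l κ), T.l.toFun κ z = z.1.2
  right_anchor : ∀ (κ : DualTotal F V) (z : leftTangent A.l κ),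
    T.r.toFun κ z = z.1.2 - Dl.hlift κ z.1.1 + Dr.hlift κ z.1.1
  bracket_hh : ∀ σ σ' Z Z', IsHorizontalLift Dl σ Z → IsHorizontalLift Dl σ' Z' →
    ∀ κ, ((T.B Z Z').1 κ).1 =
      ((A.B σ σ').1 κ.proj,
        Dl.hlift κ ((A.B σ σ').1 κ.proj) + tensorVlift (R σ σ') κ)
  bracket_hv : ∀ σ ν Z Z', IsHorizontalLift Dl σ Z → IsVerticalLift ν Z' →
    IsVerticalLift (Dl.dual σ ν) (T.B Z Z')
  bracket_vh : ∀ μ σ' Z Z', IsVerticalLift μ Z → IsHorizontalLift Dl σ' Z' →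
    IsVerticalLift (-Dr.dual σ' μ) (T.B Z Z')
  bracket_vv : ∀ (μ ν : (bundleSections 𝓘(ℝ, EB) F V).DualSec) Z Z',
    IsVerticalLift μ Z → IsVerticalLift ν Z' → T.B Z Z' = 0

/-- Tensors of type `(2, 0)` on `E^*` (at each point, a bilinear form on covectors). -/
abbrev Tensor20 (EB : Type*) [NormedAddCommGroup EB] [NormedSpace ℝ EB]
    {Q : Type*} [TopologicalSpace Q] [ChartedSpace EB Q]
    (F : Type*) [NormedAddCommGroup F] [NormedSpace ℝ F]
    (V : Q → Type*) [∀ x, AddCommGroup (V x)] [∀ x, Module ℝ (V x)]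
    [∀ x, TopologicalSpace (V x)] [TopologicalSpace (TotalSpace F V)]
    [FiberBundle F V] [VectorBundle ℝ F V] : Type _ :=
  ∀ κ : DualTotal F V, Module.Dual ℝ (DualTangent (EB := EB) κ) →ₗ[ℝ]
    Module.Dual ℝ (DualTangent (EB := EB) κ) →ₗ[ℝ] ℝ

/-- The bracket `{φ, ψ}_Π = Π(dφ, dψ)`. -/
def Tensor20.bracket (P : Tensor20 EB F V) (φ ψ : DualTotal F V → ℝ) (κ : DualTotal F V) : ℝ :=
  P κ (covec φ κ) (covec ψ κ)

/-- `P` is the linear `(2, 0)`-tensor `Π_{E^*}` on `E^*` induced by the algebroid structure.  As the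
covectors `d(f ∘ τ)` and `dγ̂` span every cotangent space of `E^*`, it is determined by these four
identities. -/
structure IsInducedTensor (A : Algebroid (bundleSections 𝓘(ℝ, EB) F V))
    (P : Tensor20 EB F V) : Prop where
  lin_lin : ∀ (σ σ' : (bundleSections 𝓘(ℝ, EB) F V).Sec) (κ : DualTotal F V),
    P.bracket (hat σ) (hat σ') κ = -hat (A.B σ σ') κ
  lin_base : ∀ (σ : (bundleSections 𝓘(ℝ, EB) F V).Sec) (f' : C^∞⟮𝓘(ℝ, EB), Q; 𝓘(ℝ, ℝ), ℝ⟯)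
    (κ : DualTotal F V),
    P.bracket (hat σ) (fun p => f' p.proj) κ = -A.l.deriv σ f' κ.proj
  base_lin : ∀ (f : C^∞⟮𝓘(ℝ, EB), Q; 𝓘(ℝ, ℝ), ℝ⟯) (σ' : (bundleSections 𝓘(ℝ, EB) F V).Sec)
    (κ : DualTotal F V),
    P.bracket (fun p => f p.proj) (hat σ') κ = A.r.deriv σ' f κ.proj
  base_base : ∀ (f f' : C^∞⟮𝓘(ℝ, EB), Q; 𝓘(ℝ, ℝ), ℝ⟯) (κ : DualTotal F V),
    P.bracket (fun p => f p.proj) (fun p => f' p.proj) κ = 0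

/-- The Hamiltonian vector field `ℋ_H^P` of `H`: `ℋ_H^P(κ)` is the tangent vector `X` with
`β(X) = -P(dH(κ), β)` for every covector `β` at `κ`, so that `ℋ_H^P(F) = -{H, F}_P`. -/
def hamiltonianField (P : Tensor20 EB F V) (H : DualTotal F V → ℝ) (κ : DualTotal F V) :
    DualTangent (EB := EB) κ :=
  -(Module.evalEquiv ℝ (DualTangent (EB := EB) κ)).symm (P κ (covec H κ))

end DualBundle

end LeibnizAlgebroid

end

/-!
Everything rests on the fact that the functions `f ∘ τ` (`pull f`) and `γ̂` (`hatFun γ`) on `E^*`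
have differentials that fill every cotangent space (`exists_covec_eq`): in the bundle chart around
a point, every linear function of the coordinates is such a sum. Consequently tangent vectors,
`(2, 0)`-tensors and the smoothness of vector fields are controlled by these functions
(`tangent_ext`, `covec_ext`, `mem_vectorFields_of`), and the lifts in the statement exist
(`exists_liftVector`). In particular the induced tensor is unique. Connections exist by a
partition of unity, and given a left connection `D^l`, the formula
`D^r_{σ'} σ = D^l_σ σ' - B(σ, σ')` defines a right one (`exists_connections`). With them the
induced tensor is `(α, β) ↦ α((β^v)^{D^r h}) - β((α^v)^{D^l h})`, where the restriction
`α^v ∈ E_q` of a covector to the vertical vectors is lifted back (`inducedTensor`).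

A section `(a, X)` of the left tangent bundle has two components: the map `ν ↦ ν(a)` from sections
of `E^*` to functions on `E^*` (`horPart`), and the map `γ ↦ X(γ̂) - κ(D^l_a γ)` from sections of
`E` to functions on `E^*` (`vertPart`). Both are linear over the functions on `Q`; they determine
the section and can be prescribed arbitrarily (`parts_injective`, `parts_surjective`). So the left
tangent bundle is identified with the pull-back of `E ⊕ E^*`, and `D^l`, `D^r` and their duals
pull back to operators `∇^l`, `∇^r` on the components (`nabla`). The lifted bracket is
`∇^l_Z Z' - ∇^r_{Z'} Z` with the contribution `κ(R(a, a', ·))` added to the vertical component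
(`bracket`). The Leibniz rule is then formal, and evaluation on horizontal and vertical lifts,
whose components are pulled back from `Q`, gives the required brackets
(`isLifted_liftedAlgebroid`). Up to a cut-off function every section is a combination of lifts of
a local frame and its dual (`lift_expansion`), so a tensorial object is determined by its values
on lifts. As the anchors are prescribed, the difference of two lifted brackets is tensorial,
whence uniqueness (`IsLifted.unique`).

By the same principle, `Ω` is computed on lifts: it pairs horizontal and vertical lifts by duality
and vanishes on pairs of vertical lifts and, because `B(σ, σ') = D^l_σ σ' - D^r_{σ'} σ`, on pairs
of horizontal ones. Thus `Ω(Z, ν^v)` and `-Ω(Z, σ^h)` are the components of `Z`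
(`IsLifted.omega_apply_vertLift`, `IsLifted.omega_apply_horLift`), from which nondegeneracy and
the bijectivity of `♭` follow. Finally, `♭ Z = d^r H` says that the components of `Z` are
`ν ↦ ν^v(H)` and `γ ↦ -γ^{D^r h}(H)`. Hence `a` is the vertical part of `dH`, and the derivatives
of `f ∘ τ` and `γ̂` along `X` agree with those along the Hamiltonian vector field of `H`
(`IsLifted.field_eq_of_flat`).
-/

noncomputable section

namespace LeibnizAlgebroid

set_option linter.unusedSectionVars false

open scoped Topology

section General

variable {EM : Type*} [NormedAddCommGroup EM] [NormedSpace ℝ EM]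
  {HM : Type*} [TopologicalSpace HM] {I : ModelWithCorners ℝ EM HM}
  {M : Type*} [TopologicalSpace M] [ChartedSpace HM M]

/-! ### Differentials of functions -/

theorem covec_congr {f g : M → ℝ} {x : M} (h : f =ᶠ[𝓝 x] g) :
    covec (I := I) f x = covec g x := by
  rw [covec, covec, h.mfderiv_eq]

theorem covec_const (r : ℝ) (x : M) :
    covec (I := I) (ContMDiffMap.const r : C^∞⟮I, M; 𝓘(ℝ, ℝ), ℝ⟯) x = 0 := by
  have : mfderiv I 𝓘(ℝ, ℝ) (fun _ : M => r) x = 0 := mfderiv_const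
  exact congrArg (fun L : TangentSpace I x →L[ℝ] ℝ => L.toLinearMap) this

theorem covec_add (f g : C^∞⟮I, M; 𝓘(ℝ, ℝ), ℝ⟯) (x : M) :
    covec (I := I) (f + g : C^∞⟮I, M; 𝓘(ℝ, ℝ), ℝ⟯) x = covec (I := I) f x + covec (I := I) g x := by
  have hf : MDifferentiableAt I 𝓘(ℝ, ℝ) f x := f.contMDiff.mdifferentiable (by simp) x
  have hg : MDifferentiableAt I 𝓘(ℝ, ℝ) g x := g.contMDiff.mdifferentiable (by simp) x
  have h := (hf.hasMFDerivAt.add hg.hasMFDerivAt).mfderiv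
  exact congrArg (fun L : TangentSpace I x →L[ℝ] ℝ => L.toLinearMap) h

theorem covec_mul (f g : C^∞⟮I, M; 𝓘(ℝ, ℝ), ℝ⟯) (x : M) :
    covec (I := I) (f * g : C^∞⟮I, M; 𝓘(ℝ, ℝ), ℝ⟯) x =
      f x • covec (I := I) g x + g x • covec (I := I) f x := by
  have hf : MDifferentiableAt I 𝓘(ℝ, ℝ) f x := f.contMDiff.mdifferentiable (by simp) x
  have hg : MDifferentiableAt I 𝓘(ℝ, ℝ) g x := g.contMDiff.mdifferentiable (by simp) x
  have h := (hf.hasMFDerivAt.mul hg.hasMFDerivAt).mfderiv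
  exact congrArg (fun L : TangentSpace I x →L[ℝ] ℝ => L.toLinearMap) h

/-- The differential of a coordinate function in the chart at `x₀`. -/
theorem covec_chart [IsManifold I ∞ M] {x₀ x : M} (hx : x ∈ (chartAt HM x₀).source)
    (ℓ : EM →L[ℝ] ℝ) (v : TangentSpace I x) :
    covec (I := I) (fun y => ℓ (extChartAt I x₀ y)) x v =
      ℓ (mfderiv I 𝓘(ℝ, EM) (extChartAt I x₀) x v) := by
  have : IsManifold I 1 M := IsManifold.of_le (n := ∞) (by simp)
  have h1 : MDifferentiableAt I 𝓘(ℝ, EM) (extChartAt I x₀) x := mdifferentiableAt_extChartAt hx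
  have h2 : MDifferentiableAt 𝓘(ℝ, EM) 𝓘(ℝ, ℝ) ℓ (extChartAt I x₀ x) :=
    ℓ.differentiableAt.mdifferentiableAt
  have h := mfderiv_comp x h2 h1
  have h3 : mfderiv 𝓘(ℝ, EM) 𝓘(ℝ, ℝ) ℓ (extChartAt I x₀ x) = ℓ := by
    rw [mfderiv_eq_fderiv]; exact ℓ.fderiv
  rw [h3] at h
  exact congrArg (fun L : TangentSpace I x →L[ℝ] ℝ => L v) h

/-! ### Pointwise algebra of sections -/

variable {W : M → Type*} [∀ x, AddCommGroup (W x)] [∀ x, Module ℝ (W x)] {S : SectionModule I W}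

/-- A section given by a family of vectors that is known to be smooth. -/
def SectionModule.ofMem (S : SectionModule I W) (s : ∀ x, W x) (hs : s ∈ S.carrier) : S.Sec :=
  ⟨s, hs⟩

theorem SectionModule.ofMem_apply (s : ∀ x, W x) (hs : s ∈ S.carrier) (x : M) :
    (S.ofMem s hs).1 x = s x := rfl

theorem SectionModule.ext_apply {s t : S.Sec} (h : ∀ x, s.1 x = t.1 x) : s = t :=
  Subtype.ext (funext h)

theorem SectionModule.add_apply (s t : S.Sec) (x : M) : (s + t).1 x = s.1 x + t.1 x := rfl

theorem SectionModule.zero_apply (x : M) : (0 : S.Sec).1 x = 0 := rfl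

theorem SectionModule.real_smul_apply (c : ℝ) (s : S.Sec) (x : M) : (c • s).1 x = c • s.1 x := rfl

theorem SectionModule.sum_apply {ι : Type*} (t : Finset ι) (s : ι → S.Sec) (x : M) :
    (∑ i ∈ t, s i).1 x = ∑ i ∈ t, (s i).1 x :=
  map_sum (⟨⟨fun s : S.Sec => s.1 x, rfl⟩, fun _ _ => rfl⟩ : S.Sec →+ W x) _ _

/-! ### Anchors and brackets -/

variable [IsManifold I ∞ M]

theorem Anchor.deriv_add_right (a : Anchor S) (s : S.Sec) (f g : C^∞⟮I, M; 𝓘(ℝ, ℝ), ℝ⟯) :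
    a.deriv s (f + g) = a.deriv s f + a.deriv s g := derivAlong_add_right _ f g

theorem Anchor.deriv_mul_right (a : Anchor S) (s : S.Sec) (f g : C^∞⟮I, M; 𝓘(ℝ, ℝ), ℝ⟯) :
    a.deriv s (f * g) = f * a.deriv s g + a.deriv s f * g := derivAlong_mul_right _ f g

theorem Anchor.deriv_const (a : Anchor S) (s : S.Sec) (r : ℝ) :
    a.deriv s (ContMDiffMap.const r) = 0 :=
  ContMDiffMap.ext fun x => by
    change covec (I := I) (ContMDiffMap.const r : C^∞⟮I, M; 𝓘(ℝ, ℝ), ℝ⟯) x _ = 0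
    rw [covec_const, LinearMap.zero_apply]

theorem Anchor.deriv_zero_right (a : Anchor S) (s : S.Sec) : a.deriv s 0 = 0 :=
  a.deriv_const s 0

theorem Algebroid.omega_apply (T : Algebroid S) (lam : S.DualSec) (Z Z' : S.Sec) :
    T.omega lam Z Z' = -(T.l.deriv Z (lam Z') - T.r.deriv Z' (lam Z) - lam (T.B Z Z')) := rfl

variable {T T' : Algebroid S}

/-- The difference of the brackets of two algebroid structures with the same left anchor is
linear over the functions in the second argument. -/
def bracketSubRight (hl : T.l = T'.l) (Z : S.Sec) : S.Sec →ₗ[C^∞⟮I, M; 𝓘(ℝ, ℝ), ℝ⟯] S.Sec where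
  toFun Z' := T.B Z Z' - T'.B Z Z'
  map_add' Y Y' := by rw [map_add, map_add, add_sub_add_comm]
  map_smul' g Y := by
    rw [T.B_smul_right, T'.B_smul_right, hl, RingHom.id_apply, smul_sub, add_sub_add_right_eq_sub]

/-- The difference of the brackets of two algebroid structures with the same right anchor is
linear over the functions in the first argument. -/
def bracketSubLeft (hr : T.r = T'.r) (Z' : S.Sec) : S.Sec →ₗ[C^∞⟮I, M; 𝓘(ℝ, ℝ), ℝ⟯] S.Sec where
  toFun Z := T.B Z Z' - T'.B Z Z'
  map_add' Y Y' := by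
    rw [map_add, map_add, LinearMap.add_apply, LinearMap.add_apply, add_sub_add_comm]
  map_smul' g Y := by
    rw [T.B_smul_left, T'.B_smul_left, hr, RingHom.id_apply, smul_sub, sub_sub_sub_cancel_right]

end General

section DualBundle

variable {EB : Type*} [NormedAddCommGroup EB] [NormedSpace ℝ EB] [FiniteDimensional ℝ EB]
  {Q : Type*} [TopologicalSpace Q] [T2Space Q] [ChartedSpace EB Q] [IsManifold 𝓘(ℝ, EB) ∞ Q]
  {F : Type*} [NormedAddCommGroup F] [NormedSpace ℝ F] [FiniteDimensional ℝ F]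
  {V : Q → Type*} [∀ x, AddCommGroup (V x)] [∀ x, Module ℝ (V x)]
  [∀ x, TopologicalSpace (V x)] [TopologicalSpace (TotalSpace F V)]
  [FiberBundle F V] [VectorBundle ℝ F V] [ContMDiffVectorBundle ∞ F V 𝓘(ℝ, EB)]

local notation "CQ" => C^∞⟮𝓘(ℝ, EB), Q; 𝓘(ℝ, ℝ), ℝ⟯
local notation "CE" => C^∞⟮dualModel EB F, DualTotal F V; 𝓘(ℝ, ℝ), ℝ⟯
local notation "ΓE" => SectionModule.Sec (bundleSections 𝓘(ℝ, EB) F V)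
local notation "ΓE'" => SectionModule.DualSec (bundleSections 𝓘(ℝ, EB) F V)
local notation "ΓE⋆" => ΓE →ₗ[CQ] CE

-- Shortcuts for instance search, which otherwise unfolds the total space of the dual bundle.
local instance instTopologicalSpaceDual : TopologicalSpace (DualTotal F V) := inferInstance

local instance instChartedSpaceDual :
    ChartedSpace (ModelProd EB (F →L[ℝ] ℝ)) (DualTotal F V) := inferInstance

local instance instIsManifoldDual : IsManifold (dualModel EB F) ∞ (DualTotal F V) :=
  inferInstance

local instance instNormedSpaceDualModel : NormedSpace ℝ (EB × (F →L[ℝ] ℝ)) := inferInstance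

/-! ### Cut-off local frames -/

section LocalFrames

theorem exists_bump {q : Q} {s : Set Q} (hs : s ∈ 𝓝 q) :
    ∃ ψ : CQ, (∀ᶠ x in 𝓝 q, ψ x = 1) ∧ tsupport ψ ⊆ s := by
  obtain ⟨f, -, hf⟩ := ((SmoothBumpFunction.nhds_basis_tsupport (I := 𝓘(ℝ, EB)) q).mem_iff).1 hs
  exact ⟨⟨f, f.contMDiff⟩, f.eventuallyEq_one, hf⟩

variable (F V) in
theorem exists_frameBump (q : Q) : ∃ ψ : CQ, (∀ᶠ x in 𝓝 q, ψ x = 1) ∧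
    tsupport ψ ⊆ (trivializationAt F V q).baseSet :=
  exists_bump ((trivializationAt F V q).open_baseSet.mem_nhds
    (FiberBundle.mem_baseSet_trivializationAt' q))

variable (EB F V) in
/-- A bump function at `q`, supported where the preferred trivialization at `q` is defined. -/
def frameBump (q : Q) : CQ := (exists_frameBump F V q).choose

theorem frameBump_eventually (q : Q) : ∀ᶠ x in 𝓝 q, frameBump EB F V q x = 1 :=
  (exists_frameBump F V q).choose_spec.1

theorem frameBump_self (q : Q) : frameBump EB F V q q = 1 := (frameBump_eventually q).self_of_nhds

theorem tsupport_frameBump (q : Q) :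
    tsupport (frameBump EB F V q) ⊆ (trivializationAt F V q).baseSet :=
  (exists_frameBump F V q).choose_spec.2

theorem frameBump_eq_zero {q x : Q} (hx : x ∉ (trivializationAt F V q).baseSet) :
    frameBump EB F V q x = 0 :=
  image_eq_zero_of_notMem_tsupport fun h => hx (tsupport_frameBump q h)

theorem frameSec_smooth (q : Q) (w : F) :
    (fun x => frameBump EB F V q x • (trivializationAt F V q).symmₗ ℝ x w) ∈
      (bundleSections 𝓘(ℝ, EB) F V).carrier := by
  set e := trivializationAt F V q
  refine ContMDiffOn.smul_section_of_tsupport (s := fun x => e.symmₗ ℝ x w)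
    (frameBump EB F V q).contMDiff.contMDiffOn e.open_baseSet (tsupport_frameBump q) ?_
  rw [e.contMDiffOn_section_baseSet_iff]
  refine (contMDiffOn_const (c := w)).congr fun y hy => ?_
  rw [e.symmₗ_apply hy, e.apply_mk_symm hy]

variable (EB F V) in
/-- The global section which, near `q`, is constantly `w` in the preferred trivialization. -/
def frameSec (q : Q) : F →ₗ[ℝ] ΓE where
  toFun w := SectionModule.ofMem _ _ (frameSec_smooth q w)
  map_add' v w := SectionModule.ext_apply fun x => by
    rw [SectionModule.add_apply]
    simp only [SectionModule.ofMem_apply, map_add, smul_add]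
  map_smul' c w := SectionModule.ext_apply fun x => by
    rw [RingHom.id_apply, SectionModule.real_smul_apply]
    simp only [SectionModule.ofMem_apply, map_smul, smul_comm c]

theorem frameSec_apply (q : Q) (w : F) (x : Q) : (frameSec EB F V q w).1 x =
    frameBump EB F V q x • (trivializationAt F V q).symmₗ ℝ x w := rfl

variable (EB F V) in
/-- The coordinates in the preferred trivialization at `q`, cut off away from `q`. -/
def frameCoord (q x : Q) : V x →ₗ[ℝ] F :=
  frameBump EB F V q x • (trivializationAt F V q).linearMapAt ℝ x

theorem frameSec_frameCoord (q x : Q) (v : V x) :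
    (frameSec EB F V q (frameCoord EB F V q x v)).1 x =
      (frameBump EB F V q * frameBump EB F V q) x • v := by
  rw [frameSec_apply, frameCoord, LinearMap.smul_apply, map_smul, smul_smul]
  by_cases hx : x ∈ (trivializationAt F V q).baseSet
  · rw [Bundle.Trivialization.symmₗ_linearMapAt _ hx]; rfl
  · change _ = (frameBump EB F V q x * frameBump EB F V q x) • v
    rw [frameBump_eq_zero hx]; simp

/-- The cut-off coordinates of a smooth map into the total space of `E` are smooth. -/
theorem contMDiff_frameCoord (q : Q) {N : Type*} [TopologicalSpace N]
    {EN : Type*} [NormedAddCommGroup EN] [NormedSpace ℝ EN]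
    {HN : Type*} [TopologicalSpace HN] {J : ModelWithCorners ℝ EN HN} [ChartedSpace HN N]
    {g : N → Q} {a : ∀ n, V (g n)}
    (ha : ContMDiff J (𝓘(ℝ, EB).prod 𝓘(ℝ, F)) ∞ fun n => TotalSpace.mk' F (g n) (a n)) :
    ContMDiff J 𝓘(ℝ, F) ∞ fun n => frameCoord EB F V q (g n) (a n) := by
  set e := trivializationAt F V q
  have hg : ContMDiff J 𝓘(ℝ, EB) ∞ g := (contMDiff_proj V).comp ha
  have hψ : ContMDiff J 𝓘(ℝ, ℝ) ∞ fun n => frameBump EB F V q (g n) :=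
    (frameBump EB F V q).contMDiff.comp hg
  intro n
  by_cases hn : g n ∈ tsupport (frameBump EB F V q)
  · have hn' := tsupport_frameBump q hn
    have h2 : ContMDiffAt J 𝓘(ℝ, F) ∞ (fun n => (e (TotalSpace.mk' F (g n) (a n))).2) n :=
      ((e.contMDiffAt_iff (f := fun n => TotalSpace.mk' F (g n) (a n))
        (by rwa [e.mem_source])).1 (ha n)).2
    refine ((hψ n).smul h2).congr_of_eventuallyEq ?_
    filter_upwards [hg.continuous.continuousAt.preimage_mem_nhds (e.open_baseSet.mem_nhds hn')]
      with m hm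
    rw [frameCoord, LinearMap.smul_apply, e.coe_linearMapAt_of_mem hm]; rfl
  · refine (contMDiffAt_const (c := (0 : F))).congr_of_eventuallyEq ?_
    filter_upwards [hg.continuous.continuousAt.preimage_mem_nhds
      ((isClosed_tsupport _).isOpen_compl.mem_nhds hn)] with m hm
    rw [frameCoord, image_eq_zero_of_notMem_tsupport hm, zero_smul, LinearMap.zero_apply]

variable (EB F V) in
/-- The section of the dual bundle attached to a linear form on the model fibre, by means of the
cut-off coordinates at `q`. -/
def frameDual (q : Q) (φ : Module.Dual ℝ F) : ΓE' where
  toFun γ := ⟨fun x => φ (frameCoord EB F V q x (γ.1 x)),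
    φ.toContinuousLinearMap.contMDiff.comp (contMDiff_frameCoord q γ.2)⟩
  map_add' γ γ' := ContMDiffMap.ext fun x => by
    change φ (frameCoord EB F V q x (γ.1 x + γ'.1 x)) = φ _ + φ _
    rw [map_add, map_add]
  map_smul' f γ := ContMDiffMap.ext fun x => by
    change φ (frameCoord EB F V q x (f x • γ.1 x)) = f x * φ _
    rw [map_smul, map_smul, smul_eq_mul]

theorem frameDual_apply (q : Q) (φ : Module.Dual ℝ F) (γ : ΓE) (x : Q) :
    frameDual EB F V q φ γ x = φ (frameCoord EB F V q x (γ.1 x)) := rfl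

variable (EB F V) in
/-- The members of the cut-off frame at `q`. -/
def frame (q : Q) (i : Fin (Module.finrank ℝ F)) : ΓE :=
  frameSec EB F V q (Module.finBasis ℝ F i)

variable (EB F V) in
/-- The members of the cut-off dual frame at `q`. -/
def coframe (q : Q) (i : Fin (Module.finrank ℝ F)) : ΓE' :=
  frameDual EB F V q ((Module.finBasis ℝ F).coord i)

variable (EB F V) in
/-- The function by which a section is multiplied when it is expanded in the cut-off frame at
`q`.  The bump function is squared because both the frame and the coordinates are cut off. -/
def frameCut (q : Q) : CQ := frameBump EB F V q * frameBump EB F V q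

theorem frameCut_eventually (q : Q) : ∀ᶠ x in 𝓝 q, frameCut EB F V q x = 1 := by
  filter_upwards [frameBump_eventually (EB := EB) (F := F) (V := V) q] with x hx
  change frameBump EB F V q x * frameBump EB F V q x = 1
  rw [hx, one_mul]

theorem frameCut_self (q : Q) : frameCut EB F V q q = 1 := (frameCut_eventually q).self_of_nhds

theorem sum_coord_smul_frame (q x : Q) (v : V x) :
    ∑ i, (Module.finBasis ℝ F).coord i (frameCoord EB F V q x v) • (frame EB F V q i).1 x =
      frameCut EB F V q x • v := by
  refine Eq.trans ?_ (frameSec_frameCoord q x v)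
  conv_rhs => rw [← (Module.finBasis ℝ F).sum_repr (frameCoord EB F V q x v), map_sum,
    SectionModule.sum_apply]
  refine Finset.sum_congr rfl fun i _ => ?_
  rw [map_smul, SectionModule.real_smul_apply]
  rfl

/-- Every section, once cut off, is a combination of the members of the frame. -/
theorem frame_expansion (q : Q) (γ : ΓE) :
    ∑ i, coframe EB F V q i γ • frame EB F V q i = frameCut EB F V q • γ := by
  refine SectionModule.ext_apply fun x => ?_
  rw [SectionModule.sum_apply]
  exact sum_coord_smul_frame q x (γ.1 x)

/-- Every section of the dual bundle, once cut off, is a combination of the members of the dual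
frame. -/
theorem coframe_expansion (q : Q) (ν : ΓE') :
    ∑ i, ν (frame EB F V q i) • coframe EB F V q i = frameCut EB F V q • ν := by
  ext1 γ
  rw [LinearMap.smul_apply, ← map_smul, ← frame_expansion, map_sum, LinearMap.sum_apply]
  simp only [map_smul, LinearMap.smul_apply, smul_eq_mul, mul_comm]

/-- Through every vector passes a smooth section. -/
theorem exists_sec (q : Q) (v : V q) : ∃ γ : ΓE, γ.1 q = v :=
  ⟨frameSec EB F V q (frameCoord EB F V q q v), by
    rw [frameSec_frameCoord]
    change (frameBump EB F V q q * frameBump EB F V q q) • v = v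
    rw [frameBump_self]; simp⟩

/-- A map which is linear over the functions, after evaluation at a point, only depends on the
coordinates of its argument at that point. -/
theorem tensorial_eq_sum {q : Q} {G : Type*} [AddCommGroup G] [Module ℝ G] {c : ΓE → G}
    (hadd : ∀ γ γ', c (γ + γ') = c γ + c γ') (hsmul : ∀ (f : CQ) γ, c (f • γ) = f q • c γ)
    (γ : ΓE) :
    c γ = ∑ i, coframe EB F V q i γ q • c (frame EB F V q i) := by
  have h := hsmul (frameCut EB F V q) γ
  rw [frameCut_self, one_smul, ← frame_expansion] at h
  rw [← h]
  refine (map_sum (AddMonoidHom.mk' c hadd) _ _).trans ?_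
  exact Finset.sum_congr rfl fun i _ => hsmul _ _

theorem tensorial_congr {q : Q} {G : Type*} [AddCommGroup G] [Module ℝ G] {c : ΓE → G}
    (hadd : ∀ γ γ', c (γ + γ') = c γ + c γ') (hsmul : ∀ (f : CQ) γ, c (f • γ) = f q • c γ)
    {γ γ' : ΓE} (h : γ.1 q = γ'.1 q) : c γ = c γ' := by
  rw [tensorial_eq_sum hadd hsmul γ, tensorial_eq_sum hadd hsmul γ']
  refine Finset.sum_congr rfl fun i _ => ?_
  rw [coframe, frameDual_apply, frameDual_apply, h]

/-- A vector killed by the whole dual bundle vanishes. -/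
theorem eq_zero_of_dual {q : Q} {γ : ΓE} (h : ∀ ν : ΓE', ν γ q = 0) : γ.1 q = 0 := by
  have h1 := sum_coord_smul_frame (EB := EB) (F := F) q q (γ.1 q)
  rw [frameCut_self, one_smul] at h1
  rw [← h1]
  exact Finset.sum_eq_zero fun i _ => by
    have := h (coframe EB F V q i)
    rw [coframe, frameDual_apply] at this
    rw [this, zero_smul]

end LocalFrames

/-! ### The cotangent and the tangent spaces of the dual bundle -/

section CotangentSpaces

/-- The function `f ∘ τ` on the dual bundle. -/
def pull (f : CQ) : CE := ⟨fun κ => f κ.proj, f.contMDiff.comp (contMDiff_proj _)⟩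

theorem pull_apply (f : CQ) (κ : DualTotal F V) : pull f κ = f κ.proj := rfl

/-- A smooth map `a : E^* → E` over `Q` can be paired with the tautological covector. -/
theorem contMDiff_tautological {a : ∀ κ : DualTotal F V, V κ.proj}
    (ha : ContMDiff (dualModel EB F) (𝓘(ℝ, EB).prod 𝓘(ℝ, F)) ∞
      fun κ : DualTotal F V => TotalSpace.mk' F κ.proj (a κ)) :
    ContMDiff (dualModel EB F) 𝓘(ℝ, ℝ) ∞ fun κ : DualTotal F V => (show ℝ from κ.2 (a κ)) := by
  have h : ContMDiff (dualModel EB F) (𝓘(ℝ, EB).prod 𝓘(ℝ, ℝ)) ∞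
      (fun κ : DualTotal F V =>
        TotalSpace.mk' ℝ (E := Bundle.Trivial Q ℝ) κ.proj (κ.2 (a κ))) :=
    ContMDiff.clm_bundle_apply (b := fun κ : DualTotal F V => κ.proj) (ϕ := fun κ => κ.2)
      contMDiff_id ha
  exact fun κ => (contMDiffAt_totalSpace.1 (h κ)).2

theorem contMDiff_sec_comp_proj (γ : ΓE) :
    ContMDiff (dualModel EB F) (𝓘(ℝ, EB).prod 𝓘(ℝ, F)) ∞
      fun κ : DualTotal F V => TotalSpace.mk' F κ.proj (γ.1 κ.proj) :=
  ContMDiff.comp (g := fun x => TotalSpace.mk' F x (γ.1 x)) γ.2 (contMDiff_proj _)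

/-- The linear function `γ̂` as a smooth function. -/
def hatFun (γ : ΓE) : CE := ⟨hat γ, contMDiff_tautological (contMDiff_sec_comp_proj γ)⟩

theorem hatFun_apply (γ : ΓE) (κ : DualTotal F V) : hatFun γ κ = κ.2 (γ.1 κ.proj) := rfl

theorem hatFun_add (γ γ' : ΓE) : hatFun (γ + γ') = hatFun γ + hatFun γ' :=
  ContMDiffMap.ext fun κ => map_add κ.2 (γ.1 κ.proj) (γ'.1 κ.proj)

theorem hatFun_smul (f : CQ) (γ : ΓE) : hatFun (f • γ) = pull f * hatFun γ :=
  ContMDiffMap.ext fun κ => map_smul κ.2 (f κ.proj) (γ.1 κ.proj)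

theorem covec_pull (f : CQ) (κ : DualTotal F V) (v : DualTangent (EB := EB) κ) :
    covec (I := dualModel EB F) (pull f) κ v =
      covec (I := 𝓘(ℝ, EB)) f κ.proj (projTangent κ v) := by
  have h1 : MDifferentiableAt (dualModel EB F) 𝓘(ℝ, EB) (fun p : DualTotal F V => p.proj) κ :=
    (contMDiff_proj (n := ∞) _).mdifferentiable (by simp) κ
  have h2 : MDifferentiableAt 𝓘(ℝ, EB) 𝓘(ℝ, ℝ) f κ.proj :=
    f.contMDiff.mdifferentiable (by simp) _
  have h := mfderiv_comp κ h2 h1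
  exact congrArg (fun L : DualTangent (EB := EB) κ →L[ℝ] ℝ => L v) h

theorem exists_fun_eventuallyEq_chart (q : Q) (ℓ : EB →L[ℝ] ℝ) :
    ∃ f : CQ, ∀ᶠ x in 𝓝 q, f x = ℓ (extChartAt 𝓘(ℝ, EB) q x) := by
  obtain ⟨ψ, hψ, hs⟩ := exists_bump (EB := EB) (chart_source_mem_nhds EB q)
  refine ⟨⟨fun x => ψ x * ℓ (extChartAt 𝓘(ℝ, EB) q x), ?_⟩, ?_⟩
  · refine contMDiff_of_tsupport fun x hx => ?_
    have hx' := hs (tsupport_mul_subset_left hx)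
    exact (ψ.contMDiff x).mul (ℓ.contMDiff.contMDiffAt.comp x (contMDiffAt_extChartAt' hx'))
  · filter_upwards [hψ] with x hx
    change ψ x * _ = _
    rw [hx, one_mul]

theorem extChartAt_dual_fst (κ₀ κ : DualTotal F V) :
    (extChartAt (dualModel EB F) κ₀ κ).1 = extChartAt 𝓘(ℝ, EB) κ₀.proj κ.proj := by
  rw [FiberBundle.extChartAt]
  rfl

/-- The fibre coordinates of the chart of `E^*` are the values on sections that are constant in the
trivialization. -/
theorem extChartAt_dual_snd (κ₀ : DualTotal F V) (w : F) :
    ∀ᶠ κ : DualTotal F V in 𝓝 κ₀,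
      hat (frameSec EB F V κ₀.proj w) κ = (extChartAt (dualModel EB F) κ₀ κ).2 w := by
  have hp : ContinuousAt (fun κ : DualTotal F V => κ.proj) κ₀ :=
    (FiberBundle.continuous_proj _ _).continuousAt
  filter_upwards [hp.eventually (frameBump_eventually (EB := EB) (F := F) (V := V) κ₀.proj),
    hp.preimage_mem_nhds ((trivializationAt F V κ₀.proj).open_baseSet.mem_nhds
      (FiberBundle.mem_baseSet_trivializationAt' κ₀.proj))] with κ h1 h2
  rw [FiberBundle.extChartAt, hat, frameSec_apply, h1, one_smul]
  rw [Bundle.Trivialization.symmₗ_apply _ h2]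
  have := congrArg Prod.snd (hom_trivializationAt_apply (RingHom.id ℝ) κ₀.proj κ)
  change _ = ((trivializationAt (F →L[ℝ] ℝ) (fun x : Q => V x →L[ℝ] Bundle.Trivial Q ℝ x)
    κ₀.proj) κ).2 w
  rw [this]
  simp only [ContinuousLinearMap.inCoordinates]
  rw [ContinuousLinearMap.comp_apply, ContinuousLinearMap.comp_apply,
    Bundle.Trivialization.symmL_apply _ h2]
  simp

theorem covec_hatFun_smul (f : CQ) (γ : ΓE) (κ : DualTotal F V) (v : DualTangent (EB := EB) κ) :
    covec (I := dualModel EB F) (hatFun (f • γ)) κ v =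
      covec (I := 𝓘(ℝ, EB)) f κ.proj (projTangent κ v) * κ.2 (γ.1 κ.proj) +
        f κ.proj * covec (I := dualModel EB F) (hatFun γ) κ v := by
  rw [hatFun_smul, covec_mul, LinearMap.add_apply, LinearMap.smul_apply, LinearMap.smul_apply,
    covec_pull, smul_eq_mul, smul_eq_mul, pull_apply, hatFun_apply, add_comm]
  congr 1
  exact mul_comm _ _

/-- The differential at `κ` of the chart of `E^*` around `κ`. -/
def chartDeriv (κ : DualTotal F V) : DualTangent (EB := EB) κ ≃L[ℝ] EB × (F →L[ℝ] ℝ) :=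
  (isInvertible_mfderiv_extChartAt (I := dualModel EB F) (mem_extChartAt_source κ)).choose

theorem chartDeriv_apply (κ : DualTotal F V) (v : DualTangent (EB := EB) κ) :
    chartDeriv κ v = mfderiv (dualModel EB F) 𝓘(ℝ, EB × (F →L[ℝ] ℝ))
      (extChartAt (dualModel EB F) κ) κ v :=
  congrArg (fun L : DualTangent (EB := EB) κ →L[ℝ] EB × (F →L[ℝ] ℝ) => L v)
    (isInvertible_mfderiv_extChartAt (I := dualModel EB F) (mem_extChartAt_source κ)).choose_spec

theorem exists_pull_eventuallyEq (κ₀ : DualTotal F V) (ℓ : EB →L[ℝ] ℝ) :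
    ∃ f : CQ, (∀ᶠ x in 𝓝 κ₀.proj, f x = ℓ (extChartAt 𝓘(ℝ, EB) κ₀.proj x)) ∧
      ∀ᶠ κ : DualTotal F V in 𝓝 κ₀, pull f κ = ℓ (extChartAt (dualModel EB F) κ₀ κ).1 := by
  obtain ⟨f, hf⟩ := exists_fun_eventuallyEq_chart κ₀.proj ℓ
  have hp : ContinuousAt (fun κ : DualTotal F V => κ.proj) κ₀ :=
    (FiberBundle.continuous_proj _ _).continuousAt
  refine ⟨f, hf, ?_⟩
  filter_upwards [hp.eventually hf] with κ h
  rw [extChartAt_dual_fst, ← h]; rfl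

/-- Near a point of `E^*`, every linear function of the coordinates is the sum of a function pulled
back from `Q` and of a fibrewise linear function. -/
theorem exists_eventuallyEq_chart (κ₀ : DualTotal F V) (ℓ : (EB × (F →L[ℝ] ℝ)) →L[ℝ] ℝ) :
    ∃ (f : CQ) (γ : ΓE), ∀ᶠ κ : DualTotal F V in 𝓝 κ₀,
      (pull f + hatFun γ : CE) κ = ℓ (extChartAt (dualModel EB F) κ₀ κ) := by
  obtain ⟨f, -, hf⟩ := exists_pull_eventuallyEq κ₀ (ℓ.comp (ContinuousLinearMap.inl ℝ _ _))
  -- a linear form on the finite-dimensional space `F^*` is the evaluation at a vector of `F`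
  obtain ⟨w, hw⟩ : ∃ w : F, ∀ α : F →L[ℝ] ℝ, ℓ (0, α) = α w := by
    let L : Module.Dual ℝ (Module.Dual ℝ F) :=
      (ℓ.comp (ContinuousLinearMap.inr ℝ EB (F →L[ℝ] ℝ))).toLinearMap.comp
        (LinearMap.toContinuousLinearMap : (F →ₗ[ℝ] ℝ) ≃ₗ[ℝ] F →L[ℝ] ℝ).toLinearMap
    refine ⟨(Module.evalEquiv ℝ F).symm L, fun α => ?_⟩
    have h := Module.apply_evalEquiv_symm_apply ℝ F (α : F →ₗ[ℝ] ℝ) L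
    exact h.symm
  refine ⟨f, frameSec EB F V κ₀.proj w, ?_⟩
  filter_upwards [hf, extChartAt_dual_snd (EB := EB) κ₀ w] with κ h1 h2
  change pull f κ + hat (frameSec EB F V κ₀.proj w) κ = _
  rw [h1, h2, ← hw, ContinuousLinearMap.comp_apply, ContinuousLinearMap.inl_apply, ← map_add,
    Prod.mk_add_mk, add_zero, zero_add]

theorem covec_eventuallyEq_chart {κ : DualTotal F V} {g : DualTotal F V → ℝ}
    {ℓ : (EB × (F →L[ℝ] ℝ)) →L[ℝ] ℝ}
    (h : ∀ᶠ κ' : DualTotal F V in 𝓝 κ, g κ' = ℓ (extChartAt (dualModel EB F) κ κ'))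
    (v : DualTangent (EB := EB) κ) :
    covec (I := dualModel EB F) g κ v = ℓ (chartDeriv κ v) := by
  rw [covec_congr h, covec_chart (mem_chart_source _ κ), chartDeriv_apply]

/-- The covectors `d(f ∘ τ)` and `dγ̂` fill the cotangent spaces of `E^*`. -/
theorem exists_covec_eq (κ : DualTotal F V) (α : Module.Dual ℝ (DualTangent (EB := EB) κ)) :
    ∃ (f : CQ) (γ : ΓE), α = covec (I := dualModel EB F) (pull f) κ +
      covec (I := dualModel EB F) (hatFun γ) κ := by
  let ℓ : (EB × (F →L[ℝ] ℝ)) →L[ℝ] ℝ :=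
    (α.comp (chartDeriv κ).symm.toLinearEquiv.toLinearMap).toContinuousLinearMap
  obtain ⟨f, γ, h⟩ := exists_eventuallyEq_chart κ ℓ
  refine ⟨f, γ, ?_⟩
  rw [← covec_add]
  ext v
  rw [covec_eventuallyEq_chart h]
  change α v = α ((chartDeriv κ).symm (chartDeriv κ v))
  rw [ContinuousLinearEquiv.symm_apply_apply]

/-- Linear maps on a cotangent space of `E^*` can be compared on the covectors `d(f ∘ τ)` and
`dγ̂`. -/
theorem covec_ext {κ : DualTotal F V} {G : Type*} [AddCommGroup G] [Module ℝ G]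
    {L L' : Module.Dual ℝ (DualTangent (EB := EB) κ) →ₗ[ℝ] G}
    (h1 : ∀ f : CQ, L (covec (I := dualModel EB F) (pull f) κ) =
      L' (covec (I := dualModel EB F) (pull f) κ))
    (h2 : ∀ γ : ΓE, L (covec (I := dualModel EB F) (hatFun γ) κ) =
      L' (covec (I := dualModel EB F) (hatFun γ) κ)) : L = L' := by
  ext α
  obtain ⟨f, γ, rfl⟩ := exists_covec_eq κ α
  rw [map_add, map_add, h1, h2]

/-- A tangent vector of `E^*` is determined by the derivatives of the functions `f ∘ τ` and `γ̂`. -/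
theorem tangent_ext {κ : DualTotal F V} {v w : DualTangent (EB := EB) κ}
    (h1 : ∀ f : CQ, covec (I := dualModel EB F) (pull f) κ v =
      covec (I := dualModel EB F) (pull f) κ w)
    (h2 : ∀ γ : ΓE, covec (I := dualModel EB F) (hatFun γ) κ v =
      covec (I := dualModel EB F) (hatFun γ) κ w) : v = w := by
  have h : Module.Dual.eval ℝ (DualTangent (EB := EB) κ) v = Module.Dual.eval ℝ _ w :=
    covec_ext h1 h2
  exact (Module.evalEquiv ℝ (DualTangent (EB := EB) κ)).injective h

/-- The differential at `q` of the chart of `Q` around `q`. -/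
def baseChartDeriv (q : Q) : TangentSpace 𝓘(ℝ, EB) q ≃L[ℝ] EB :=
  (isInvertible_mfderiv_extChartAt (I := 𝓘(ℝ, EB)) (mem_extChartAt_source q)).choose

theorem baseChartDeriv_apply (q : Q) (ξ : TangentSpace 𝓘(ℝ, EB) q) :
    baseChartDeriv q ξ = mfderiv 𝓘(ℝ, EB) 𝓘(ℝ, EB) (extChartAt 𝓘(ℝ, EB) q) q ξ :=
  congrArg (fun L : TangentSpace 𝓘(ℝ, EB) q →L[ℝ] EB => L ξ)
    (isInvertible_mfderiv_extChartAt (I := 𝓘(ℝ, EB)) (mem_extChartAt_source q)).choose_spec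

/-- In the charts, the tangent map of the projection `E^* → Q` is the first projection. -/
theorem projTangent_eq_of {κ : DualTotal F V} {v : DualTangent (EB := EB) κ}
    {ξ : TangentSpace 𝓘(ℝ, EB) κ.proj}
    (h : (chartDeriv κ v).1 = baseChartDeriv κ.proj ξ) : projTangent κ v = ξ := by
  refine (baseChartDeriv κ.proj).injective ?_
  rw [← h]
  refine (SeparatingDual.eq_iff_forall_dual_eq (R := ℝ)).2 fun ℓ => ?_
  obtain ⟨f, hf, hf'⟩ := exists_pull_eventuallyEq κ ℓ
  have h1 := covec_eventuallyEq_chart (ℓ := ℓ.comp (ContinuousLinearMap.fst ℝ _ _)) hf' v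
  rw [covec_pull, covec_congr hf, covec_chart (mem_chart_source _ κ.proj),
    ← baseChartDeriv_apply] at h1
  exact h1

/-- Existence of the tangent vector with prescribed derivatives of the functions `f ∘ τ` and
`γ̂`. -/
theorem exists_liftVector (κ : DualTotal F V) (ξ : TangentSpace 𝓘(ℝ, EB) κ.proj) (c : ΓE → ℝ)
    (hadd : ∀ γ γ', c (γ + γ') = c γ + c γ')
    (hsmul : ∀ (f : CQ) γ, c (f • γ) =
      covec (I := 𝓘(ℝ, EB)) f κ.proj ξ * κ.2 (γ.1 κ.proj) + f κ.proj * c γ) :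
    ∃ v : DualTangent (EB := EB) κ, projTangent κ v = ξ ∧
      ∀ γ, covec (I := dualModel EB F) (hatFun γ) κ v = c γ := by
  have hreal (r : ℝ) (γ : ΓE) : c (r • γ) = r * c γ := by
    have h := hsmul (ContMDiffMap.const r) γ
    rw [covec_const, LinearMap.zero_apply, zero_mul, zero_add] at h
    exact h
  let φ : F →L[ℝ] ℝ := LinearMap.toContinuousLinearMap
    { toFun := fun w => c (frameSec EB F V κ.proj w)
      map_add' := fun w w' => by rw [map_add, hadd]
      map_smul' := fun r w => by rw [map_smul, hreal]; rfl }
  let v := (chartDeriv κ).symm (baseChartDeriv κ.proj ξ, φ)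
  have hv : projTangent κ v = ξ :=
    projTangent_eq_of (by rw [ContinuousLinearEquiv.apply_symm_apply])
  refine ⟨v, hv, fun γ => ?_⟩
  have hframe (w : F) : covec (I := dualModel EB F) (hatFun (frameSec EB F V κ.proj w)) κ v =
      c (frameSec EB F V κ.proj w) := by
    let ℓ : (EB × (F →L[ℝ] ℝ)) →L[ℝ] ℝ :=
      (ContinuousLinearMap.apply ℝ ℝ w).comp (ContinuousLinearMap.snd ℝ EB (F →L[ℝ] ℝ))
    refine (covec_eventuallyEq_chart (ℓ := ℓ) (extChartAt_dual_snd (EB := EB) κ w) v).trans ?_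
    rw [ContinuousLinearEquiv.apply_symm_apply]
    rfl
  -- the two sides differ by a tensorial map that vanishes on the frame
  have h := tensorial_eq_sum (q := κ.proj)
    (c := fun γ => covec (I := dualModel EB F) (hatFun γ) κ v - c γ)
    (fun γ γ' => by rw [hatFun_add, covec_add, hadd, LinearMap.add_apply]; ring)
    (fun f γ => by rw [covec_hatFun_smul, hsmul, hv, smul_eq_mul]; ring) γ
  rw [Finset.sum_eq_zero fun i _ => by
    rw [frame, hframe, sub_self, smul_zero]] at h
  exact sub_eq_zero.1 h

/-- The tangent vector chosen in `liftVector` has the required derivatives as soon as these satisfy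
the Leibniz rule. -/
theorem liftVector_spec (κ : DualTotal F V) (ξ : TangentSpace 𝓘(ℝ, EB) κ.proj) (c : ΓE → ℝ)
    (hadd : ∀ γ γ', c (γ + γ') = c γ + c γ')
    (hsmul : ∀ (f : CQ) γ, c (f • γ) =
      covec (I := 𝓘(ℝ, EB)) f κ.proj ξ * κ.2 (γ.1 κ.proj) + f κ.proj * c γ) :
    (∀ f : CQ, covec (I := dualModel EB F) (pull f) κ (liftVector κ ξ c) =
      covec (I := 𝓘(ℝ, EB)) f κ.proj ξ) ∧
    ∀ γ, covec (I := dualModel EB F) (hatFun γ) κ (liftVector κ ξ c) = c γ := by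
  obtain ⟨v, hv, hc⟩ := exists_liftVector κ ξ c hadd hsmul
  exact Classical.epsilon_spec (p := fun v : DualTangent (EB := EB) κ =>
    (∀ f : CQ, covec (I := dualModel EB F) (fun p : DualTotal F V => f p.proj) κ v =
        covec (I := 𝓘(ℝ, EB)) f κ.proj ξ) ∧
    ∀ γ, covec (I := dualModel EB F) (hat γ) κ v = c γ)
    ⟨v, fun f => by rw [← hv]; exact covec_pull f κ v, hc⟩

/-- Smoothness of a vector field on `E^*` can be tested on the functions `f ∘ τ` and `γ̂`. -/
theorem mem_vectorFields_of {X : ∀ κ : DualTotal F V, DualTangent (EB := EB) κ}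
    (h1 : ∀ f : CQ, ContMDiff (dualModel EB F) 𝓘(ℝ, ℝ) ∞
      fun κ => covec (I := dualModel EB F) (pull f) κ (X κ))
    (h2 : ∀ γ : ΓE, ContMDiff (dualModel EB F) 𝓘(ℝ, ℝ) ∞
      fun κ => covec (I := dualModel EB F) (hatFun γ) κ (X κ)) :
    X ∈ (vectorFields (dualModel EB F) (DualTotal F V)).carrier := by
  intro κ₀
  rw [contMDiffAt_section]
  let D (κ : DualTotal F V) : EB × (F →L[ℝ] ℝ) :=
    mfderiv (dualModel EB F) 𝓘(ℝ, EB × (F →L[ℝ] ℝ)) (extChartAt (dualModel EB F) κ₀) κ (X κ)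
  have hcoord (ℓ : (EB × (F →L[ℝ] ℝ)) →L[ℝ] ℝ) :
      ContMDiffAt (dualModel EB F) 𝓘(ℝ, ℝ) ∞ (fun κ => ℓ (D κ)) κ₀ := by
    obtain ⟨f, γ, h⟩ := exists_eventuallyEq_chart κ₀ ℓ
    refine (((h1 f).add (h2 γ)) κ₀).congr_of_eventuallyEq ?_
    filter_upwards [chart_source_mem_nhds (ModelProd EB (F →L[ℝ] ℝ)) κ₀, h.eventually_nhds]
      with κ hκ hκ'
    rw [← covec_chart hκ, ← covec_congr hκ', covec_add]
    rfl
  have key : ContMDiffAt (dualModel EB F) 𝓘(ℝ, EB × (F →L[ℝ] ℝ)) ∞ D κ₀ := by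
    let b := Module.finBasis ℝ (EB × (F →L[ℝ] ℝ))
    have h : ContMDiffAt (dualModel EB F) 𝓘(ℝ, EB × (F →L[ℝ] ℝ)) ∞
        (fun κ => ∑ i, (b.coord i).toContinuousLinearMap (D κ) • b i) κ₀ :=
      ContMDiffAt.sum fun i _ => (hcoord _).smul contMDiffAt_const
    exact h.congr_of_eventuallyEq (.of_forall fun κ => (b.sum_repr (D κ)).symm)
  refine key.congr_of_eventuallyEq ?_
  filter_upwards [chart_source_mem_nhds (ModelProd EB (F →L[ℝ] ℝ)) κ₀] with κ hκ
  have h := TangentBundle.continuousLinearMapAt_trivializationAt (I := dualModel EB F) hκ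
  have h' := Bundle.Trivialization.coe_linearMapAt_of_mem (R := ℝ)
    (trivializationAt (EB × (F →L[ℝ] ℝ)) (TangentSpace (dualModel EB F)) κ₀) (b := κ) hκ
  exact (congrFun h' (X κ)).symm.trans
    (congrArg (fun L : DualTangent (EB := EB) κ →L[ℝ] EB × (F →L[ℝ] ℝ) => L (X κ)) h)

/-- A map `a : E^* → E` over `Q` with smooth cut-off coordinates is smooth. -/
theorem contMDiff_of_frameCoord {a : ∀ κ : DualTotal F V, V κ.proj}
    (h : ∀ q i, ContMDiff (dualModel EB F) 𝓘(ℝ, ℝ) ∞ fun κ : DualTotal F V =>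
      (Module.finBasis ℝ F).coord i (frameCoord EB F V q κ.proj (a κ))) :
    ContMDiff (dualModel EB F) (𝓘(ℝ, EB).prod 𝓘(ℝ, F)) ∞
      fun κ : DualTotal F V => TotalSpace.mk' F κ.proj (a κ) := by
  intro κ₀
  refine contMDiffAt_totalSpace.2 ⟨contMDiff_proj _ κ₀, ?_⟩
  have hp : ContinuousAt (fun κ : DualTotal F V => κ.proj) κ₀ :=
    (FiberBundle.continuous_proj _ _).continuousAt
  have key : ContMDiff (dualModel EB F) 𝓘(ℝ, F) ∞ fun κ : DualTotal F V =>
      ∑ i, (Module.finBasis ℝ F).coord i (frameCoord EB F V κ₀.proj κ.proj (a κ)) •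
        Module.finBasis ℝ F i :=
    ContMDiff.sum fun i _ => (h κ₀.proj i).smul contMDiff_const
  refine (key κ₀).congr_of_eventuallyEq ?_
  filter_upwards [hp.eventually (frameBump_eventually (EB := EB) (F := F) (V := V) κ₀.proj),
    hp.preimage_mem_nhds ((trivializationAt F V κ₀.proj).open_baseSet.mem_nhds
      (FiberBundle.mem_baseSet_trivializationAt' κ₀.proj))] with κ hκ hκ'
  refine Eq.trans ?_ ((Module.finBasis ℝ F).sum_repr _).symm
  rw [frameCoord, hκ, one_smul, Bundle.Trivialization.coe_linearMapAt_of_mem _ hκ']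

end CotangentSpaces

/-! ### Existence of connections -/

section Along

section glue

variable (f : SmoothPartitionOfUnity Q 𝓘(ℝ, EB) Q)

theorem glue_smooth (s : Q → ΓE) :
    (fun x => ∑ᶠ q, f q x • (s q).1 x) ∈ (bundleSections 𝓘(ℝ, EB) F V).carrier := by
  refine ContMDiff.finsum_section_of_locallyFinite (t := fun q x => f q x • (s q).1 x)
    (f.locallyFinite.subset fun _ _ hx => ?_) fun q => (f q • s q).2
  exact left_ne_zero_of_smul hx

/-- Sections are glued with the help of a partition of unity. -/
def glue (s : Q → ΓE) : ΓE := SectionModule.ofMem _ _ (glue_smooth f s)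

theorem glue_finite (s : Q → ΓE) (x : Q) :
    (Function.support fun q => f q x • (s q).1 x).Finite :=
  (f.locallyFinite.point_finite x).subset fun _ hx => left_ne_zero_of_smul hx

theorem glue_add (s t : Q → ΓE) : glue f (fun q => s q + t q) = glue f s + glue f t := by
  refine SectionModule.ext_apply fun x => ?_
  refine Eq.trans ?_ (finsum_add_distrib (glue_finite f s x) (glue_finite f t x))
  exact finsum_congr fun _ => smul_add _ _ _

theorem glue_smul (g : CQ) (s : Q → ΓE) : glue f (fun q => g • s q) = g • glue f s := by
  refine SectionModule.ext_apply fun x => ?_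
  refine Eq.trans ?_ (smul_finsum' (g x) (glue_finite f s x)).symm
  exact finsum_congr fun _ => smul_comm _ _ _

/-- If the partition of unity is supported where the cut-off functions are `1`, gluing removes the
cut-offs. -/
theorem glue_frameCut (hf : ∀ q x, f q x ≠ 0 → frameCut EB F V q x = 1) (γ : ΓE) :
    glue f (fun q => frameCut EB F V q • γ) = γ := by
  refine SectionModule.ext_apply fun x => ?_
  have h : ∀ q, f q x • (frameCut EB F V q • γ).1 x = f q x • γ.1 x := fun q => by
    by_cases h0 : f q x = 0
    · rw [h0, zero_smul, zero_smul]
    · rw [SectionModule.smul_apply, hf q x h0, one_smul]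
  refine (finsum_congr h).trans ?_
  rw [← finsum_smul' (f.locallyFinite.point_finite x), f.sum_eq_one (Set.mem_univ x), one_smul]

end glue

variable {ρ : Anchor (bundleSections 𝓘(ℝ, EB) F V)}

/-- The flat connection of the cut-off frame at `q`. -/
def frameConn (ρ : Anchor (bundleSections 𝓘(ℝ, EB) F V)) (q : Q) (σ γ : ΓE) : ΓE :=
  ∑ i, ρ.deriv σ (coframe EB F V q i γ) • frame EB F V q i

theorem frameConn_add_left (q : Q) (σ σ' γ : ΓE) :
    frameConn ρ q (σ + σ') γ = frameConn ρ q σ γ + frameConn ρ q σ' γ := by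
  simp only [frameConn, Anchor.deriv_add_left, add_smul, Finset.sum_add_distrib]

theorem frameConn_smul_left (q : Q) (g : CQ) (σ γ : ΓE) :
    frameConn ρ q (g • σ) γ = g • frameConn ρ q σ γ := by
  simp only [frameConn, Anchor.deriv_smul_left, mul_smul, Finset.smul_sum]

theorem frameConn_add_right (q : Q) (σ γ γ' : ΓE) :
    frameConn ρ q σ (γ + γ') = frameConn ρ q σ γ + frameConn ρ q σ γ' := by
  simp only [frameConn, map_add, Anchor.deriv, derivAlong_add_right, add_smul,
    Finset.sum_add_distrib]

/-- The Leibniz rule of the flat connection holds where the cut-off function is `1`. -/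
theorem frameConn_leibniz (q : Q) (g : CQ) (σ γ : ΓE) :
    frameConn ρ q σ (g • γ) =
      ρ.deriv σ g • frameCut EB F V q • γ + g • frameConn ρ q σ γ := by
  simp only [← frame_expansion, frameConn, map_smul, Anchor.deriv, smul_eq_mul,
    derivAlong_mul_right, add_smul, Finset.sum_add_distrib, Finset.smul_sum, mul_smul]
  rw [add_comm]

/-- The flat connections of the local frames are glued with a partition of unity. -/
theorem exists_connection [SigmaCompactSpace Q] (ρ : Anchor (bundleSections 𝓘(ℝ, EB) F V)) :
    Nonempty (Connection ρ) := by
  obtain ⟨f, hf⟩ := SmoothPartitionOfUnity.exists_isSubordinate 𝓘(ℝ, EB)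
    (isClosed_univ (X := Q)) (fun q => interior {x | frameCut EB F V q x = 1})
    (fun _ => isOpen_interior) fun q _ =>
      Set.mem_iUnion.2 ⟨q, mem_interior_iff_mem_nhds.2 (frameCut_eventually q)⟩
  have hf' : ∀ q x, f q x ≠ 0 → frameCut EB F V q x = 1 := fun q x h => by
    have hx : x ∈ {x | frameCut EB F V q x = 1} := interior_subset (hf q (subset_tsupport _ h))
    exact hx
  let D (σ γ : ΓE) : ΓE := glue f fun q => frameConn ρ q σ γ
  have hl (g : CQ) (σ γ : ΓE) : D (g • σ) γ = g • D σ γ := by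
    simp only [D, frameConn_smul_left, glue_smul]
  have hr (g : CQ) (σ γ : ΓE) : D σ (g • γ) = ρ.deriv σ g • γ + g • D σ γ := by
    simp only [D, frameConn_leibniz, glue_add, glue_smul, glue_frameCut f hf']
  refine ⟨⟨LinearMap.mk₂ ℝ D (fun σ σ' γ => ?_) (fun r σ γ => hl (ContMDiffMap.const r) σ γ)
    (fun σ γ γ' => ?_) (fun r σ γ => ?_), hl, hr⟩⟩
  · simp only [D, frameConn_add_left, glue_add]
  · simp only [D, frameConn_add_right, glue_add]
  · have h := hr (ContMDiffMap.const r) σ γ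
    rw [Anchor.deriv_const, zero_smul, zero_add] at h
    exact h

/-- The right connection is obtained from the left one by subtracting the bracket. -/
theorem exists_connections [SigmaCompactSpace Q] (A : Algebroid (bundleSections 𝓘(ℝ, EB) F V)) :
    ∃ (Dl : Connection A.l) (Dr : Connection A.r),
      ∀ σ σ', A.B σ σ' = Dl.D σ σ' - Dr.D σ' σ := by
  obtain ⟨Dl⟩ := exists_connection A.l
  refine ⟨Dl, ⟨(Dl.D - A.B).flip, fun f σ γ => ?_, fun g σ γ => ?_⟩, fun σ σ' => ?_⟩
  · simp only [LinearMap.flip_apply, LinearMap.sub_apply, Dl.leibniz, A.B_smul_right, smul_sub]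
    abel
  · simp only [LinearMap.flip_apply, LinearMap.sub_apply, Dl.smul_left, A.B_smul_left, smul_sub]
    abel
  · simp only [LinearMap.flip_apply, LinearMap.sub_apply]
    abel

/-! ### Horizontal and vertical lifts -/

/-- The value `(D_σ γ)(q)` only depends on `σ(q)`, so that the choice in `Connection.at` is
immaterial. -/
theorem Connection.at_apply (D : Connection ρ) (σ γ : ΓE) (q : Q) :
    D.at (σ.1 q) γ = (D.D σ γ).1 q := by
  have h : (Classical.epsilon fun σ' : ΓE => σ'.1 q = σ.1 q).1 q = σ.1 q :=
    Classical.epsilon_spec (p := fun σ' : ΓE => σ'.1 q = σ.1 q) ⟨σ, rfl⟩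
  refine tensorial_congr (c := fun σ => (D.D σ γ).1 q) (fun σ σ' => ?_) (fun f σ => ?_) h
  · rw [map_add]; rfl
  · rw [D.smul_left]; rfl

theorem Anchor.deriv_apply (σ : ΓE) (f : CQ) (q : Q) :
    ρ.deriv σ f q = covec (I := 𝓘(ℝ, EB)) f q (ρ.toFun q (σ.1 q)) := rfl

/-- The horizontal lift has the derivatives that characterize it. -/
theorem Connection.hlift_spec (D : Connection ρ) (κ : DualTotal F V) (σ : ΓE) :
    (∀ f : CQ, covec (I := dualModel EB F) (pull f) κ (D.hlift κ (σ.1 κ.proj)) =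
      ρ.deriv σ f κ.proj) ∧
    ∀ γ, covec (I := dualModel EB F) (hatFun γ) κ (D.hlift κ (σ.1 κ.proj)) =
      hatFun (D.D σ γ) κ := by
  have h := liftVector_spec κ (ρ.toFun κ.proj (σ.1 κ.proj))
    (fun γ => κ.2 (D.at (σ.1 κ.proj) γ)) (fun γ γ' => ?_) (fun f γ => ?_)
  · refine ⟨h.1, fun γ => (h.2 γ).trans ?_⟩
    rw [D.at_apply]; rfl
  · simp only [D.at_apply, map_add]
    exact map_add κ.2 _ _
  · simp only [D.at_apply, D.leibniz]
    exact (map_add κ.2 _ _).trans (congrArg₂ _ (map_smul κ.2 _ _) (map_smul κ.2 _ _))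

theorem vlift_spec (ν : ΓE') (κ : DualTotal F V) :
    (∀ f : CQ, covec (I := dualModel EB F) (pull f) κ (vlift ν κ) = 0) ∧
    ∀ γ, covec (I := dualModel EB F) (hatFun γ) κ (vlift ν κ) = ν γ κ.proj := by
  have h := liftVector_spec κ 0 (fun γ => ν γ κ.proj) (fun γ γ' => by rw [map_add]; rfl)
    (fun f γ => by rw [map_smul, map_zero, zero_mul, zero_add]; rfl)
  exact ⟨fun f => (h.1 f).trans (map_zero _), h.2⟩

theorem tensorVlift_spec (P : ΓE →ₗ[CQ] ΓE) (κ : DualTotal F V) :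
    (∀ f : CQ, covec (I := dualModel EB F) (pull f) κ (tensorVlift P κ) = 0) ∧
    ∀ γ, covec (I := dualModel EB F) (hatFun γ) κ (tensorVlift P κ) = hatFun (P γ) κ := by
  have h := liftVector_spec κ 0 (fun γ => hatFun (P γ) κ)
    (fun γ γ' => by rw [map_add, hatFun_add]; rfl)
    (fun f γ => by rw [map_smul, hatFun_smul, map_zero, zero_mul, zero_add]; rfl)
  exact ⟨fun f => (h.1 f).trans (map_zero _), h.2⟩

end Along

/-! ### Linear maps from sections of `E` to functions on the dual bundle -/

section Pairing

theorem pull_add (f g : CQ) : (pull (f + g) : CE) = pull f + pull g := rfl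

theorem pull_mul (f g : CQ) : (pull (f * g) : CE) = pull f * pull g := rfl

variable (EB Q F V) in
/-- The pull-back of functions along `τ : E^* → Q`. -/
def pullHom : CQ →+* CE where
  toFun := pull
  map_one' := rfl
  map_mul' _ _ := rfl
  map_zero' := rfl
  map_add' _ _ := rfl

/-- The functions on the dual bundle form an algebra over the functions on the base. -/
instance instAlgebraPull : Algebra CQ CE := (pullHom EB Q F V).toAlgebra

theorem pull_smul (f : CQ) (g : CE) : f • g = pull f * g := rfl

/-- The value of `Θ` at `e ∈ E_q` and `κ ∈ E^*_q`: the value at `κ` of `Θ(σ)`, for any section `σ`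
with `σ(q) = e`. -/
def alongFun (Θ : ΓE⋆) (κ : DualTotal F V) (e : V κ.proj) : ℝ :=
  Θ (exists_sec (EB := EB) (F := F) κ.proj e).choose κ

/-- The choice of a section through `e` in `alongFun` is immaterial. -/
theorem alongFun_sec (Θ : ΓE⋆) (κ : DualTotal F V) (σ : ΓE) :
    alongFun Θ κ (σ.1 κ.proj) = Θ σ κ :=
  tensorial_congr (c := fun σ => Θ σ κ) (fun σ σ' => by rw [map_add]; rfl)
    (fun f σ => by rw [map_smul]; rfl)
    (exists_sec (EB := EB) (F := F) κ.proj (σ.1 κ.proj)).choose_spec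

theorem alongFun_add (Θ : ΓE⋆) (κ : DualTotal F V) (e e' : V κ.proj) :
    alongFun Θ κ (e + e') = alongFun Θ κ e + alongFun Θ κ e' := by
  obtain ⟨σ, rfl⟩ := exists_sec (EB := EB) (F := F) κ.proj e
  obtain ⟨σ', rfl⟩ := exists_sec (EB := EB) (F := F) κ.proj e'
  rw [← SectionModule.add_apply, alongFun_sec, alongFun_sec, alongFun_sec, map_add]
  rfl

theorem alongFun_smul (Θ : ΓE⋆) (κ : DualTotal F V) (r : ℝ) (e : V κ.proj) :
    alongFun Θ κ (r • e) = r * alongFun Θ κ e := by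
  obtain ⟨σ, rfl⟩ := exists_sec (EB := EB) (F := F) κ.proj e
  have h : r • σ.1 κ.proj = ((ContMDiffMap.const r : CQ) • σ).1 κ.proj := rfl
  rw [h, alongFun_sec, alongFun_sec, map_smul]
  rfl

/-- A smooth map `a : E^* → E` over `Q` gives rise to a smooth function `κ ↦ Θ(a(κ))`. -/
theorem contMDiff_alongFun (Θ : ΓE⋆) {a : ∀ κ : DualTotal F V, V κ.proj}
    (ha : ContMDiff (dualModel EB F) (𝓘(ℝ, EB).prod 𝓘(ℝ, F)) ∞
      fun κ : DualTotal F V => TotalSpace.mk' F κ.proj (a κ)) :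
    ContMDiff (dualModel EB F) 𝓘(ℝ, ℝ) ∞ fun κ => alongFun Θ κ (a κ) := by
  intro κ₀
  have key : ContMDiff (dualModel EB F) 𝓘(ℝ, ℝ) ∞ fun κ : DualTotal F V =>
      ∑ i, ((Module.finBasis ℝ F).coord i).toContinuousLinearMap
        (frameCoord EB F V κ₀.proj κ.proj (a κ)) • Θ (frame EB F V κ₀.proj i) κ :=
    ContMDiff.sum fun i _ =>
      (((Module.finBasis ℝ F).coord i).toContinuousLinearMap.contMDiff.comp
        (contMDiff_frameCoord κ₀.proj ha)).smul (Θ (frame EB F V κ₀.proj i)).contMDiff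
  refine (key κ₀).congr_of_eventuallyEq ?_
  have hp : ContinuousAt (fun κ : DualTotal F V => κ.proj) κ₀ :=
    (FiberBundle.continuous_proj _ _).continuousAt
  filter_upwards [hp.eventually (frameCut_eventually (EB := EB) (F := F) (V := V) κ₀.proj)]
    with κ hκ
  obtain ⟨σ, hσ⟩ := exists_sec (EB := EB) (F := F) κ.proj (a κ)
  have h : (frameCut EB F V κ₀.proj • Θ σ : CE) κ = ∑ i, (coframe EB F V κ₀.proj i σ •
      Θ (frame EB F V κ₀.proj i) : CE) κ := by
    rw [← map_smul, ← frame_expansion, map_sum]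
    simp only [map_smul]
    exact map_sum (ContMDiffMap.evalRingHom κ) _ _
  rw [← hσ, alongFun_sec]
  have h' : (frameCut EB F V κ₀.proj • Θ σ : CE) κ = Θ σ κ := by
    change frameCut EB F V κ₀.proj κ.proj * Θ σ κ = _
    rw [hκ, one_mul]
  rw [← h', h]
  rfl

variable {ρ : Anchor (bundleSections 𝓘(ℝ, EB) F V)}

instance instAddCommGroupLeftTangent (κ : DualTotal F V) : AddCommGroup (leftTangent ρ κ) :=
  Submodule.addCommGroup _

instance instModuleLeftTangent (κ : DualTotal F V) : Module ℝ (leftTangent ρ κ) :=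
  Submodule.module _

/-- The smooth sections of the left `E`-tangent bundle to the dual bundle. -/
abbrev TSec (ρ : Anchor (bundleSections 𝓘(ℝ, EB) F V)) : Type _ := (leftTangentSections ρ).Sec

instance instAddCommGroupTSec : AddCommGroup (TSec ρ) := SectionModule.instAddCommGroupSec _

instance instModuleTSec : Module CE (TSec ρ) := SectionModule.instModuleSec _

local notation "ΓT" => TSec ρ

/-- The function `κ ↦ Θ(a(κ))` of a section `(a, X)` of the left `E`-tangent bundle. -/
def along : ΓE⋆ →ₗ[CE] ΓT →ₗ[CE] CE :=
  LinearMap.mk₂ CE (fun Θ Z => ⟨fun κ => alongFun Θ κ (Z.1 κ).1.1, contMDiff_alongFun Θ Z.2.1⟩)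
    (fun _ _ _ => rfl) (fun _ _ _ => rfl)
    (fun Θ Z Z' => ContMDiffMap.ext fun κ => alongFun_add Θ κ (Z.1 κ).1.1 (Z'.1 κ).1.1)
    (fun g Θ Z => ContMDiffMap.ext fun κ => alongFun_smul Θ κ (g κ) (Z.1 κ).1.1)

theorem along_add_right (Θ : ΓE⋆) (Z Z' : ΓT) : along Θ (Z + Z') = along Θ Z + along Θ Z' :=
  (along Θ).map_add Z Z'

theorem along_smul_right (g : CE) (Θ : ΓE⋆) (Z : ΓT) : along Θ (g • Z) = g * along Θ Z :=
  (along Θ).map_smul g Z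

theorem along_add_left (Θ Θ' : ΓE⋆) (Z : ΓT) : along (Θ + Θ') Z = along Θ Z + along Θ' Z :=
  along.map_add₂ Θ Θ' Z

theorem along_smul_left (g : CE) (Θ : ΓE⋆) (Z : ΓT) : along (g • Θ) Z = g * along Θ Z :=
  along.map_smul₂ g Θ Z

theorem along_pull_smul_left (f : CQ) (Θ : ΓE⋆) (Z : ΓT) :
    along (f • Θ) Z = pull f * along Θ Z :=
  along_smul_left (pull f) Θ Z

theorem along_apply (Θ : ΓE⋆) (Z : ΓT) (κ : DualTotal F V) :
    along Θ Z κ = alongFun Θ κ (Z.1 κ).1.1 := rfl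

/-- The map `σ ↦ ν(σ) ∘ τ`. -/
def pullDual : ΓE' →ₗ[CQ] ΓE⋆ where
  toFun ν := (Algebra.linearMap CQ CE).comp ν
  map_add' _ _ := rfl
  map_smul' _ _ := rfl

theorem pullDual_apply (ν : ΓE') (σ : ΓE) : pullDual ν σ = pull (ν σ) := rfl

/-- The map `ν ↦ ν(σ) ∘ τ`. -/
def evalHat (σ : ΓE) : ΓE' →ₗ[CQ] CE where
  toFun ν := pull (ν σ)
  map_add' _ _ := rfl
  map_smul' _ _ := rfl

theorem evalHat_apply (ν : ΓE') (σ : ΓE) : evalHat σ ν = pull (ν σ) := rfl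

/-- The map `σ ↦ ρ(σ)(f) ∘ τ`. -/
def anchorHat (ρ : Anchor (bundleSections 𝓘(ℝ, EB) F V)) (f : CQ) : ΓE⋆ where
  toFun σ := pull (ρ.deriv σ f)
  map_add' σ σ' := by rw [ρ.deriv_add_left]; rfl
  map_smul' g σ := by rw [ρ.deriv_smul_left]; rfl

theorem anchorHat_apply (f : CQ) (σ : ΓE) : anchorHat ρ f σ = pull (ρ.deriv σ f) := rfl

theorem alongFun_anchorHat (f : CQ) (κ : DualTotal F V) (e : V κ.proj) :
    alongFun (anchorHat ρ f) κ e = covec (I := 𝓘(ℝ, EB)) f κ.proj (ρ.toFun κ.proj e) := by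
  obtain ⟨σ, rfl⟩ := exists_sec (EB := EB) (F := F) κ.proj e
  rw [alongFun_sec]; rfl

/-- The map `σ ↦ (D_σ γ)^`. -/
def connHat (D : Connection ρ) (γ : ΓE) : ΓE⋆ where
  toFun σ := hatFun (D.D σ γ)
  map_add' σ σ' := by rw [map_add, LinearMap.add_apply, hatFun_add]
  map_smul' g σ := by rw [D.smul_left, hatFun_smul]; rfl

theorem connHat_apply (D : Connection ρ) (σ γ : ΓE) : connHat D γ σ = hatFun (D.D σ γ) := rfl

theorem connHat_add (D : Connection ρ) (γ γ' : ΓE) :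
    connHat D (γ + γ') = connHat D γ + connHat D γ' := by
  ext1 σ
  rw [connHat_apply, map_add, hatFun_add]
  rfl

theorem connHat_smul (D : Connection ρ) (g : CQ) (γ : ΓE) :
    connHat D (g • γ) = hatFun γ • anchorHat ρ g + g • connHat D γ := by
  ext1 σ
  rw [connHat_apply, D.leibniz, hatFun_add, hatFun_smul, hatFun_smul, mul_comm]
  rfl

theorem hlift_pull (D : Connection ρ) (κ : DualTotal F V) (e : V κ.proj) (f : CQ) :
    covec (I := dualModel EB F) (pull f) κ (D.hlift κ e) = alongFun (anchorHat ρ f) κ e := by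
  obtain ⟨σ, rfl⟩ := exists_sec (EB := EB) (F := F) κ.proj e
  rw [(D.hlift_spec κ σ).1, alongFun_sec]; rfl

theorem hlift_hat (D : Connection ρ) (κ : DualTotal F V) (e : V κ.proj) (γ : ΓE) :
    covec (I := dualModel EB F) (hatFun γ) κ (D.hlift κ e) = alongFun (connHat D γ) κ e := by
  obtain ⟨σ, rfl⟩ := exists_sec (EB := EB) (F := F) κ.proj e
  rw [(D.hlift_spec κ σ).2, alongFun_sec]; rfl

theorem hlift_add (D : Connection ρ) (κ : DualTotal F V) (e e' : V κ.proj) :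
    D.hlift κ (e + e') = D.hlift κ e + D.hlift κ e' :=
  tangent_ext (fun f => by simp only [map_add, hlift_pull, alongFun_add])
    fun γ => by simp only [map_add, hlift_hat, alongFun_add]

theorem hlift_smul (D : Connection ρ) (κ : DualTotal F V) (r : ℝ) (e : V κ.proj) :
    D.hlift κ (r • e) = r • D.hlift κ e :=
  tangent_ext (fun f => by simp only [map_smul, hlift_pull, alongFun_smul, smul_eq_mul])
    fun γ => by simp only [map_smul, hlift_hat, alongFun_smul, smul_eq_mul]

/-- The horizontal lift as a linear map. -/
def hliftLin (D : Connection ρ) (κ : DualTotal F V) : V κ.proj →ₗ[ℝ] DualTangent (EB := EB) κ where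
  toFun := D.hlift κ
  map_add' := hlift_add D κ
  map_smul' := hlift_smul D κ

end Pairing

/-! ### The anchors of the left tangent bundle and the components of its sections -/

section Components

variable {ρ ρ' : Anchor (bundleSections 𝓘(ℝ, EB) F V)}

local notation "ΓT" => TSec ρ

variable (ρ) in
/-- The anchor `(e, X) ↦ X`. -/
def leftAnchor : Anchor (leftTangentSections ρ) where
  toFun κ := (LinearMap.snd ℝ _ _).comp (leftTangent ρ κ).subtype
  smooth Z := Z.2.2

theorem leftAnchor_pull (Z : ΓT) (f : CQ) :
    (leftAnchor ρ).deriv Z (pull f) = along (anchorHat ρ f) Z := by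
  refine ContMDiffMap.ext fun κ => ?_
  rw [along_apply, alongFun_anchorHat]
  refine (covec_pull f κ (Z.1 κ).1.2).trans ?_
  exact congrArg _ (Z.1 κ).2.symm

/-- The map `(e, X) ↦ X - e^{Dh} + e^{D'h}`. -/
def rightAnchorFun (D : Connection ρ) (D' : Connection ρ') (κ : DualTotal F V) :
    leftTangent ρ κ →ₗ[ℝ] DualTangent (EB := EB) κ :=
  ((LinearMap.snd ℝ _ _) - (hliftLin D κ).comp (LinearMap.fst ℝ _ _) +
    (hliftLin D' κ).comp (LinearMap.fst ℝ _ _)).comp (leftTangent ρ κ).subtype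

theorem covec_rightAnchorFun (D : Connection ρ) (D' : Connection ρ') (Z : ΓT) (g : CE)
    (κ : DualTotal F V) :
    covec (I := dualModel EB F) g κ (rightAnchorFun D D' κ (Z.1 κ)) =
      (leftAnchor ρ).deriv Z g κ - covec (I := dualModel EB F) g κ (D.hlift κ (Z.1 κ).1.1) +
        covec (I := dualModel EB F) g κ (D'.hlift κ (Z.1 κ).1.1) := by
  refine (map_add _ _ _).trans ?_
  congr 1
  exact map_sub _ _ _

theorem covec_rightAnchorFun_pull (D : Connection ρ) (D' : Connection ρ') (Z : ΓT) (f : CQ)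
    (κ : DualTotal F V) :
    covec (I := dualModel EB F) (pull f) κ (rightAnchorFun D D' κ (Z.1 κ)) =
      along (anchorHat ρ' f) Z κ := by
  rw [covec_rightAnchorFun, leftAnchor_pull, hlift_pull, hlift_pull, along_apply, along_apply]
  ring

theorem covec_rightAnchorFun_hat (D : Connection ρ) (D' : Connection ρ') (Z : ΓT) (γ : ΓE)
    (κ : DualTotal F V) :
    covec (I := dualModel EB F) (hatFun γ) κ (rightAnchorFun D D' κ (Z.1 κ)) =
      ((leftAnchor ρ).deriv Z (hatFun γ) - along (connHat D γ) Z +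
        along (connHat D' γ) Z : CE) κ := by
  rw [covec_rightAnchorFun, hlift_hat, hlift_hat]
  rfl

/-- The anchor `(e, X) ↦ X - e^{Dh} + e^{D'h}`. -/
def rightAnchor (D : Connection ρ) (D' : Connection ρ') : Anchor (leftTangentSections ρ) where
  toFun := rightAnchorFun D D'
  smooth Z := by
    refine mem_vectorFields_of (fun f => ?_) fun γ => ?_
    · simp only [covec_rightAnchorFun_pull]
      exact (along (anchorHat ρ' f) Z).contMDiff
    · simp only [covec_rightAnchorFun_hat]
      exact ((leftAnchor ρ).deriv Z (hatFun γ) - along (connHat D γ) Z +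
        along (connHat D' γ) Z : CE).contMDiff

theorem rightAnchor_pull (D : Connection ρ) (D' : Connection ρ') (Z : ΓT) (f : CQ) :
    (rightAnchor D D').deriv Z (pull f) = along (anchorHat ρ' f) Z :=
  ContMDiffMap.ext fun κ => covec_rightAnchorFun_pull D D' Z f κ

/-- The component of a section `(a, X)` in `E`, as the map `ν ↦ ν(a)`. -/
def horPart (Z : ΓT) : ΓE' →ₗ[CQ] CE where
  toFun ν := along (pullDual ν) Z
  map_add' ν ν' := by rw [map_add, along_add_left]
  map_smul' f ν := by rw [map_smul, along_pull_smul_left]; rfl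

theorem horPart_apply (Z : ΓT) (ν : ΓE') : horPart Z ν = along (pullDual ν) Z := rfl

theorem horPart_add (Z Z' : ΓT) : horPart (Z + Z') = horPart Z + horPart Z' :=
  LinearMap.ext fun ν => along_add_right (pullDual ν) Z Z'

theorem horPart_smul (g : CE) (Z : ΓT) : horPart (g • Z) = g • horPart Z :=
  LinearMap.ext fun ν => along_smul_right g (pullDual ν) Z

theorem horPart_sub (Z Z' : ΓT) : horPart (Z - Z') = horPart Z - horPart Z' :=
  map_sub (AddMonoidHom.mk' (horPart (ρ := ρ)) horPart_add) Z Z'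

theorem horPart_sum {ι : Type*} (s : Finset ι) (Z : ι → ΓT) :
    horPart (∑ i ∈ s, Z i) = ∑ i ∈ s, horPart (Z i) :=
  map_sum (AddMonoidHom.mk' (horPart (ρ := ρ)) horPart_add) _ _

/-- The vertical component of a section `(a, X)` with respect to a connection: the map
`γ ↦ X(γ̂) - κ(D_a γ)`. -/
def vertPart (D : Connection ρ) (Z : ΓT) : ΓE⋆ where
  toFun γ := (leftAnchor ρ).deriv Z (hatFun γ) - along (connHat D γ) Z
  map_add' γ γ' := by
    rw [hatFun_add, connHat_add, along_add_left, Anchor.deriv_add_right]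
    abel
  map_smul' f γ := by
    rw [hatFun_smul, connHat_smul, along_add_left, along_smul_left, along_pull_smul_left,
      Anchor.deriv_mul_right, leftAnchor_pull, RingHom.id_apply, pull_smul]
    ring

theorem vertPart_apply (D : Connection ρ) (Z : ΓT) (γ : ΓE) :
    vertPart D Z γ = (leftAnchor ρ).deriv Z (hatFun γ) - along (connHat D γ) Z := rfl

theorem vertPart_add (D : Connection ρ) (Z Z' : ΓT) :
    vertPart D (Z + Z') = vertPart D Z + vertPart D Z' :=
  LinearMap.ext fun γ => by
    rw [LinearMap.add_apply, vertPart_apply, vertPart_apply, vertPart_apply, along_add_right,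
      Anchor.deriv_add_left]
    abel

theorem vertPart_smul (D : Connection ρ) (g : CE) (Z : ΓT) :
    vertPart D (g • Z) = g • vertPart D Z :=
  LinearMap.ext fun γ => by
    rw [LinearMap.smul_apply, vertPart_apply, vertPart_apply, along_smul_right,
      Anchor.deriv_smul_left, smul_eq_mul, mul_sub]

theorem vertPart_sub (D : Connection ρ) (Z Z' : ΓT) :
    vertPart D (Z - Z') = vertPart D Z - vertPart D Z' :=
  map_sub (AddMonoidHom.mk' (vertPart D) (vertPart_add D)) Z Z'

theorem vertPart_sum (D : Connection ρ) {ι : Type*} (s : Finset ι) (Z : ι → ΓT) :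
    vertPart D (∑ i ∈ s, Z i) = ∑ i ∈ s, vertPart D (Z i) :=
  map_sum (AddMonoidHom.mk' (vertPart D) (vertPart_add D)) _ _

theorem leftAnchor_hat (D : Connection ρ) (Z : ΓT) (γ : ΓE) :
    (leftAnchor ρ).deriv Z (hatFun γ) = vertPart D Z γ + along (connHat D γ) Z :=
  (sub_add_cancel _ _).symm

theorem rightAnchor_hat (D : Connection ρ) (D' : Connection ρ') (Z : ΓT) (γ : ΓE) :
    (rightAnchor D D').deriv Z (hatFun γ) = vertPart D Z γ + along (connHat D' γ) Z :=
  ContMDiffMap.ext fun κ => covec_rightAnchorFun_hat D D' Z γ κ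

/-- Vectors of `E` are separated by the sections of the dual bundle. -/
theorem vec_ext {κ : DualTotal F V} {e e' : V κ.proj}
    (h : ∀ ν : ΓE', alongFun (pullDual ν) κ e = alongFun (pullDual ν) κ e') : e = e' := by
  obtain ⟨σ, rfl⟩ := exists_sec (EB := EB) (F := F) κ.proj e
  obtain ⟨σ', rfl⟩ := exists_sec (EB := EB) (F := F) κ.proj e'
  refine sub_eq_zero.1 (eq_zero_of_dual (EB := EB) (γ := σ - σ') fun ν => ?_)
  have h1 := h ν
  rw [alongFun_sec, alongFun_sec] at h1
  rw [map_sub]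
  exact sub_eq_zero.2 h1

variable (D : Connection ρ)

/-- A section of the left `E`-tangent bundle is determined by its two components. -/
theorem parts_injective {Z Z' : ΓT} (h1 : horPart Z = horPart Z')
    (h2 : vertPart D Z = vertPart D Z') : Z = Z' := by
  have ha (κ : DualTotal F V) : (Z.1 κ).1.1 = (Z'.1 κ).1.1 :=
    vec_ext (EB := EB) fun ν => congrArg (fun u : ΓE' →ₗ[CQ] CE => u ν κ) h1
  have halong (Θ : ΓE⋆) : along Θ Z = along Θ Z' :=
    ContMDiffMap.ext fun κ => by rw [along_apply, along_apply, ha]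
  refine SectionModule.ext_apply fun κ => Subtype.ext (Prod.ext (ha κ) (tangent_ext ?_ ?_))
  · intro f
    have h := (leftAnchor_pull Z f).trans ((halong _).trans (leftAnchor_pull Z' f).symm)
    exact congrArg (fun g : CE => g κ) h
  · intro γ
    have h : (leftAnchor ρ).deriv Z (hatFun γ) = (leftAnchor ρ).deriv Z' (hatFun γ) := by
      rw [leftAnchor_hat D, leftAnchor_hat D, h2, halong]
    exact congrArg (fun g : CE => g κ) h

/-- The map `a : E^* → E` with prescribed values `ν(a)`. -/
def horFun (u : ΓE' →ₗ[CQ] CE) (κ : DualTotal F V) : V κ.proj :=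
  ∑ i, u (coframe EB F V κ.proj i) κ • (frame EB F V κ.proj i).1 κ.proj

theorem alongFun_horFun (u : ΓE' →ₗ[CQ] CE) (κ : DualTotal F V) (ν : ΓE') :
    alongFun (pullDual ν) κ (horFun u κ) = u ν κ := by
  have h1 : alongFun (pullDual ν) κ (horFun u κ) =
      ∑ i, u (coframe EB F V κ.proj i) κ * ν (frame EB F V κ.proj i) κ.proj := by
    refine (map_sum (AddMonoidHom.mk' (alongFun (EB := EB) (pullDual ν) κ)
      (alongFun_add (pullDual ν) κ)) _ _).trans ?_
    refine Finset.sum_congr rfl fun i _ => ?_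
    refine (alongFun_smul (EB := EB) (pullDual ν) κ _ _).trans ?_
    rw [alongFun_sec]
    rfl
  have h2 : (frameCut EB F V κ.proj • u ν : CE) κ = u ν κ := by
    change frameCut EB F V κ.proj κ.proj * u ν κ = _
    rw [frameCut_self, one_mul]
  rw [h1, ← h2, ← map_smul, ← coframe_expansion, map_sum]
  simp only [map_smul]
  refine ((map_sum (ContMDiffMap.evalRingHom κ) _ _).trans ?_).symm
  exact Finset.sum_congr rfl fun i _ => mul_comm _ _

theorem contMDiff_horFun (u : ΓE' →ₗ[CQ] CE) :
    ContMDiff (dualModel EB F) (𝓘(ℝ, EB).prod 𝓘(ℝ, F)) ∞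
      fun κ : DualTotal F V => TotalSpace.mk' F κ.proj (horFun u κ) := by
  refine contMDiff_of_frameCoord fun q i => ?_
  refine (u (coframe EB F V q i)).contMDiff.congr fun κ => ?_
  rw [← alongFun_horFun]
  obtain ⟨σ, hσ⟩ := exists_sec (EB := EB) (F := F) κ.proj (horFun u κ)
  rw [← hσ, alongFun_sec]
  rfl

/-- The vector part of the section with given components, at a point. -/
theorem exists_vertFun (u : ΓE' →ₗ[CQ] CE) (w : ΓE⋆) (κ : DualTotal F V) :
    ∃ v : DualTangent (EB := EB) κ, projTangent κ v = ρ.toFun κ.proj (horFun u κ) ∧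
      ∀ γ, covec (I := dualModel EB F) (hatFun γ) κ v =
        w γ κ + alongFun (connHat D γ) κ (horFun u κ) := by
  obtain ⟨σ, hσ⟩ := exists_sec (EB := EB) (F := F) κ.proj (horFun u κ)
  rw [← hσ]
  simp only [alongFun_sec]
  refine exists_liftVector κ _ _ (fun γ γ' => ?_) fun f γ => ?_
  · rw [map_add, connHat_add]
    change (w γ κ + w γ' κ) + (connHat D γ σ κ + connHat D γ' σ κ) = _
    ring
  · rw [map_smul, connHat_smul]
    change f κ.proj * w γ κ + (hatFun γ κ * ρ.deriv σ f κ.proj + f κ.proj * connHat D γ σ κ) = _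
    rw [hatFun_apply, Anchor.deriv_apply, mul_add, mul_comm (κ.2 _)]
    ring

/-- The two components of a section of the left `E`-tangent bundle can be prescribed. -/
theorem parts_surjective (u : ΓE' →ₗ[CQ] CE) (w : ΓE⋆) :
    ∃ Z : ΓT, horPart Z = u ∧ vertPart D Z = w := by
  choose X hX hX' using exists_vertFun D u w
  have hpull (f : CQ) (κ : DualTotal F V) : covec (I := dualModel EB F) (pull f) κ (X κ) =
      alongFun (anchorHat ρ f) κ (horFun u κ) := by
    rw [covec_pull, hX, alongFun_anchorHat]
  have hsmooth : X ∈ (vectorFields (dualModel EB F) (DualTotal F V)).carrier := by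
    refine mem_vectorFields_of (fun f => ?_) fun γ => ?_
    · simp only [hpull]
      exact contMDiff_alongFun _ (contMDiff_horFun u)
    · simp only [hX']
      exact (w γ).contMDiff.add (contMDiff_alongFun _ (contMDiff_horFun u))
  let Z : ΓT := SectionModule.ofMem _ (fun κ => ⟨(horFun u κ, X κ), (hX κ).symm⟩)
    ⟨contMDiff_horFun u, hsmooth⟩
  refine ⟨Z, LinearMap.ext fun ν => ContMDiffMap.ext fun κ => alongFun_horFun u κ ν,
    LinearMap.ext fun γ => ContMDiffMap.ext fun κ => ?_⟩
  refine (congrArg (· - alongFun (connHat D γ) κ (horFun u κ)) (hX' κ γ)).trans ?_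
  exact add_sub_cancel_right _ _

/-- The section of the left `E`-tangent bundle with given components. -/
def ofParts (u : ΓE' →ₗ[CQ] CE) (w : ΓE⋆) : ΓT := (parts_surjective D u w).choose

theorem horPart_ofParts (u : ΓE' →ₗ[CQ] CE) (w : ΓE⋆) : horPart (ofParts D u w) = u :=
  (parts_surjective D u w).choose_spec.1

theorem vertPart_ofParts (u : ΓE' →ₗ[CQ] CE) (w : ΓE⋆) : vertPart D (ofParts D u w) = w :=
  (parts_surjective D u w).choose_spec.2

end Components

/-! ### Pull-back connections -/

section Bracket

variable {ρ ρ' : Anchor (bundleSections 𝓘(ℝ, EB) F V)}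

local notation "ΓT" => TSec ρ

/-- A `ρ`-connection on a module over the functions on `Q`. -/
structure ModuleConnection (ρ : Anchor (bundleSections 𝓘(ℝ, EB) F V))
    (N : Type*) [AddCommGroup N] [Module CQ N] where
  op : ΓE → N → N
  add_left : ∀ σ σ' n, op (σ + σ') n = op σ n + op σ' n
  smul_left : ∀ (f : CQ) σ n, op (f • σ) n = f • op σ n
  add_right : ∀ σ n n', op σ (n + n') = op σ n + op σ n'
  leibniz : ∀ (f : CQ) σ n, op σ (f • n) = ρ.deriv σ f • n + f • op σ n

/-- A connection on `E`, viewed as a connection on the module of sections. -/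
def Connection.onSec (D : Connection ρ) : ModuleConnection ρ ΓE where
  op σ γ := D.D σ γ
  add_left σ σ' γ := by rw [map_add, LinearMap.add_apply]
  smul_left f σ γ := D.smul_left f σ γ
  add_right σ γ γ' := map_add _ γ γ'
  leibniz f σ γ := D.leibniz f σ γ

theorem Connection.dual_apply (D : Connection ρ) (σ : ΓE) (ν : ΓE') (γ : ΓE) :
    D.dual σ ν γ = ρ.deriv σ (ν γ) - ν (D.D σ γ) := rfl

/-- The dual connection, on the module of sections of the dual bundle. -/
def Connection.onDual (D : Connection ρ) : ModuleConnection ρ ΓE' where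
  op σ ν := D.dual σ ν
  add_left σ σ' ν := LinearMap.ext fun γ => by
    rw [LinearMap.add_apply, D.dual_apply, D.dual_apply, D.dual_apply, map_add,
      LinearMap.add_apply, map_add, Anchor.deriv_add_left]
    abel
  smul_left f σ ν := LinearMap.ext fun γ => by
    rw [LinearMap.smul_apply, D.dual_apply, D.dual_apply, D.smul_left, map_smul,
      Anchor.deriv_smul_left, smul_eq_mul, smul_eq_mul, mul_sub]
  add_right σ ν ν' := LinearMap.ext fun γ => by
    rw [LinearMap.add_apply, D.dual_apply, D.dual_apply, D.dual_apply, LinearMap.add_apply,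
      LinearMap.add_apply, Anchor.deriv_add_right]
    abel
  leibniz f σ ν := LinearMap.ext fun γ => by
    rw [LinearMap.add_apply, LinearMap.smul_apply, LinearMap.smul_apply, D.dual_apply,
      D.dual_apply, LinearMap.smul_apply, LinearMap.smul_apply]
    simp only [smul_eq_mul]
    rw [Anchor.deriv_mul_right]
    ring

section nabla

variable {N : Type*} [AddCommGroup N] [Module C^∞⟮𝓘(ℝ, EB), Q; 𝓘(ℝ, ℝ), ℝ⟯ N]

/-- The map `σ ↦ s(D_σ n)`. -/
def ModuleConnection.hat (C : ModuleConnection ρ' N) (s : N →ₗ[CQ] CE) (n : N) : ΓE⋆ where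
  toFun σ := s (C.op σ n)
  map_add' σ σ' := by rw [C.add_left, map_add]
  map_smul' f σ := by rw [C.smul_left, map_smul, RingHom.id_apply]

theorem ModuleConnection.hat_apply (C : ModuleConnection ρ' N) (s : N →ₗ[CQ] CE) (n : N) (σ : ΓE) :
    C.hat s n σ = s (C.op σ n) := rfl

theorem ModuleConnection.hat_add (C : ModuleConnection ρ' N) (s : N →ₗ[CQ] CE) (n n' : N) :
    C.hat s (n + n') = C.hat s n + C.hat s n' :=
  LinearMap.ext fun σ => by
    rw [LinearMap.add_apply, C.hat_apply, C.hat_apply, C.hat_apply, C.add_right, map_add]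

theorem ModuleConnection.hat_smul (C : ModuleConnection ρ' N) (s : N →ₗ[CQ] CE) (f : CQ) (n : N) :
    C.hat s (f • n) = s n • anchorHat ρ' f + f • C.hat s n :=
  LinearMap.ext fun σ => by
    rw [LinearMap.add_apply, C.hat_apply, C.leibniz, map_add, map_smul, map_smul,
      LinearMap.smul_apply, LinearMap.smul_apply, C.hat_apply, anchorHat_apply, pull_smul,
      smul_eq_mul, mul_comm]

theorem ModuleConnection.hat_map_add (C : ModuleConnection ρ' N) (s s' : N →ₗ[CQ] CE) (n : N) :
    C.hat (s + s') n = C.hat s n + C.hat s' n := rfl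

theorem ModuleConnection.hat_map_smul (C : ModuleConnection ρ' N) (g : CE) (s : N →ₗ[CQ] CE)
    (n : N) : C.hat (g • s) n = g • C.hat s n := rfl

/-- An anchor of the left `E`-tangent bundle covers an anchor of `E`. -/
def Covers (a : Anchor (leftTangentSections ρ)) (ρ' : Anchor (bundleSections 𝓘(ℝ, EB) F V)) :
    Prop :=
  ∀ (Z : ΓT) (f : CQ), a.deriv Z (pull f) = along (anchorHat ρ' f) Z

variable {a : Anchor (leftTangentSections ρ)} (ha : Covers a ρ')

/-- The pull-back of a connection to the left `E`-tangent bundle, acting on sections of the pulled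
back bundle, which are viewed as linear maps on the module of sections of its dual. -/
def nabla (ha : Covers a ρ') (C : ModuleConnection ρ' N) (Z : ΓT) (s : N →ₗ[CQ] CE) :
    N →ₗ[CQ] CE where
  toFun n := a.deriv Z (s n) - along (C.hat s n) Z
  map_add' n n' := by
    rw [map_add, C.hat_add, along_add_left, Anchor.deriv_add_right]
    abel
  map_smul' f n := by
    rw [map_smul, C.hat_smul, along_add_left, along_smul_left, along_pull_smul_left, pull_smul,
      Anchor.deriv_mul_right, ha, RingHom.id_apply, pull_smul]
    ring

theorem nabla_apply (C : ModuleConnection ρ' N) (Z : ΓT) (s : N →ₗ[CQ] CE) (n : N) :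
    nabla ha C Z s n = a.deriv Z (s n) - along (C.hat s n) Z := rfl

variable (C : ModuleConnection ρ' N)

theorem nabla_add_left (Z Z' : ΓT) (s : N →ₗ[CQ] CE) :
    nabla ha C (Z + Z') s = nabla ha C Z s + nabla ha C Z' s :=
  LinearMap.ext fun n => by
    rw [LinearMap.add_apply, nabla_apply, nabla_apply, nabla_apply, along_add_right,
      Anchor.deriv_add_left]
    abel

theorem nabla_smul_left (g : CE) (Z : ΓT) (s : N →ₗ[CQ] CE) :
    nabla ha C (g • Z) s = g • nabla ha C Z s :=
  LinearMap.ext fun n => by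
    rw [LinearMap.smul_apply, nabla_apply, nabla_apply, along_smul_right, Anchor.deriv_smul_left,
      smul_eq_mul, mul_sub]

theorem nabla_add_right (Z : ΓT) (s s' : N →ₗ[CQ] CE) :
    nabla ha C Z (s + s') = nabla ha C Z s + nabla ha C Z s' :=
  LinearMap.ext fun n => by
    rw [LinearMap.add_apply, nabla_apply, nabla_apply, nabla_apply, C.hat_map_add, along_add_left,
      LinearMap.add_apply, Anchor.deriv_add_right]
    abel

theorem nabla_leibniz (g : CE) (Z : ΓT) (s : N →ₗ[CQ] CE) :
    nabla ha C Z (g • s) = a.deriv Z g • s + g • nabla ha C Z s :=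
  LinearMap.ext fun n => by
    rw [LinearMap.add_apply, LinearMap.smul_apply, LinearMap.smul_apply, nabla_apply, nabla_apply,
      C.hat_map_smul, along_smul_left, LinearMap.smul_apply, smul_eq_mul, smul_eq_mul, smul_eq_mul,
      Anchor.deriv_mul_right]
    ring

theorem nabla_zero (Z : ΓT) : nabla ha C Z 0 = 0 := by
  have h := nabla_add_right ha C Z 0 0
  rwa [add_zero, left_eq_add] at h

end nabla

/-! ### The lifted algebroid structure -/

/-- The fibrewise linear functions as a linear map. -/
def hatLin : ΓE⋆ where
  toFun := hatFun
  map_add' := hatFun_add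
  map_smul' := hatFun_smul

theorem hatLin_apply (γ : ΓE) : hatLin γ = hatFun γ := rfl

/-- The map `σ ↦ κ(R(σ, a', γ))`, for a section `(a', X')`. -/
def tensorHat (R : (bundleSections 𝓘(ℝ, EB) F V).Tensor13) (Z' : ΓT) (γ : ΓE) : ΓE⋆ where
  toFun σ := along (hatLin.comp ((R σ).flip γ)) Z'
  map_add' σ σ' := by
    rw [← along_add_left]
    exact congrArg (fun Θ : ΓE⋆ => along Θ Z') (LinearMap.ext fun σ'' => by
      simp only [map_add, LinearMap.comp_apply, LinearMap.flip_apply, LinearMap.add_apply])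
  map_smul' f σ := by
    rw [RingHom.id_apply, pull_smul, ← along_pull_smul_left]
    exact congrArg (fun Θ : ΓE⋆ => along Θ Z') (LinearMap.ext fun σ'' => by
      simp only [map_smul, LinearMap.comp_apply, LinearMap.flip_apply, LinearMap.smul_apply])

theorem tensorHat_apply (R : (bundleSections 𝓘(ℝ, EB) F V).Tensor13) (Z' : ΓT) (γ σ : ΓE) :
    tensorHat R Z' γ σ = along (hatLin.comp ((R σ).flip γ)) Z' := rfl

/-- The vertical component `γ ↦ κ(R(a, a', γ))`. -/
def tensorPart (R : (bundleSections 𝓘(ℝ, EB) F V).Tensor13) (Z Z' : ΓT) : ΓE⋆ where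
  toFun γ := along (tensorHat R Z' γ) Z
  map_add' γ γ' := by
    rw [← along_add_left]
    refine congrArg (fun Θ : ΓE⋆ => along Θ Z) (LinearMap.ext fun σ => ?_)
    rw [LinearMap.add_apply, tensorHat_apply, tensorHat_apply, tensorHat_apply, ← along_add_left]
    exact congrArg (fun Θ : ΓE⋆ => along Θ Z') (LinearMap.ext fun σ'' => by
      simp only [map_add, LinearMap.comp_apply, LinearMap.flip_apply, LinearMap.add_apply])
  map_smul' f γ := by
    rw [RingHom.id_apply, pull_smul, ← along_pull_smul_left]
    refine congrArg (fun Θ : ΓE⋆ => along Θ Z) (LinearMap.ext fun σ => ?_)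
    rw [LinearMap.smul_apply, tensorHat_apply, tensorHat_apply, pull_smul, ← along_pull_smul_left]
    exact congrArg (fun Θ : ΓE⋆ => along Θ Z') (LinearMap.ext fun σ'' => by
      simp only [map_smul, LinearMap.comp_apply, LinearMap.flip_apply, LinearMap.smul_apply])

theorem tensorPart_apply (R : (bundleSections 𝓘(ℝ, EB) F V).Tensor13) (Z Z' : ΓT) (γ : ΓE) :
    tensorPart R Z Z' γ = along (tensorHat R Z' γ) Z := rfl

theorem tensorPart_add_left (R : (bundleSections 𝓘(ℝ, EB) F V).Tensor13) (Z₁ Z₂ Z' : ΓT) :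
    tensorPart R (Z₁ + Z₂) Z' = tensorPart R Z₁ Z' + tensorPart R Z₂ Z' :=
  LinearMap.ext fun γ => along_add_right (tensorHat R Z' γ) Z₁ Z₂

theorem tensorPart_smul_left (R : (bundleSections 𝓘(ℝ, EB) F V).Tensor13) (g : CE) (Z Z' : ΓT) :
    tensorPart R (g • Z) Z' = g • tensorPart R Z Z' :=
  LinearMap.ext fun γ => along_smul_right g (tensorHat R Z' γ) Z

theorem tensorPart_add_right (R : (bundleSections 𝓘(ℝ, EB) F V).Tensor13) (Z Z₁ Z₂ : ΓT) :
    tensorPart R Z (Z₁ + Z₂) = tensorPart R Z Z₁ + tensorPart R Z Z₂ :=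
  LinearMap.ext fun γ => by
    rw [LinearMap.add_apply, tensorPart_apply, tensorPart_apply, tensorPart_apply, ← along_add_left]
    exact congrArg (fun Θ : ΓE⋆ => along Θ Z)
      (LinearMap.ext fun σ => along_add_right (hatLin.comp ((R σ).flip γ)) Z₁ Z₂)

theorem tensorPart_smul_right (R : (bundleSections 𝓘(ℝ, EB) F V).Tensor13) (g : CE) (Z Z' : ΓT) :
    tensorPart R Z (g • Z') = g • tensorPart R Z Z' :=
  LinearMap.ext fun γ => by
    rw [LinearMap.smul_apply, tensorPart_apply, tensorPart_apply, smul_eq_mul, ← along_smul_left]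
    exact congrArg (fun Θ : ΓE⋆ => along Θ Z)
      (LinearMap.ext fun σ => along_smul_right g (hatLin.comp ((R σ).flip γ)) Z')

theorem leftAnchor_covers : Covers (leftAnchor ρ) ρ := leftAnchor_pull

variable (Dl : Connection ρ) (Dr : Connection ρ')

theorem rightAnchor_covers : Covers (rightAnchor Dl Dr) ρ' := rightAnchor_pull Dl Dr

/-- The component in `E` of the lifted bracket. -/
def bracketHor (Z Z' : ΓT) : ΓE' →ₗ[CQ] CE :=
  nabla leftAnchor_covers Dl.onDual Z (horPart Z') -
    nabla (rightAnchor_covers Dl Dr) Dr.onDual Z' (horPart Z)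

/-- The vertical component of the lifted bracket. -/
def bracketVert (R : (bundleSections 𝓘(ℝ, EB) F V).Tensor13) (Z Z' : ΓT) : ΓE⋆ :=
  nabla leftAnchor_covers Dl.onSec Z (vertPart Dl Z') -
    nabla (rightAnchor_covers Dl Dr) Dr.onSec Z' (vertPart Dl Z) + tensorPart R Z Z'

/-- The lifted bracket: the difference of the pull-backs of the two connections, to which the
vertical lift of the tensor `R` is added. -/
def bracket (R : (bundleSections 𝓘(ℝ, EB) F V).Tensor13) (Z Z' : ΓT) : ΓT :=
  ofParts Dl (bracketHor Dl Dr Z Z') (bracketVert Dl Dr R Z Z')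

theorem horPart_bracket (R : (bundleSections 𝓘(ℝ, EB) F V).Tensor13) (Z Z' : ΓT) :
    horPart (bracket Dl Dr R Z Z') = bracketHor Dl Dr Z Z' := horPart_ofParts Dl _ _

theorem vertPart_bracket (R : (bundleSections 𝓘(ℝ, EB) F V).Tensor13) (Z Z' : ΓT) :
    vertPart Dl (bracket Dl Dr R Z Z') = bracketVert Dl Dr R Z Z' := vertPart_ofParts Dl _ _

theorem bracket_add_left (R : (bundleSections 𝓘(ℝ, EB) F V).Tensor13) (Z₁ Z₂ Z' : ΓT) :
    bracket Dl Dr R (Z₁ + Z₂) Z' = bracket Dl Dr R Z₁ Z' + bracket Dl Dr R Z₂ Z' := by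
  refine parts_injective Dl ?_ ?_
  · simp only [horPart_add, horPart_bracket, bracketHor, nabla_add_left, nabla_add_right]
    abel
  · simp only [vertPart_add, vertPart_bracket, bracketVert, nabla_add_left, nabla_add_right,
      tensorPart_add_left]
    abel

theorem bracket_add_right (R : (bundleSections 𝓘(ℝ, EB) F V).Tensor13) (Z Z₁ Z₂ : ΓT) :
    bracket Dl Dr R Z (Z₁ + Z₂) = bracket Dl Dr R Z Z₁ + bracket Dl Dr R Z Z₂ := by
  refine parts_injective Dl ?_ ?_
  · simp only [horPart_add, horPart_bracket, bracketHor, nabla_add_left, nabla_add_right]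
    abel
  · simp only [vertPart_add, vertPart_bracket, bracketVert, nabla_add_left, nabla_add_right,
      tensorPart_add_right]
    abel

theorem bracket_leibniz (R : (bundleSections 𝓘(ℝ, EB) F V).Tensor13) (g g' : CE) (Z Z' : ΓT) :
    bracket Dl Dr R (g • Z) (g' • Z') =
      (g * (leftAnchor ρ).deriv Z g') • Z' - (g' * (rightAnchor Dl Dr).deriv Z' g) • Z +
        (g * g') • bracket Dl Dr R Z Z' := by
  refine parts_injective Dl ?_ ?_
  · simp only [horPart_add, horPart_sub, horPart_smul, horPart_bracket, bracketHor,
      nabla_smul_left, nabla_leibniz, Anchor.deriv_smul_left]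
    module
  · simp only [vertPart_add, vertPart_sub, vertPart_smul, vertPart_bracket, bracketVert,
      nabla_smul_left, nabla_leibniz, Anchor.deriv_smul_left, tensorPart_smul_left,
      tensorPart_smul_right]
    module

theorem bracket_const_smul_left (R : (bundleSections 𝓘(ℝ, EB) F V).Tensor13) (r : ℝ) (Z Z' : ΓT) :
    bracket Dl Dr R (r • Z) Z' = r • bracket Dl Dr R Z Z' := by
  have h := bracket_leibniz Dl Dr R (ContMDiffMap.const r) (ContMDiffMap.const 1) Z Z'
  rw [Anchor.deriv_const, Anchor.deriv_const, mul_zero, mul_zero, zero_smul, zero_smul, sub_zero,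
    zero_add] at h
  have h1 : (ContMDiffMap.const 1 : CE) = 1 := rfl
  rw [h1, one_smul, mul_one] at h
  exact h

theorem bracket_const_smul_right (R : (bundleSections 𝓘(ℝ, EB) F V).Tensor13) (r : ℝ) (Z Z' : ΓT) :
    bracket Dl Dr R Z (r • Z') = r • bracket Dl Dr R Z Z' := by
  have h := bracket_leibniz Dl Dr R (ContMDiffMap.const 1) (ContMDiffMap.const r) Z Z'
  rw [Anchor.deriv_const, Anchor.deriv_const, mul_zero, mul_zero, zero_smul, zero_smul, sub_zero,
    zero_add] at h
  have h1 : (ContMDiffMap.const 1 : CE) = 1 := rfl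
  rw [h1, one_smul, one_mul] at h
  exact h

/-- The lifted algebroid structure on the left `E`-tangent bundle to `E^*`. -/
def liftedAlgebroid (R : (bundleSections 𝓘(ℝ, EB) F V).Tensor13) :
    Algebroid (leftTangentSections ρ) where
  l := leftAnchor ρ
  r := rightAnchor Dl Dr
  B := LinearMap.mk₂ ℝ (bracket Dl Dr R) (bracket_add_left Dl Dr R)
    (bracket_const_smul_left Dl Dr R) (bracket_add_right Dl Dr R)
    (bracket_const_smul_right Dl Dr R)
  leibniz := bracket_leibniz Dl Dr R

end Bracket

section Lifts

variable {ρ ρ' : Anchor (bundleSections 𝓘(ℝ, EB) F V)}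

local notation "ΓT" => TSec ρ

/-! ### Horizontal and vertical lifts as sections -/

theorem along_eq_of_fst {Z : ΓT} {σ : ΓE} (h : ∀ κ, (Z.1 κ).1.1 = σ.1 κ.proj) (Θ : ΓE⋆) :
    along Θ Z = Θ σ :=
  ContMDiffMap.ext fun κ => by rw [along_apply, h, alongFun_sec]

theorem horPart_eq_evalHat_iff {Z : ΓT} {σ : ΓE} :
    horPart Z = evalHat σ ↔ ∀ κ, (Z.1 κ).1.1 = σ.1 κ.proj := by
  refine ⟨fun h κ => vec_ext (EB := EB) fun ν => ?_, fun h => LinearMap.ext fun ν => ?_⟩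
  · have h1 := congrArg (fun u : ΓE' →ₗ[CQ] CE => u ν κ) h
    refine Eq.trans ?_ (h1.trans ?_)
    · rfl
    · rw [alongFun_sec]; rfl
  · rw [horPart_apply, along_eq_of_fst h]
    rfl

theorem along_of_horPart {Z : ΓT} {σ : ΓE} (h : horPart Z = evalHat σ) (Θ : ΓE⋆) :
    along Θ Z = Θ σ :=
  along_eq_of_fst (horPart_eq_evalHat_iff.1 h) Θ

theorem evalHat_zero : (evalHat 0 : ΓE' →ₗ[CQ] CE) = 0 :=
  LinearMap.ext fun ν => by
    rw [evalHat_apply, map_zero]; rfl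

theorem along_of_horPart_zero {Z : ΓT} (h : horPart Z = 0) (Θ : ΓE⋆) : along Θ Z = 0 := by
  rw [along_of_horPart (h.trans evalHat_zero.symm), map_zero]

/-- A section of the left `E`-tangent bundle is the sum of the horizontal lift of `σ` and of a
vertical vector field exactly when its components are those of the two summands. -/
theorem eq_hlift_add_iff (D : Connection ρ) {Z : ΓT} {σ : ΓE} {w : ΓE⋆}
    {v : ∀ κ : DualTotal F V, DualTangent (EB := EB) κ}
    (hv : ∀ κ, (∀ f : CQ, covec (I := dualModel EB F) (pull f) κ (v κ) = 0) ∧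
      ∀ γ : ΓE, covec (I := dualModel EB F) (hatFun γ) κ (v κ) = w γ κ) :
    (∀ κ, (Z.1 κ).1 = (σ.1 κ.proj, D.hlift κ (σ.1 κ.proj) + v κ)) ↔
      horPart Z = evalHat σ ∧ vertPart D Z = w := by
  constructor
  · intro h
    have h1 : ∀ κ, (Z.1 κ).1.1 = σ.1 κ.proj := fun κ => congrArg Prod.fst (h κ)
    refine ⟨horPart_eq_evalHat_iff.2 h1, LinearMap.ext fun γ => ContMDiffMap.ext fun κ => ?_⟩
    have h2 : (Z.1 κ).1.2 = D.hlift κ (σ.1 κ.proj) + v κ := congrArg Prod.snd (h κ)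
    have h3 : (leftAnchor ρ).deriv Z (hatFun γ) κ = along (connHat D γ) Z κ + w γ κ := by
      refine (congrArg (covec (I := dualModel EB F) (hatFun γ) κ) h2).trans ?_
      rw [map_add, (hv κ).2, hlift_hat, along_apply, h1]
    have h4 := congrArg (fun g : CE => g κ) (leftAnchor_hat D Z γ)
    have h5 : (leftAnchor ρ).deriv Z (hatFun γ) κ =
      vertPart D Z γ κ + along (connHat D γ) Z κ := h4
    linarith
  · rintro ⟨h1, h2⟩ κ
    have h1' := horPart_eq_evalHat_iff.1 h1
    refine Prod.ext (h1' κ) (tangent_ext (fun f => ?_) fun γ => ?_)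
    · have h3 := congrArg (fun g : CE => g κ) (leftAnchor_pull Z f)
      refine h3.trans ?_
      rw [map_add, (hv κ).1, add_zero, hlift_pull, along_apply, h1']
    · have h3 := congrArg (fun g : CE => g κ) (leftAnchor_hat D Z γ)
      refine h3.trans ?_
      change vertPart D Z γ κ + along (connHat D γ) Z κ = _
      rw [map_add, (hv κ).2, hlift_hat, along_apply, h1', h2, add_comm]

theorem isHorizontalLift_iff (D : Connection ρ) {Z : ΓT} {σ : ΓE} :
    IsHorizontalLift D σ Z ↔ horPart Z = evalHat σ ∧ vertPart D Z = 0 := by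
  rw [← eq_hlift_add_iff D (v := fun _ => 0)
    fun κ => ⟨fun f => map_zero _, fun γ => map_zero _⟩]
  exact forall_congr' fun κ => by rw [add_zero]

theorem hlift_zero (D : Connection ρ) (κ : DualTotal F V) : D.hlift κ 0 = 0 :=
  map_zero (hliftLin D κ)

theorem isVerticalLift_iff (D : Connection ρ) {Z : ΓT} {ν : ΓE'} :
    IsVerticalLift ν Z ↔ horPart Z = 0 ∧ vertPart D Z = pullDual ν := by
  rw [← evalHat_zero, ← eq_hlift_add_iff D (v := fun κ => vlift ν κ)
    fun κ => ⟨(vlift_spec ν κ).1, (vlift_spec ν κ).2⟩]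
  refine forall_congr' fun κ => ?_
  rw [SectionModule.zero_apply, hlift_zero, zero_add]

/-- The horizontal lift of a section of `E`. -/
def horLift (D : Connection ρ) (σ : ΓE) : ΓT := ofParts D (evalHat σ) 0

/-- The vertical lift of a section of the dual bundle. -/
def vertLift (D : Connection ρ) (ν : ΓE') : ΓT := ofParts D 0 (pullDual ν)

theorem horPart_horLift (D : Connection ρ) (σ : ΓE) : horPart (horLift D σ) = evalHat σ :=
  horPart_ofParts D _ _

theorem vertPart_horLift (D : Connection ρ) (σ : ΓE) : vertPart D (horLift D σ) = 0 :=
  vertPart_ofParts D _ _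

theorem horPart_vertLift (D : Connection ρ) (ν : ΓE') : horPart (vertLift D ν) = 0 :=
  horPart_ofParts D _ _

theorem vertPart_vertLift (D : Connection ρ) (ν : ΓE') :
    vertPart D (vertLift D ν) = pullDual ν :=
  vertPart_ofParts D _ _

theorem isHorizontalLift_horLift (D : Connection ρ) (σ : ΓE) :
    IsHorizontalLift D σ (horLift D σ) :=
  (isHorizontalLift_iff D).2 ⟨horPart_horLift D σ, vertPart_horLift D σ⟩

theorem isVerticalLift_vertLift (D : Connection ρ) (ν : ΓE') :
    IsVerticalLift ν (vertLift D ν) :=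
  (isVerticalLift_iff D).2 ⟨horPart_vertLift D ν, vertPart_vertLift D ν⟩

theorem horLift_add (D : Connection ρ) (σ σ' : ΓE) :
    horLift D (σ + σ') = horLift D σ + horLift D σ' := by
  refine parts_injective D ?_ ?_
  · rw [horPart_add, horPart_horLift, horPart_horLift, horPart_horLift]
    exact LinearMap.ext fun ν => by
      rw [LinearMap.add_apply, evalHat_apply, evalHat_apply, evalHat_apply, map_add, pull_add]
  · rw [vertPart_add, vertPart_horLift, vertPart_horLift, vertPart_horLift, add_zero]

theorem horLift_smul (D : Connection ρ) (f : CQ) (σ : ΓE) :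
    horLift D (f • σ) = (pull f : CE) • horLift D σ := by
  refine parts_injective D ?_ ?_
  · rw [horPart_smul, horPart_horLift, horPart_horLift]
    exact LinearMap.ext fun ν => by
      rw [LinearMap.smul_apply, evalHat_apply, evalHat_apply, map_smul, smul_eq_mul, smul_eq_mul,
        pull_mul]
  · rw [vertPart_smul, vertPart_horLift, vertPart_horLift, smul_zero]

theorem vertLift_add (D : Connection ρ) (ν ν' : ΓE') :
    vertLift D (ν + ν') = vertLift D ν + vertLift D ν' := by
  refine parts_injective D ?_ ?_
  · rw [horPart_add, horPart_vertLift, horPart_vertLift, horPart_vertLift, add_zero]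
  · rw [vertPart_add, vertPart_vertLift, vertPart_vertLift, vertPart_vertLift, map_add]

theorem vertLift_smul (D : Connection ρ) (f : CQ) (ν : ΓE') :
    vertLift D (f • ν) = (pull f : CE) • vertLift D ν := by
  refine parts_injective D ?_ ?_
  · rw [horPart_smul, horPart_vertLift, horPart_vertLift, smul_zero]
  · rw [vertPart_smul, vertPart_vertLift, vertPart_vertLift, map_smul]
    rfl

theorem horPart_zero : horPart (0 : ΓT) = 0 := LinearMap.ext fun ν => map_zero (along (pullDual ν))

theorem vertPart_zero (D : Connection ρ) : vertPart D (0 : ΓT) = 0 := by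
  have h := vertPart_add D (0 : ΓT) 0
  rwa [add_zero, left_eq_add] at h

/-- The expansion of a section in the horizontal lifts of a cut-off frame and the vertical lifts of
the dual frame. -/
theorem lift_expansion (D : Connection ρ) (q : Q) (Z : ΓT) :
    (pull (frameCut EB F V q) : CE) • Z =
      ∑ i, horPart Z (coframe EB F V q i) • horLift D (frame EB F V q i) +
        ∑ i, vertPart D Z (frame EB F V q i) • vertLift D (coframe EB F V q i) := by
  refine parts_injective D ?_ ?_
  · rw [horPart_add, horPart_sum, horPart_sum]
    simp only [horPart_smul, horPart_horLift, horPart_vertLift, smul_zero, Finset.sum_const_zero,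
      add_zero]
    refine LinearMap.ext fun ν => ?_
    rw [LinearMap.smul_apply, smul_eq_mul, ← pull_smul, ← map_smul, ← coframe_expansion, map_sum,
      LinearMap.sum_apply]
    refine Finset.sum_congr rfl fun i _ => ?_
    rw [map_smul, LinearMap.smul_apply, evalHat_apply, pull_smul, smul_eq_mul, mul_comm]
  · rw [vertPart_add, vertPart_sum, vertPart_sum]
    simp only [vertPart_smul, vertPart_horLift, vertPart_vertLift, smul_zero,
      Finset.sum_const_zero, zero_add]
    refine LinearMap.ext fun γ => ?_
    rw [LinearMap.smul_apply, smul_eq_mul, ← pull_smul, ← map_smul, ← frame_expansion, map_sum,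
      LinearMap.sum_apply]
    refine Finset.sum_congr rfl fun i _ => ?_
    rw [map_smul, LinearMap.smul_apply, pullDual_apply, pull_smul, smul_eq_mul, mul_comm]

/-- A map that is tensorial at `κ` and vanishes on horizontal and vertical lifts is zero. -/
theorem eq_zero_of_lifts (D : Connection ρ) (κ : DualTotal F V) {G : Type*} [AddCommGroup G]
    [Module ℝ G] (L : ΓT →+ G) (hL : ∀ (g : CE) Z, L (g • Z) = g κ • L Z)
    (hh : ∀ σ, L (horLift D σ) = 0) (hv : ∀ ν, L (vertLift D ν) = 0) (Z : ΓT) : L Z = 0 := by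
  have h := hL (pull (frameCut EB F V κ.proj)) Z
  rw [pull_apply, frameCut_self, one_smul] at h
  rw [← h, lift_expansion D, map_add, map_sum, map_sum]
  simp only [hL, hh, hv, smul_zero, Finset.sum_const_zero, add_zero]

theorem endomorphism_eq_zero_of_lifts (D : Connection ρ) (L : ΓT →ₗ[CE] ΓT)
    (hh : ∀ σ, L (horLift D σ) = 0) (hv : ∀ ν, L (vertLift D ν) = 0) (Z : ΓT) : L Z = 0 := by
  refine SectionModule.ext_apply fun κ => ?_
  let ev : ΓT →+ leftTangent ρ κ := AddMonoidHom.mk' (fun Z : ΓT => Z.1 κ) fun _ _ => rfl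
  have h : (ev.comp L.toAddMonoidHom) Z = 0 := by
    refine eq_zero_of_lifts D κ (ev.comp L.toAddMonoidHom) (fun g Y => ?_) (fun σ => ?_)
      (fun ν => ?_) Z
    · have h1 : L (g • Y) = g • L Y := map_smul L g Y
      exact congrArg ev h1
    · exact congrArg ev (hh σ)
    · exact congrArg ev (hv ν)
  exact h

theorem lifts_ext (D : Connection ρ) {L L' : (leftTangentSections ρ).DualSec}
    (hh : ∀ σ, L (horLift D σ) = L' (horLift D σ))
    (hv : ∀ ν, L (vertLift D ν) = L' (vertLift D ν)) : L = L' := by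
  refine LinearMap.ext fun Z => ContMDiffMap.ext fun κ => ?_
  have h := eq_zero_of_lifts D κ (G := ℝ)
    (AddMonoidHom.mk' (fun Z : ΓT => L Z κ - L' Z κ) fun Z Z' => by
      rw [map_add, map_add]
      exact add_sub_add_comm _ _ _ _)
    (fun g Z => by
      change L (g • Z) κ - L' (g • Z) κ = g κ * (L Z κ - L' Z κ)
      rw [map_smul, map_smul, mul_sub]
      rfl)
    (fun σ => by
      change L (horLift D σ) κ - L' (horLift D σ) κ = 0
      rw [hh, sub_self])
    (fun ν => by
      change L (vertLift D ν) κ - L' (vertLift D ν) κ = 0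
      rw [hv, sub_self]) Z
  exact sub_eq_zero.1 h

end Lifts

section LiftedStructure

variable {ρ ρ' : Anchor (bundleSections 𝓘(ℝ, EB) F V)}

local notation "ΓT" => TSec ρ

/-! ### Existence of the lifted structure -/

section nabla

variable {a : Anchor (leftTangentSections ρ)} (ha : Covers a ρ')

theorem nabla_evalHat (D : Connection ρ') {Z : ΓT} {σ : ΓE} (h : horPart Z = evalHat σ) (σ' : ΓE) :
    nabla ha D.onDual Z (evalHat σ') = evalHat (D.D σ σ') :=
  LinearMap.ext fun ν => by
    rw [nabla_apply, along_of_horPart h, evalHat_apply, ha, along_of_horPart h, anchorHat_apply,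
      evalHat_apply]
    change pull (ρ'.deriv σ (ν σ')) - pull (D.dual σ ν σ') = pull (ν (D.D σ σ'))
    rw [D.dual_apply]
    refine ContMDiffMap.ext fun κ => ?_
    exact sub_sub_cancel _ _

theorem nabla_pullDual (D : Connection ρ') {Z : ΓT} {σ : ΓE} (h : horPart Z = evalHat σ) (ν : ΓE') :
    nabla ha D.onSec Z (pullDual ν) = pullDual (D.dual σ ν) :=
  LinearMap.ext fun γ => by
    rw [nabla_apply, along_of_horPart h, pullDual_apply, ha, along_of_horPart h, anchorHat_apply,
      pullDual_apply, D.dual_apply]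
    rfl

/-- The covariant derivative of a pulled back section vanishes along a vertical section. -/
theorem nabla_evalHat_vert (D : Connection ρ') {Z : ΓT} (h : horPart Z = 0) (σ' : ΓE) :
    nabla ha D.onDual Z (evalHat σ') = 0 := by
  rw [nabla_evalHat ha D (h.trans evalHat_zero.symm), map_zero, LinearMap.zero_apply, evalHat_zero]

theorem nabla_pullDual_vert (D : Connection ρ') {Z : ΓT} (h : horPart Z = 0) (ν : ΓE') :
    nabla ha D.onSec Z (pullDual ν) = 0 := by
  refine LinearMap.ext fun γ => ?_
  rw [nabla_apply, along_of_horPart_zero h, pullDual_apply, ha, along_of_horPart_zero h, sub_zero]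
  rfl

end nabla

theorem tensorPart_horizontal (R : (bundleSections 𝓘(ℝ, EB) F V).Tensor13) {Z Z' : ΓT}
    {σ σ' : ΓE} (h : horPart Z = evalHat σ) (h' : horPart Z' = evalHat σ') :
    tensorPart R Z Z' = hatLin.comp (R σ σ') :=
  LinearMap.ext fun γ => by
    rw [tensorPart_apply, along_of_horPart h, tensorHat_apply, along_of_horPart h']
    rfl

theorem tensorPart_vertical_left (R : (bundleSections 𝓘(ℝ, EB) F V).Tensor13) {Z : ΓT}
    (h : horPart Z = 0) (Z' : ΓT) : tensorPart R Z Z' = 0 :=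
  LinearMap.ext fun γ => by
    rw [tensorPart_apply, along_of_horPart_zero h]
    rfl

theorem tensorPart_vertical_right (R : (bundleSections 𝓘(ℝ, EB) F V).Tensor13) (Z : ΓT) {Z' : ΓT}
    (h : horPart Z' = 0) : tensorPart R Z Z' = 0 :=
  LinearMap.ext fun γ => by
    have h0 : tensorHat R Z' γ = 0 := LinearMap.ext fun σ => by
      rw [tensorHat_apply, along_of_horPart_zero h]
      rfl
    rw [tensorPart_apply, h0, map_zero]
    rfl

variable {A : Algebroid (bundleSections 𝓘(ℝ, EB) F V)} (Dl : Connection A.l) (Dr : Connection A.r)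
  (R : (bundleSections 𝓘(ℝ, EB) F V).Tensor13)

theorem liftedAlgebroid_bracket_horPart (Z Z' : TSec A.l) :
    horPart ((liftedAlgebroid Dl Dr R).B Z Z') = bracketHor Dl Dr Z Z' :=
  horPart_bracket Dl Dr R Z Z'

theorem liftedAlgebroid_bracket_vertPart (Z Z' : TSec A.l) :
    vertPart Dl ((liftedAlgebroid Dl Dr R).B Z Z') = bracketVert Dl Dr R Z Z' :=
  vertPart_bracket Dl Dr R Z Z'

theorem liftedAlgebroid_bracket_hh (hD : ∀ σ σ', A.B σ σ' = Dl.D σ σ' - Dr.D σ' σ)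
    {σ σ' : ΓE} {Z Z' : TSec A.l} (hZ : IsHorizontalLift Dl σ Z) (hZ' : IsHorizontalLift Dl σ' Z')
    (κ : DualTotal F V) :
    (((liftedAlgebroid Dl Dr R).B Z Z').1 κ).1 = ((A.B σ σ').1 κ.proj,
      Dl.hlift κ ((A.B σ σ').1 κ.proj) + tensorVlift (R σ σ') κ) := by
  revert κ
  obtain ⟨h1, h2⟩ := (isHorizontalLift_iff Dl).1 hZ
  obtain ⟨h1', h2'⟩ := (isHorizontalLift_iff Dl).1 hZ'
  refine (eq_hlift_add_iff Dl (w := hatLin.comp (R σ σ'))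
    fun κ => tensorVlift_spec (R σ σ') κ).2 ⟨?_, ?_⟩
  · rw [liftedAlgebroid_bracket_horPart, bracketHor, h1, h1', nabla_evalHat _ Dl h1,
      nabla_evalHat _ Dr h1', hD]
    exact LinearMap.ext fun ν => by
      rw [LinearMap.sub_apply, evalHat_apply, evalHat_apply, evalHat_apply, map_sub]
      rfl
  · rw [liftedAlgebroid_bracket_vertPart, bracketVert, h2, h2', nabla_zero, nabla_zero, sub_zero,
      zero_add, tensorPart_horizontal R h1 h1']

theorem liftedAlgebroid_bracket_hv {σ : ΓE} {ν : ΓE'} {Z Z' : TSec A.l}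
    (hZ : IsHorizontalLift Dl σ Z) (hZ' : IsVerticalLift ν Z') :
    IsVerticalLift (Dl.dual σ ν) ((liftedAlgebroid Dl Dr R).B Z Z') := by
  obtain ⟨h1, h2⟩ := (isHorizontalLift_iff Dl).1 hZ
  obtain ⟨h1', h2'⟩ := (isVerticalLift_iff Dl).1 hZ'
  refine (isVerticalLift_iff Dl).2 ⟨?_, ?_⟩
  · rw [liftedAlgebroid_bracket_horPart, bracketHor, h1, h1', nabla_zero,
      nabla_evalHat_vert _ Dr h1', sub_zero]
  · rw [liftedAlgebroid_bracket_vertPart, bracketVert, h2, h2', nabla_zero,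
      nabla_pullDual _ Dl h1, tensorPart_vertical_right R Z h1', sub_zero, add_zero]

theorem liftedAlgebroid_bracket_vh {μ : ΓE'} {σ' : ΓE} {Z Z' : TSec A.l}
    (hZ : IsVerticalLift μ Z) (hZ' : IsHorizontalLift Dl σ' Z') :
    IsVerticalLift (-Dr.dual σ' μ) ((liftedAlgebroid Dl Dr R).B Z Z') := by
  obtain ⟨h1, h2⟩ := (isVerticalLift_iff Dl).1 hZ
  obtain ⟨h1', h2'⟩ := (isHorizontalLift_iff Dl).1 hZ'
  refine (isVerticalLift_iff Dl).2 ⟨?_, ?_⟩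
  · rw [liftedAlgebroid_bracket_horPart, bracketHor, h1, h1', nabla_zero,
      nabla_evalHat_vert _ Dl h1, sub_zero]
  · rw [liftedAlgebroid_bracket_vertPart, bracketVert, h2, h2', nabla_zero,
      nabla_pullDual _ Dr h1', tensorPart_vertical_left R h1 Z', zero_sub, add_zero, map_neg]

theorem liftedAlgebroid_bracket_vv {μ ν : ΓE'} {Z Z' : TSec A.l}
    (hZ : IsVerticalLift μ Z) (hZ' : IsVerticalLift ν Z') :
    (liftedAlgebroid Dl Dr R).B Z Z' = 0 := by
  obtain ⟨h1, h2⟩ := (isVerticalLift_iff Dl).1 hZ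
  obtain ⟨h1', h2'⟩ := (isVerticalLift_iff Dl).1 hZ'
  refine parts_injective Dl ?_ ?_
  · rw [liftedAlgebroid_bracket_horPart, bracketHor, h1, h1', nabla_zero, nabla_zero, sub_zero]
    exact horPart_zero.symm
  · rw [liftedAlgebroid_bracket_vertPart, bracketVert, h2, h2', nabla_pullDual_vert _ Dl h1,
      nabla_pullDual_vert _ Dr h1', tensorPart_vertical_left R h1 Z', sub_zero, add_zero]
    exact (vertPart_zero Dl).symm

theorem isLifted_liftedAlgebroid (hD : ∀ σ σ', A.B σ σ' = Dl.D σ σ' - Dr.D σ' σ) :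
    IsLifted A Dl Dr R (liftedAlgebroid Dl Dr R) where
  left_anchor _ _ := rfl
  right_anchor _ _ := rfl
  bracket_hh _ _ _ _ hZ hZ' := liftedAlgebroid_bracket_hh Dl Dr R hD hZ hZ'
  bracket_hv _ _ _ _ hZ hZ' := liftedAlgebroid_bracket_hv Dl Dr R hZ hZ'
  bracket_vh _ _ _ _ hZ hZ' := liftedAlgebroid_bracket_vh Dl Dr R hZ hZ'
  bracket_vv _ _ _ _ hZ hZ' := liftedAlgebroid_bracket_vv Dl Dr R hZ hZ'

/-! ### Uniqueness of the lifted structure -/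

variable {Dl Dr R} {T T' : Algebroid (leftTangentSections A.l)}

theorem IsLifted.l_eq (hT : IsLifted A Dl Dr R T) : T.l = leftAnchor A.l :=
  Anchor.ext (funext fun κ => LinearMap.ext fun z => hT.left_anchor κ z)

theorem IsLifted.r_eq (hT : IsLifted A Dl Dr R T) : T.r = rightAnchor Dl Dr :=
  Anchor.ext (funext fun κ => LinearMap.ext fun z => hT.right_anchor κ z)

theorem bracket_eq_of_lifts_right (D : Connection A.l) (hl : T.l = T'.l) {Z : TSec A.l}
    (h1 : ∀ σ, T.B Z (horLift D σ) = T'.B Z (horLift D σ))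
    (h2 : ∀ ν, T.B Z (vertLift D ν) = T'.B Z (vertLift D ν)) (Z' : TSec A.l) :
    T.B Z Z' = T'.B Z Z' :=
  sub_eq_zero.1 (endomorphism_eq_zero_of_lifts D (bracketSubRight hl Z)
    (fun σ => sub_eq_zero.2 (h1 σ)) (fun ν => sub_eq_zero.2 (h2 ν)) Z')

theorem bracket_eq_of_lifts_left (D : Connection A.l) (hr : T.r = T'.r) {Z' : TSec A.l}
    (h1 : ∀ σ, T.B (horLift D σ) Z' = T'.B (horLift D σ) Z')
    (h2 : ∀ ν, T.B (vertLift D ν) Z' = T'.B (vertLift D ν) Z') (Z : TSec A.l) :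
    T.B Z Z' = T'.B Z Z' :=
  sub_eq_zero.1 (endomorphism_eq_zero_of_lifts D (bracketSubLeft hr Z')
    (fun σ => sub_eq_zero.2 (h1 σ)) (fun ν => sub_eq_zero.2 (h2 ν)) Z)

theorem IsVerticalLift.unique {ν : ΓE'} {Z Z' : ΓT} (h : IsVerticalLift ν Z)
    (h' : IsVerticalLift ν Z') : Z = Z' :=
  SectionModule.ext_apply fun κ => Subtype.ext ((h κ).trans (h' κ).symm)

theorem IsLifted.unique (hT : IsLifted A Dl Dr R T) (hT' : IsLifted A Dl Dr R T') : T = T' := by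
  have hl := hT.l_eq.trans hT'.l_eq.symm
  have hr := hT.r_eq.trans hT'.r_eq.symm
  refine Algebroid.ext hl hr (LinearMap.ext fun Z => LinearMap.ext fun Z' =>
    bracket_eq_of_lifts_left Dl hr
      (fun σ => bracket_eq_of_lifts_right Dl hl (fun σ' => ?_) (fun ν => ?_) Z')
      (fun μ => bracket_eq_of_lifts_right Dl hl (fun σ' => ?_) (fun ν => ?_) Z') Z)
  · have h1 := isHorizontalLift_horLift Dl σ
    have h2 := isHorizontalLift_horLift Dl σ'
    exact SectionModule.ext_apply fun κ => Subtype.ext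
      ((hT.bracket_hh σ σ' _ _ h1 h2 κ).trans (hT'.bracket_hh σ σ' _ _ h1 h2 κ).symm)
  · have h1 := isHorizontalLift_horLift Dl σ
    have h2 := isVerticalLift_vertLift Dl ν
    exact (hT.bracket_hv σ ν _ _ h1 h2).unique (hT'.bracket_hv σ ν _ _ h1 h2)
  · have h1 := isVerticalLift_vertLift Dl μ
    have h2 := isHorizontalLift_horLift Dl σ'
    exact (hT.bracket_vh μ σ' _ _ h1 h2).unique (hT'.bracket_vh μ σ' _ _ h1 h2)
  · have h1 := isVerticalLift_vertLift Dl μ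
    have h2 := isVerticalLift_vertLift Dl ν
    exact (hT.bracket_vv μ ν _ _ h1 h2).trans (hT'.bracket_vv μ ν _ _ h1 h2).symm

end LiftedStructure

/-! ### The symplectic section -/

section Symplectic

section components

variable {ρ : Anchor (bundleSections 𝓘(ℝ, EB) F V)}

local notation "ΓT" => TSec ρ

theorem liouville_eq_along (Z : ΓT) : liouville ρ Z = along hatLin Z := by
  refine ContMDiffMap.ext fun κ => ?_
  obtain ⟨σ, hσ⟩ := exists_sec (EB := EB) (F := F) κ.proj (Z.1 κ).1.1
  rw [along_apply, ← hσ, alongFun_sec, hatLin_apply, hatFun_apply, hσ]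
  rfl

theorem liouville_of_horPart {Z : ΓT} {σ : ΓE} (h : horPart Z = evalHat σ) :
    liouville ρ Z = hatFun σ := by
  rw [liouville_eq_along, along_of_horPart h, hatLin_apply]

theorem liouville_of_horPart_zero {Z : ΓT} (h : horPart Z = 0) : liouville ρ Z = 0 := by
  rw [liouville_eq_along, along_of_horPart_zero h]

/-- The vertical component in the direction `γ`, as a section of the dual bundle. -/
def vertPartLin (D : Connection ρ) (γ : ΓE) : (leftTangentSections ρ).DualSec where
  toFun Z := vertPart D Z γ
  map_add' Z Z' := by rw [vertPart_add, LinearMap.add_apply]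
  map_smul' g Z := by rw [vertPart_smul, LinearMap.smul_apply, RingHom.id_apply]

theorem vertPartLin_apply (D : Connection ρ) (γ : ΓE) (Z : ΓT) :
    vertPartLin D γ Z = vertPart D Z γ := rfl

/-- A section whose two components vanish at a point vanishes at this point. -/
theorem apply_eq_zero_of_parts (D : Connection ρ) {Z : ΓT} {κ : DualTotal F V}
    (h1 : ∀ ν, horPart Z ν κ = 0) (h2 : ∀ γ, vertPart D Z γ κ = 0) : Z.1 κ = 0 := by
  have h : ((pull (frameCut EB F V κ.proj) : CE) • Z).1 κ = Z.1 κ := by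
    rw [SectionModule.smul_apply, pull_apply, frameCut_self, one_smul]
  rw [← h, lift_expansion D, SectionModule.add_apply, SectionModule.sum_apply,
    SectionModule.sum_apply]
  simp only [SectionModule.smul_apply, h1, h2, zero_smul, Finset.sum_const_zero, add_zero]

end components

variable {A : Algebroid (bundleSections 𝓘(ℝ, EB) F V)} {Dl : Connection A.l} {Dr : Connection A.r}
  {R : (bundleSections 𝓘(ℝ, EB) F V).Tensor13} {T : Algebroid (leftTangentSections A.l)}

theorem IsLifted.omega_hh (hT : IsLifted A Dl Dr R T)
    (hD : ∀ σ σ', A.B σ σ' = Dl.D σ σ' - Dr.D σ' σ) (σ σ' : ΓE) :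
    T.omega (liouville A.l) (horLift Dl σ) (horLift Dl σ') = 0 := by
  have hB : horPart (T.B (horLift Dl σ) (horLift Dl σ')) = evalHat (A.B σ σ') :=
    horPart_eq_evalHat_iff.2 fun κ => congrArg Prod.fst
      (hT.bracket_hh σ σ' _ _ (isHorizontalLift_horLift Dl σ) (isHorizontalLift_horLift Dl σ') κ)
  rw [Algebroid.omega_apply, liouville_of_horPart hB,
    liouville_of_horPart (horPart_horLift Dl σ), liouville_of_horPart (horPart_horLift Dl σ'),
    hT.l_eq, hT.r_eq, leftAnchor_hat Dl, rightAnchor_hat, vertPart_horLift, vertPart_horLift,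
    along_of_horPart (horPart_horLift Dl σ), along_of_horPart (horPart_horLift Dl σ'),
    connHat_apply, connHat_apply, hD]
  refine ContMDiffMap.ext fun κ => ?_
  have h : hatFun (Dl.D σ σ' - Dr.D σ' σ) κ = hatFun (Dl.D σ σ') κ - hatFun (Dr.D σ' σ) κ :=
    map_sub κ.2 _ _
  change -((0 + hatFun (Dl.D σ σ') κ) - (0 + hatFun (Dr.D σ' σ) κ) -
    hatFun (Dl.D σ σ' - Dr.D σ' σ) κ) = 0
  rw [h]
  ring

theorem IsLifted.omega_hv (hT : IsLifted A Dl Dr R T) (σ : ΓE) (ν : ΓE') :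
    T.omega (liouville A.l) (horLift Dl σ) (vertLift Dl ν) = pull (ν σ) := by
  have hB := ((isVerticalLift_iff Dl).1 (hT.bracket_hv σ ν _ _ (isHorizontalLift_horLift Dl σ)
    (isVerticalLift_vertLift Dl ν))).1
  rw [Algebroid.omega_apply, liouville_of_horPart_zero hB,
    liouville_of_horPart (horPart_horLift Dl σ), liouville_of_horPart_zero (horPart_vertLift Dl ν),
    hT.r_eq, rightAnchor_hat, vertPart_vertLift, Anchor.deriv_zero_right,
    along_of_horPart_zero (horPart_vertLift Dl ν), pullDual_apply, add_zero, zero_sub, sub_zero,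
    neg_neg]

theorem IsLifted.omega_vh (hT : IsLifted A Dl Dr R T) (ν : ΓE') (σ : ΓE) :
    T.omega (liouville A.l) (vertLift Dl ν) (horLift Dl σ) = -pull (ν σ) := by
  have hB := ((isVerticalLift_iff Dl).1 (hT.bracket_vh ν σ _ _ (isVerticalLift_vertLift Dl ν)
    (isHorizontalLift_horLift Dl σ))).1
  rw [Algebroid.omega_apply, liouville_of_horPart_zero hB,
    liouville_of_horPart (horPart_horLift Dl σ), liouville_of_horPart_zero (horPart_vertLift Dl ν),
    hT.l_eq, leftAnchor_hat Dl, vertPart_vertLift, Anchor.deriv_zero_right,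
    along_of_horPart_zero (horPart_vertLift Dl ν), pullDual_apply, add_zero, sub_zero, sub_zero]

theorem IsLifted.omega_vv (hT : IsLifted A Dl Dr R T) (μ ν : ΓE') :
    T.omega (liouville A.l) (vertLift Dl μ) (vertLift Dl ν) = 0 := by
  rw [Algebroid.omega_apply, hT.bracket_vv μ ν _ _ (isVerticalLift_vertLift Dl μ)
    (isVerticalLift_vertLift Dl ν), map_zero, liouville_of_horPart_zero (horPart_vertLift Dl μ),
    liouville_of_horPart_zero (horPart_vertLift Dl ν), Anchor.deriv_zero_right,
    Anchor.deriv_zero_right, sub_zero, sub_zero, neg_zero]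

theorem IsLifted.omega_horLift (hT : IsLifted A Dl Dr R T)
    (hD : ∀ σ σ', A.B σ σ' = Dl.D σ σ' - Dr.D σ' σ) (σ : ΓE) :
    T.omega (liouville A.l) (horLift Dl σ) = vertPartLin Dl σ :=
  lifts_ext Dl
    (fun σ' => by
      rw [hT.omega_hh hD, vertPartLin_apply, vertPart_horLift, LinearMap.zero_apply])
    fun ν => by
      rw [hT.omega_hv, vertPartLin_apply, vertPart_vertLift, pullDual_apply]

theorem IsLifted.omega_vertLift (hT : IsLifted A Dl Dr R T) (ν : ΓE') :
    T.omega (liouville A.l) (vertLift Dl ν) = -along (pullDual ν) :=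
  lifts_ext Dl
    (fun σ => by
      rw [hT.omega_vh, LinearMap.neg_apply, ← horPart_apply, horPart_horLift, evalHat_apply])
    fun ν' => by
      rw [hT.omega_vv, LinearMap.neg_apply, ← horPart_apply, horPart_vertLift,
        LinearMap.zero_apply, neg_zero]

theorem IsLifted.omega_flip_horLift (hT : IsLifted A Dl Dr R T)
    (hD : ∀ σ σ', A.B σ σ' = Dl.D σ σ' - Dr.D σ' σ) (σ : ΓE) :
    (T.omega (liouville A.l)).flip (horLift Dl σ) = -vertPartLin Dl σ :=
  lifts_ext Dl
    (fun σ' => by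
      rw [LinearMap.flip_apply, hT.omega_hh hD, LinearMap.neg_apply, vertPartLin_apply,
        vertPart_horLift, LinearMap.zero_apply, neg_zero])
    fun ν => by
      rw [LinearMap.flip_apply, hT.omega_vh, LinearMap.neg_apply, vertPartLin_apply,
        vertPart_vertLift, pullDual_apply]

theorem IsLifted.omega_flip_vertLift (hT : IsLifted A Dl Dr R T) (ν : ΓE') :
    (T.omega (liouville A.l)).flip (vertLift Dl ν) = along (pullDual ν) :=
  lifts_ext Dl
    (fun σ => by
      rw [LinearMap.flip_apply, hT.omega_hv, ← horPart_apply, horPart_horLift, evalHat_apply])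
    fun ν' => by
      rw [LinearMap.flip_apply, hT.omega_vv, ← horPart_apply, horPart_vertLift,
        LinearMap.zero_apply]

theorem IsLifted.omega_apply_horLift (hT : IsLifted A Dl Dr R T)
    (hD : ∀ σ σ', A.B σ σ' = Dl.D σ σ' - Dr.D σ' σ) (Z : TSec A.l) (σ : ΓE) :
    T.omega (liouville A.l) Z (horLift Dl σ) = -vertPart Dl Z σ :=
  LinearMap.congr_fun (hT.omega_flip_horLift hD σ) Z

theorem IsLifted.omega_apply_vertLift (hT : IsLifted A Dl Dr R T) (Z : TSec A.l) (ν : ΓE') :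
    T.omega (liouville A.l) Z (vertLift Dl ν) = horPart Z ν :=
  LinearMap.congr_fun (hT.omega_flip_vertLift ν) Z

theorem IsLifted.omega_skew (hT : IsLifted A Dl Dr R T)
    (hD : ∀ σ σ', A.B σ σ' = Dl.D σ σ' - Dr.D σ' σ) (X Y : TSec A.l) :
    T.omega (liouville A.l) X Y = -T.omega (liouville A.l) Y X := by
  have h : (T.omega (liouville A.l)).flip Y = -T.omega (liouville A.l) Y :=
    lifts_ext Dl
      (fun σ => by
        rw [LinearMap.flip_apply, hT.omega_horLift hD, LinearMap.neg_apply,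
          hT.omega_apply_horLift hD, neg_neg, vertPartLin_apply])
      fun ν => by
        rw [LinearMap.flip_apply, hT.omega_vertLift, LinearMap.neg_apply, LinearMap.neg_apply,
          hT.omega_apply_vertLift, horPart_apply]
  exact LinearMap.congr_fun h X

theorem IsLifted.omega_nondegenerate (hT : IsLifted A Dl Dr R T)
    (hD : ∀ σ σ', A.B σ σ' = Dl.D σ σ' - Dr.D σ' σ) (κ : DualTotal F V) (X : TSec A.l)
    (hX : ∀ Y, T.omega (liouville A.l) X Y κ = 0) : X.1 κ = 0 := by
  refine apply_eq_zero_of_parts Dl (fun ν => ?_) fun γ => ?_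
  · rw [← hT.omega_apply_vertLift, hX]
  · have h := hX (horLift Dl γ)
    rw [hT.omega_apply_horLift hD] at h
    exact neg_eq_zero.1 h

theorem IsLifted.isExactSymplectic (hT : IsLifted A Dl Dr R T)
    (hD : ∀ σ σ', A.B σ σ' = Dl.D σ σ' - Dr.D σ' σ) : T.IsExactSymplectic (liouville A.l) :=
  ⟨hT.omega_skew hD, hT.omega_nondegenerate hD⟩

theorem IsLifted.flat_injective (hT : IsLifted A Dl Dr R T)
    (hD : ∀ σ σ', A.B σ σ' = Dl.D σ σ' - Dr.D σ' σ) :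
    Function.Injective (T.flat (liouville A.l)) := by
  refine (injective_iff_map_eq_zero _).2 fun X hX => SectionModule.ext_apply fun κ =>
    hT.omega_nondegenerate hD κ X fun Y => ?_
  exact congrArg (fun θ : (leftTangentSections A.l).DualSec => θ Y κ) hX

/-- The values of a section of the dual bundle on vertical lifts. -/
def dualOnVert (D : Connection A.l) (θ : (leftTangentSections A.l).DualSec) : ΓE' →ₗ[CQ] CE where
  toFun ν := θ (vertLift D ν)
  map_add' ν ν' := by rw [vertLift_add, map_add]
  map_smul' f ν := by rw [vertLift_smul, map_smul]; rfl

/-- The values of a section of the dual bundle on horizontal lifts. -/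
def dualOnHor (D : Connection A.l) (θ : (leftTangentSections A.l).DualSec) : ΓE⋆ where
  toFun σ := θ (horLift D σ)
  map_add' σ σ' := by rw [horLift_add, map_add]
  map_smul' f σ := by rw [horLift_smul, map_smul]; rfl

theorem IsLifted.flat_surjective (hT : IsLifted A Dl Dr R T)
    (hD : ∀ σ σ', A.B σ σ' = Dl.D σ σ' - Dr.D σ' σ) :
    Function.Surjective (T.flat (liouville A.l)) := by
  intro θ
  refine ⟨ofParts Dl (dualOnVert Dl θ) (-dualOnHor Dl θ), lifts_ext Dl (fun σ => ?_) fun ν => ?_⟩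
  · refine (hT.omega_apply_horLift hD _ σ).trans ?_
    rw [vertPart_ofParts, LinearMap.neg_apply, neg_neg]
    rfl
  · refine (hT.omega_apply_vertLift _ ν).trans ?_
    rw [horPart_ofParts]
    rfl

end Symplectic

section InducedTensor

/-! ### The induced tensor -/

/-- The restriction of a covector on the dual bundle to the vertical vectors, as an element of the
fibre of `E`. -/
def covectorVert (κ : DualTotal F V) : Module.Dual ℝ (DualTangent (EB := EB) κ) →ₗ[ℝ] V κ.proj :=
  ∑ i, (Module.Dual.eval ℝ (DualTangent (EB := EB) κ)
    (vlift (coframe EB F V κ.proj i) κ)).smulRight ((frame EB F V κ.proj i).1 κ.proj)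

theorem covectorVert_apply (κ : DualTotal F V) (α : Module.Dual ℝ (DualTangent (EB := EB) κ)) :
    covectorVert κ α =
      ∑ i, α (vlift (coframe EB F V κ.proj i) κ) • (frame EB F V κ.proj i).1 κ.proj := by
  rw [covectorVert, LinearMap.sum_apply]
  rfl

theorem covectorVert_pull (κ : DualTotal F V) (f : CQ) :
    covectorVert κ (covec (I := dualModel EB F) (pull f) κ) = 0 := by
  rw [covectorVert_apply]
  exact Finset.sum_eq_zero fun i _ => by rw [(vlift_spec _ κ).1, zero_smul]

theorem covectorVert_hat (κ : DualTotal F V) (γ : ΓE) :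
    covectorVert κ (covec (I := dualModel EB F) (hatFun γ) κ) = γ.1 κ.proj := by
  rw [covectorVert_apply]
  have h := congrArg (fun s : ΓE => s.1 κ.proj) (frame_expansion (EB := EB) κ.proj γ)
  have h1 : (frameCut EB F V κ.proj • γ).1 κ.proj = γ.1 κ.proj := by
    rw [SectionModule.smul_apply, frameCut_self, one_smul]
  refine Eq.trans ?_ (h.trans h1)
  rw [SectionModule.sum_apply]
  exact Finset.sum_congr rfl fun i _ => by rw [(vlift_spec _ κ).2]; rfl

/-- The pairing with the vertical part of a covector is its value on the vertical lift. -/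
theorem alongFun_covectorVert (κ : DualTotal F V) (ν : ΓE')
    (α : Module.Dual ℝ (DualTangent (EB := EB) κ)) :
    alongFun (pullDual ν) κ (covectorVert κ α) = α (vlift ν κ) := by
  have h0 : alongFun (pullDual ν) κ 0 = 0 := by
    rw [← zero_smul ℝ (0 : V κ.proj), alongFun_smul, zero_mul]
  obtain ⟨f, γ, rfl⟩ := exists_covec_eq κ α
  rw [map_add, covectorVert_pull, zero_add, covectorVert_hat, alongFun_sec, LinearMap.add_apply,
    (vlift_spec ν κ).1, (vlift_spec ν κ).2, zero_add]
  rfl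

/-- The tensor `(α, β) ↦ α(β^{Dr h}) - β(α^{Dl h})`, in which a covector is lifted horizontally
through its vertical part. -/
def inducedTensor {ρ ρ' : Anchor (bundleSections 𝓘(ℝ, EB) F V)} (Dl : Connection ρ)
    (Dr : Connection ρ') : Tensor20 EB F V := fun κ =>
  LinearMap.mk₂ ℝ (fun α β => α (hliftLin Dr κ (covectorVert κ β)) -
      β (hliftLin Dl κ (covectorVert κ α)))
    (fun α α' β => by
      rw [LinearMap.add_apply, map_add, map_add, map_add, add_sub_add_comm])
    (fun r α β => by
      rw [LinearMap.smul_apply, map_smul, map_smul, map_smul, smul_sub])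
    (fun α β β' => by
      rw [LinearMap.add_apply, map_add, map_add, map_add, add_sub_add_comm])
    (fun r α β => by
      rw [LinearMap.smul_apply, map_smul, map_smul, map_smul, smul_sub])

theorem inducedTensor_apply {ρ ρ' : Anchor (bundleSections 𝓘(ℝ, EB) F V)} (Dl : Connection ρ)
    (Dr : Connection ρ') (κ : DualTotal F V) (α β : Module.Dual ℝ (DualTangent (EB := EB) κ)) :
    inducedTensor Dl Dr κ α β =
      α (Dr.hlift κ (covectorVert κ β)) - β (Dl.hlift κ (covectorVert κ α)) := rfl

variable {A : Algebroid (bundleSections 𝓘(ℝ, EB) F V)} {Dl : Connection A.l} {Dr : Connection A.r}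

theorem isInducedTensor_inducedTensor (hD : ∀ σ σ', A.B σ σ' = Dl.D σ σ' - Dr.D σ' σ) :
    IsInducedTensor A (inducedTensor Dl Dr) where
  lin_lin σ σ' κ := by
    have h : hatFun (A.B σ σ') κ = hatFun (Dl.D σ σ') κ - hatFun (Dr.D σ' σ) κ := by
      rw [hD]
      exact map_sub κ.2 _ _
    change inducedTensor Dl Dr κ (covec (I := dualModel EB F) (hatFun σ) κ)
      (covec (I := dualModel EB F) (hatFun σ') κ) = -hatFun (A.B σ σ') κ
    rw [inducedTensor_apply, covectorVert_hat, covectorVert_hat, (Dl.hlift_spec κ σ).2,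
      (Dr.hlift_spec κ σ').2, h, neg_sub]
  lin_base σ f' κ := by
    change inducedTensor Dl Dr κ (covec (I := dualModel EB F) (hatFun σ) κ)
      (covec (I := dualModel EB F) (pull f') κ) = -A.l.deriv σ f' κ.proj
    rw [inducedTensor_apply, covectorVert_hat, covectorVert_pull, hlift_zero, map_zero,
      (Dl.hlift_spec κ σ).1, zero_sub]
  base_lin f σ' κ := by
    change inducedTensor Dl Dr κ (covec (I := dualModel EB F) (pull f) κ)
      (covec (I := dualModel EB F) (hatFun σ') κ) = A.r.deriv σ' f κ.proj
    rw [inducedTensor_apply, covectorVert_hat, covectorVert_pull, hlift_zero, map_zero,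
      (Dr.hlift_spec κ σ').1, sub_zero]
  base_base f f' κ := by
    change inducedTensor Dl Dr κ (covec (I := dualModel EB F) (pull f) κ)
      (covec (I := dualModel EB F) (pull f') κ) = 0
    rw [inducedTensor_apply, covectorVert_pull, covectorVert_pull, hlift_zero, hlift_zero, map_zero,
      map_zero, sub_zero]

theorem IsInducedTensor.unique {P P' : Tensor20 EB F V} (h : IsInducedTensor A P)
    (h' : IsInducedTensor A P') : P = P' :=
  funext fun κ => covec_ext
    (fun f => covec_ext
      (fun f' => (h.base_base f f' κ).trans (h'.base_base f f' κ).symm)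
      fun γ' => (h.base_lin f γ' κ).trans (h'.base_lin f γ' κ).symm)
    fun γ => covec_ext
      (fun f' => (h.lin_base γ f' κ).trans (h'.lin_base γ f' κ).symm)
      fun γ' => (h.lin_lin γ γ' κ).trans (h'.lin_lin γ γ' κ).symm

/-! ### Hamiltonian vector fields -/

theorem covec_hamiltonianField (P : Tensor20 EB F V) (H : DualTotal F V → ℝ) (κ : DualTotal F V)
    (β : Module.Dual ℝ (DualTangent (EB := EB) κ)) :
    β (hamiltonianField P H κ) = -P κ (covec H κ) β := by
  rw [hamiltonianField, map_neg]
  exact congrArg Neg.neg (Module.apply_evalEquiv_symm_apply ℝ _ β _)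

variable {R : (bundleSections 𝓘(ℝ, EB) F V).Tensor13} {T : Algebroid (leftTangentSections A.l)}

theorem rightAnchor_deriv_vertLift (ν : ΓE') (H : CE) (κ : DualTotal F V) :
    (rightAnchor Dl Dr).deriv (vertLift Dl ν) H κ =
      covec (I := dualModel EB F) H κ (vlift ν κ) := by
  have h := isVerticalLift_vertLift Dl ν κ
  have h1 : ((vertLift Dl ν).1 κ).1.1 = 0 := congrArg Prod.fst h
  have h2 : ((vertLift Dl ν).1 κ).1.2 = vlift ν κ := congrArg Prod.snd h
  refine (covec_rightAnchorFun Dl Dr (vertLift Dl ν) H κ).trans ?_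
  rw [h1, hlift_zero, hlift_zero, map_zero, sub_zero, add_zero, ← h2]
  rfl

theorem rightAnchor_deriv_horLift (σ : ΓE) (H : CE) (κ : DualTotal F V) :
    (rightAnchor Dl Dr).deriv (horLift Dl σ) H κ =
      covec (I := dualModel EB F) H κ (Dr.hlift κ (σ.1 κ.proj)) := by
  have h := isHorizontalLift_horLift Dl σ κ
  have h1 : ((horLift Dl σ).1 κ).1.1 = σ.1 κ.proj := congrArg Prod.fst h
  have h2 : ((horLift Dl σ).1 κ).1.2 = Dl.hlift κ (σ.1 κ.proj) := congrArg Prod.snd h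
  refine (covec_rightAnchorFun Dl Dr (horLift Dl σ) H κ).trans ?_
  rw [h1, ← h2]
  refine (congrArg (· + _) (sub_self _)).trans (zero_add _)

/-- The section that `♭` sends to the right differential of a function projects to the Hamiltonian
vector field of this function. -/
theorem IsLifted.field_eq_of_flat (hT : IsLifted A Dl Dr R T)
    (hD : ∀ σ σ', A.B σ σ' = Dl.D σ σ' - Dr.D σ' σ) {H : CE} {Z : TSec A.l}
    (hZ : T.flat (liouville A.l) Z = T.dr H) (κ : DualTotal F V) :
    (Z.1 κ).1.2 = hamiltonianField (inducedTensor Dl Dr) H κ := by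
  have hv (θ : TSec A.l) : T.omega (liouville A.l) Z θ = (rightAnchor Dl Dr).deriv θ H := by
    rw [← hT.r_eq]
    exact LinearMap.congr_fun hZ θ
  have h1 (ν : ΓE') : horPart Z ν κ = covec (I := dualModel EB F) H κ (vlift ν κ) := by
    rw [← hT.omega_apply_vertLift, hv, rightAnchor_deriv_vertLift]
  have h2 (γ : ΓE) : vertPart Dl Z γ κ =
      -covec (I := dualModel EB F) H κ (Dr.hlift κ (γ.1 κ.proj)) := by
    have h := hv (horLift Dl γ)
    rw [hT.omega_apply_horLift hD, neg_eq_iff_eq_neg] at h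
    rw [h, ← rightAnchor_deriv_horLift (Dl := Dl)]
    rfl
  have h3 : (Z.1 κ).1.1 = covectorVert κ (covec (I := dualModel EB F) H κ) :=
    vec_ext (EB := EB) fun ν => (h1 ν).trans (alongFun_covectorVert κ ν _).symm
  refine tangent_ext (fun f => ?_) fun γ => ?_
  · rw [covec_hamiltonianField, inducedTensor_apply, covectorVert_pull, hlift_zero, map_zero,
      zero_sub, neg_neg, hlift_pull, ← h3]
    exact congrArg (fun g : CE => g κ) (leftAnchor_pull Z f)
  · rw [covec_hamiltonianField, inducedTensor_apply, covectorVert_hat, hlift_hat, ← h3, neg_sub,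
      sub_eq_add_neg, ← h2, add_comm]
    exact congrArg (fun g : CE => g κ) (leftAnchor_hat Dl Z γ)

theorem IsLifted.leftRightHamiltonianField_eq (hT : IsLifted A Dl Dr R T)
    (hD : ∀ σ σ', A.B σ σ' = Dl.D σ σ' - Dr.D σ' σ) {P : Tensor20 EB F V}
    (hP : IsInducedTensor A P) (H : CE) :
    (T.leftRightHamiltonianField (liouville A.l) H).1 = hamiltonianField P H := by
  rw [hP.unique (isInducedTensor_inducedTensor hD)]
  refine funext fun κ => ?_
  rw [← hT.field_eq_of_flat hD (Function.invFun_eq (hT.flat_surjective hD (T.dr H))) κ]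
  exact hT.left_anchor κ _

end InducedTensor

end DualBundle

end LeibnizAlgebroid

end

open LeibnizAlgebroid in
theorem mainTheorem2
    {EB : Type*} [NormedAddCommGroup EB] [NormedSpace ℝ EB] [FiniteDimensional ℝ EB]
    {Q : Type*} [TopologicalSpace Q] [T2Space Q] [SigmaCompactSpace Q]
    [ChartedSpace EB Q] [IsManifold 𝓘(ℝ, EB) ∞ Q]
    {F : Type*} [NormedAddCommGroup F] [NormedSpace ℝ F] [FiniteDimensional ℝ F]
    {V : Q → Type*} [∀ x, AddCommGroup (V x)] [∀ x, Module ℝ (V x)]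
    [∀ x, TopologicalSpace (V x)] [TopologicalSpace (TotalSpace F V)]
    [FiberBundle F V] [VectorBundle ℝ F V] [ContMDiffVectorBundle ∞ F V 𝓘(ℝ, EB)]
    (A : Algebroid (bundleSections 𝓘(ℝ, EB) F V)) :
    -- the induced tensor exists and is unique
    (∃! P : Tensor20 EB F V, IsInducedTensor A P) ∧
    -- connections decomposing the bracket exist
    (∃ (Dl : Connection A.l) (Dr : Connection A.r),
      ∀ σ σ', A.B σ σ' = Dl.D σ σ' - Dr.D σ' σ) ∧
    -- for every choice of the connections and of the tensor of type (1, 3)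
    ∀ (Dl : Connection A.l) (Dr : Connection A.r),
      (∀ σ σ', A.B σ σ' = Dl.D σ σ' - Dr.D σ' σ) →
      ∀ R : (bundleSections 𝓘(ℝ, EB) F V).Tensor13,
        (∃! T : Algebroid (leftTangentSections A.l), IsLifted A Dl Dr R T) ∧
        ∀ (P : Tensor20 EB F V) (T : Algebroid (leftTangentSections A.l)),
          IsInducedTensor A P → IsLifted A Dl Dr R T →
            T.IsExactSymplectic (liouville A.l) ∧
            Function.Bijective (T.flat (liouville A.l)) ∧
            ∀ H : C^∞⟮dualModel EB F, DualTotal F V; 𝓘(ℝ, ℝ), ℝ⟯,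
              (T.leftRightHamiltonianField (liouville A.l) H).1 = hamiltonianField P H := by
  obtain ⟨Dl₀, Dr₀, hD₀⟩ := exists_connections A
  refine ⟨⟨inducedTensor Dl₀ Dr₀, isInducedTensor_inducedTensor hD₀,
    fun P hP => hP.unique (isInducedTensor_inducedTensor hD₀)⟩, ⟨Dl₀, Dr₀, hD₀⟩,
    fun Dl Dr hD R => ⟨⟨liftedAlgebroid Dl Dr R, isLifted_liftedAlgebroid Dl Dr R hD,
      fun T hT => hT.unique (isLifted_liftedAlgebroid Dl Dr R hD)⟩, fun P T hP hT =>
      ⟨hT.isExactSymplectic hD, ⟨hT.flat_injective hD, hT.flat_surjective hD⟩,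
        hT.leftRightHamiltonianField_eq hD hP⟩⟩⟩
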